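/- **Setting.** For strings $x,y$, let $\mathrm{ED}(x,y)$ be the smallest number of edits (insertion, deletion or replacement of one character) that turns $x$ into $y$. Let $c\ge 1$ be a constant, let $n,d,r\ge 1$ be integers, and let $\Sigma$ be a finite alphabet. All database and query strings have length at most $d$ over $\Sigma$, and $d=O(n)$, $|\Sigma|=O(n)$. Constants hidden in $O,\Omega,\Theta,\tilde O$ may depend on $c$ and on the constants in these two assumptions, but on nothing else. $\tilde O(g)$ means at most $C\,g\,(\log g)^{e}$ for constants $C,e$. The model is the unit-cost word RAM with words of $O(\log(3^r n^{1+1/c}+dn))$ bits, and space is counted in words. **The hash.** Let $p = \frac{1}{3\,(ncr)^{1/(cr)}}$ (so $(3p)^{cr}=\frac1{ncr}$), $p_a=\sqrt{p/(1+p)}$, $p_r=\sqrt p/(\sqrt{1+p}-\sqrt p)$ and $L=8d/(1-p_a)+6\log n$. Let $\$,\bot\notin\Sigma$. Given $\rho:(\Sigma\cup\{\$\})\times\{0,1,\dots\}\to[0,1)^2$, the hash $h_\rho(x)$ is obtained by scanning $x\$$ from its first character, starting from the empty output $s$. While the scan has not passed the end of $x\$$ and $|s|<L$, let $a$ be the current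 character and $(r_1,r_2)=\rho(a,|s|)$. If $r_1\le p_a$, append $\bot$ to $s$ and stay at the same character. If $r_1>p_a$ and $r_2\le p_r$, append $\bot$ and move to the next character. If $r_1>p_a$ and $r_2>p_r$, append $a$ and move to the next character. The output is $h_\rho(x)=s$. **Theorem.** There is a single word-RAM query program, the same for all $c,n,d,r,\Sigma$, such that for all parameters as above there are a random function $\rho$, numbers $p_1,p_2$, a number $R=\Theta(1/p_1)$, and a way of storing any database $S$ of $n$ strings, together with $R$ independent copies $\rho_1,\dots,\rho_R$ of $\rho$, with the following properties. 1. The values of $\rho$ at positions $k<L$ are uniformly distributed on a grid $\{0,\varepsilon,\dots,1-\varepsilon\}^2$ with $1/\varepsilon\ge n$ an integer. They are independent between positions, and pairwise independent between characters at the same position. 2. For all $x,y$ of length at most $d$: if $\mathrm{ED}(x,y)\le r$ then $\Pr[h_\rho(x)=h_\rho(y)]\ge p_1$, and if $\mathrm{ED}(x,y)\ge cr$ then $\Pr[h_\rho(x)=h_\rho(y)]\le p_2$. Here $p_1=\Omega(p^r)$ and $p_2=O(1/(ncr))$. 3. For every database $S$ the space, including the stored representation of $\rho_1,\dots,\rho_R$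 and the working memory of a query, is always $\tilde O(3^r n^{1+1/c}+dn)$. 4. For every $S$ and every query $q$, the query always halts. It returns some $y'\in S$ such that $\mathrm{ED}(q,y')\le cr$ and $h_{\rho_j}(q)=h_{\rho_j}(y')$ for some $j$, or reports that there is no such $y'$ when none exists. 5. For every $S$ and every $q$, the expected query time is $\tilde O(d\,3^r n^{1/c})$. 6. For every $S$ and every $q$, if some $y\in S$ has $\mathrm{ED}(q,y)\le r$, then with probability $>1/10$ the query returns, within time $\tilde O(d\,3^r n^{1/c})$, some $y'\in S$ with $\mathrm{ED}(q,y')\le cr$. The probabilities in 5 and 6 are over $\rho_1,\dots,\rho_R$, for fixed $S$ and $q$. -/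

import Mathlib

/-! ## Edit distance -/

/-- `Edit x y`: one insertion, deletion or replacement of a character turns `x` into `y`. -/
inductive Edit {α : Type} : List α → List α → Prop
  | insert (u v : List α) (a : α) : Edit (u ++ v) (u ++ a :: v)
  | delete (u v : List α) (a : α) : Edit (u ++ a :: v) (u ++ v)
  | replace (u v : List α) (a b : α) : Edit (u ++ a :: v) (u ++ b :: v)

/-- `Edits k x y`: some sequence of exactly `k` edits turns `x` into `y`. -/
inductive Edits {α : Type} : ℕ → List α → List α → Prop
  | nil (x : List α) : Edits 0 x x
  | cons {k : ℕ} {x y z : List α} : Edit x y → Edits k y z → Edits (k + 1) x z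

/-- Some number of edits always suffices, so the infimum in `editDist` is a minimum. -/
theorem exists_edits {α : Type} (x y : List α) : ∃ k, Edits k x y := by
  induction x with
  | nil =>
    have h : ∀ v u : List α, ∃ k, Edits k u (u ++ v) := by
      intro v
      induction v with
      | nil => intro u; exact ⟨0, by simpa using Edits.nil u⟩
      | cons a v ih =>
        intro u
        obtain ⟨k, hk⟩ := ih (u ++ [a])
        refine ⟨k + 1, Edits.cons (y := u ++ [a]) ?_ (by simpa using hk)⟩
        simpa using Edit.insert u [] a
    simpa using h y []
  | cons a x ih =>
    obtain ⟨k, hk⟩ := ih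
    exact ⟨k + 1, Edits.cons (by simpa using Edit.delete [] x a) hk⟩

/-- Edit distance: the smallest number of edits that turns `x` into `y`. -/
noncomputable def editDist {σ : ℕ} (x y : List (Fin σ)) : ℕ :=
  sInf {k | Edits k x y}

/-! ## Uniform probability on a finite set -/

/-- Probability of the event `E` when `ω` is drawn uniformly from `Ω`. -/
noncomputable def prob {Ω : Type} [Fintype Ω] (E : Ω → Prop) : ℝ :=
  (Nat.card {ω // E ω} : ℝ) / Fintype.card Ω

/-- Expected value of `T` when `ω` is drawn uniformly from `Ω`. -/
noncomputable def expect {Ω : Type} [Fintype Ω] (T : Ω → ℕ) : ℝ :=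
  (∑ ω, (T ω : ℝ)) / Fintype.card Ω

/-! ## The soft-O notation -/

/-- A quantity is `Õ(g)` if it is at most `softO C e g = C · g · (log g) ^ e` for constants `C`, `e`
(used for `g ≥ 3` only, where `log g ≥ 1`). -/
noncomputable def softO (C : ℝ) (e : ℕ) (g : ℝ) : ℝ :=
  C * g * Real.log g ^ e

/-! ## The word RAM -/

namespace WordRAM

/-- What a run is given: the word size, the query (read only), the stored data structure
(read only), and the number of cells of zero-initialised working memory. -/
structure Env where
  wordSize : ℕ
  input : List ℕ
  data : List ℕ
  scratch : ℕ

/-- Registers and working memory. -/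
structure State where
  reg : ℕ → ℕ
  mem : ℕ → ℕ

/-- Unit-cost instructions. The numbers `i j k` are names of registers, `v` is a literal. -/
inductive Instr
  | const (i v : ℕ)
  | add (i j k : ℕ)
  | sub (i j k : ℕ)
  | mul (i j k : ℕ)
  | div (i j k : ℕ)
  /-- register `i` receives the query character at the position held in register `j` -/
  | input (i j : ℕ)
  /-- register `i` receives the data structure's word at the address held in register `j` -/
  | data (i j : ℕ)
  /-- register `i` receives the working memory's word at the address held in register `j` -/
  | load (i j : ℕ)
  /-- the working memory's cell at the address held in register `i` receives register `j` -/
  | store (i j : ℕ)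

/-- Tests on two registers. -/
inductive Test
  | lt (i j : ℕ)
  | eq (i j : ℕ)

/-- Structured programs; `loop b P` is 'while `b`, do `P`'. A program is a finite object that mentions finitely many registers. -/
inductive Prog
  | skip
  | instr (a : Instr)
  | seq (P Q : Prog)
  | ite (b : Test) (P Q : Prog)
  | loop (b : Test) (P : Prog)

/-- Put `v`, reduced to the word size, into register `i`. -/
def State.setReg (E : Env) (s : State) (i v : ℕ) : State :=
  { s with reg := Function.update s.reg i (v % 2 ^ E.wordSize) }

/-- Effect of one instruction. Arithmetic is modulo `2 ^ wordSize` (subtraction stops at `0`,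
division rounds down); reads out of bounds give `0`, writes out of bounds have no effect. -/
def Instr.exec (E : Env) (s : State) : Instr → State
  | const i v => s.setReg E i v
  | add i j k => s.setReg E i (s.reg j + s.reg k)
  | sub i j k => s.setReg E i (s.reg j - s.reg k)
  | mul i j k => s.setReg E i (s.reg j * s.reg k)
  | div i j k => s.setReg E i (s.reg j / s.reg k)
  | input i j => s.setReg E i (E.input.getD (s.reg j) 0)
  | data i j => s.setReg E i (E.data.getD (s.reg j) 0)
  | load i j => s.setReg E i (s.mem (s.reg j))
  | store i j =>
      if s.reg i < E.scratch then { s with mem := Function.update s.mem (s.reg i) (s.reg j) } else s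

def Test.holds (s : State) : Test → Prop
  | lt i j => s.reg i < s.reg j
  | eq i j => s.reg i = s.reg j

/-- `Exec E P s t s'`: started in state `s`, the program `P` halts in state `s'` after exactly
`t` steps; every instruction and every evaluation of a test is one step. -/
inductive Exec (E : Env) : Prog → State → ℕ → State → Prop
  | skip (s : State) : Exec E .skip s 0 s
  | instr (a : Instr) (s : State) : Exec E (.instr a) s 1 (a.exec E s)
  | seq {P Q : Prog} {s s₁ s₂ : State} {t₁ t₂ : ℕ} :
      Exec E P s t₁ s₁ → Exec E Q s₁ t₂ s₂ → Exec E (.seq P Q) s (t₁ + t₂) s₂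
  | ite_true {b : Test} {P Q : Prog} {s s₁ : State} {t : ℕ} :
      b.holds s → Exec E P s t s₁ → Exec E (.ite b P Q) s (t + 1) s₁
  | ite_false {b : Test} {P Q : Prog} {s s₁ : State} {t : ℕ} :
      ¬ b.holds s → Exec E Q s t s₁ → Exec E (.ite b P Q) s (t + 1) s₁
  | loop_true {b : Test} {P : Prog} {s s₁ s₂ : State} {t₁ t₂ : ℕ} :
      b.holds s → Exec E P s t₁ s₁ → Exec E (.loop b P) s₁ t₂ s₂ →
        Exec E (.loop b P) s (t₁ + t₂ + 1) s₂
  | loop_false {b : Test} {P : Prog} {s : State} :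
      ¬ b.holds s → Exec E (.loop b P) s 1 s

/-- Initially register `0` holds the length of the query; all else is `0`. -/
def Env.init (E : Env) : State where
  reg := Function.update (fun _ => 0) 0 (E.input.length % 2 ^ E.wordSize)
  mem := fun _ => 0

/-- The answer in register `0`: `0` codes "no close string", `i + 1` codes the `i`-th database
string. -/
def State.Outputs {n : ℕ} (s : State) (out : Option (Fin n)) : Prop :=
  s.reg 0 = out.elim 0 (fun i => (i : ℕ) + 1)

/-- Run on `E` from the initial state, `P` halts after `t` steps with answer `out`. -/
def Answers {n : ℕ} (E : Env) (P : Prog) (t : ℕ) (out : Option (Fin n)) : Prop :=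
  ∃ s', Exec E P E.init t s' ∧ s'.Outputs out

end WordRAM

/-! ## The hash -/

/-- `p = 1 / (3 (ncr)^{1/(cr)})`, so that `(3p)^{cr} = 1 / (ncr)`. -/
noncomputable def hashP (n r : ℕ) (c : ℝ) : ℝ :=
  1 / (3 * ((n : ℝ) * c * r) ^ (1 / (c * r)))

noncomputable def hashPa (p : ℝ) : ℝ := √(p / (1 + p))

noncomputable def hashPr (p : ℝ) : ℝ := √p / (√(1 + p) - √p)

/-- Number of characters after which the hash is cut off: the least integer that is at least
`8d / (1 - p_a) + 6 log n`. -/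
noncomputable def hashLen (n d : ℕ) (p : ℝ) : ℕ :=
  ⌈8 * (d : ℝ) / (1 - hashPa p) + 6 * Real.log n⌉₊

/-- The scan. Input characters are `some a` with `a` in the alphabet, or `none` for the end marker
`$`. Output characters are `none` for `⊥`, or `some a` with `a` an input character.
Arguments: the number of characters that may still be written, the number `k` of characters
written so far, and the part of the input that is still to be scanned. -/
noncomputable def hashScan {σ : ℕ} (pa pr : ℝ) (ρ : Option (Fin σ) → ℕ → ℝ × ℝ) :
    ℕ → ℕ → List (Option (Fin σ)) → List (Option (Option (Fin σ)))
  | 0, _, _ => []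
  | _ + 1, _, [] => []
  | m + 1, k, a :: x =>
      open Classical in
      if (ρ a k).1 ≤ pa then none :: hashScan pa pr ρ m (k + 1) (a :: x)
      else if (ρ a k).2 ≤ pr then none :: hashScan pa pr ρ m (k + 1) x
      else some a :: hashScan pa pr ρ m (k + 1) x

/-- The hash `h_ρ(x)` with parameter `p`, for strings of length at most `d`. -/
noncomputable def editHash {σ : ℕ} (n d : ℕ) (p : ℝ) (ρ : Option (Fin σ) → ℕ → ℝ × ℝ)
    (x : List (Fin σ)) : List (Option (Option (Fin σ))) :=
  hashScan (hashPa p) (hashPr p) ρ (hashLen n d p) 0 (x.map some ++ [none])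

/-- The finite random family `h` is `(r, cr, p₁, p₂)`-sensitive for the edit distance
on strings of length at most `d`. -/
def IsSensitive {Ω β : Type} [Fintype Ω] {σ : ℕ} (h : Ω → List (Fin σ) → β) (d : ℕ)
    (r cr p₁ p₂ : ℝ) : Prop :=
  ∀ x y : List (Fin σ), x.length ≤ d → y.length ≤ d →
    ((editDist x y : ℝ) ≤ r → p₁ ≤ prob (fun ω => h ω x = h ω y)) ∧
    (cr ≤ (editDist x y : ℝ) → prob (fun ω => h ω x = h ω y) ≤ p₂)

/-! ## Hash-based data structures -/

/-- The data of a randomised static data structure for `n` strings over an alphabet of `σ`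
characters that is built from `copies` independent hash functions. Each hash function is given by
a seed drawn uniformly from `Fin seeds`, and the seed `s` determines the underlying function, with
values in the `grid × grid` points `(i / grid, j / grid)` of `[0,1)²`. -/
structure HashIndex (n σ : ℕ) where
  copies : ℕ
  seeds : ℕ
  grid : ℕ
  rnd : Fin seeds → Option (Fin σ) → ℕ → Fin grid × Fin grid
  wordSize : ℕ
  /-- number of words of working memory of a query -/
  scratch : ℕ
  /-- preprocessing: the words stored for a database and for the drawn seeds -/
  build : (Fin n → List (Fin σ)) → (Fin copies → Fin seeds) → List ℕ

namespace HashIndex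

variable {n σ : ℕ} (D : HashIndex n σ)

/-- The underlying function of a seed. -/
noncomputable def ρ (s : Fin D.seeds) (a : Option (Fin σ)) (k : ℕ) : ℝ × ℝ :=
  ((((D.rnd s a k).1 : ℕ) : ℝ) / D.grid, (((D.rnd s a k).2 : ℕ) : ℝ) / D.grid)

/-- The values of the underlying function at the first `ℓ` positions are uniform on the grid,
independent between positions, and pairwise independent between the characters at a position. -/
def IsUniform (ℓ : ℕ) : Prop :=
  ∀ a b : ℕ → Option (Fin σ), (∀ k, a k ≠ b k) → ∀ u v : ℕ → Fin D.grid × Fin D.grid,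
    prob (fun s : Fin D.seeds => ∀ k < ℓ, D.rnd s (a k) k = u k ∧ D.rnd s (b k) k = v k) =
      (1 / (D.grid : ℝ)) ^ (4 * ℓ)

/-- Number of words that the data structure occupies, including the working memory of a query. -/
def space (S : Fin n → List (Fin σ)) (ω : Fin D.copies → Fin D.seeds) : ℕ :=
  (D.build S ω).length + D.scratch

/-- The machine on which the query `q` is run. -/
def env (S : Fin n → List (Fin σ)) (ω : Fin D.copies → Fin D.seeds) (q : List (Fin σ)) :
    WordRAM.Env where
  wordSize := D.wordSize
  input := q.map Fin.val
  data := D.build S ω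
  scratch := D.scratch

/-- The database string `i` has edit distance at most `cr` from `q` and collides with `q` under at
least one of the drawn hash functions. -/
def IsHit (d : ℕ) (p cr : ℝ) (S : Fin n → List (Fin σ)) (ω : Fin D.copies → Fin D.seeds)
    (q : List (Fin σ)) (i : Fin n) : Prop :=
  (editDist q (S i) : ℝ) ≤ cr ∧
    ∃ j : Fin D.copies, editHash n d p (D.ρ (ω j)) q = editHash n d p (D.ρ (ω j)) (S i)

/-- `out` is what the search through the colliding strings returns: some hit, or `none` if there is
no hit. -/
def IsSearchResult (d : ℕ) (p cr : ℝ) (S : Fin n → List (Fin σ)) (ω : Fin D.copies → Fin D.seeds)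
    (q : List (Fin σ)) : Option (Fin n) → Prop
  | some i => D.IsHit d p cr S ω q i
  | none => ∀ i, ¬ D.IsHit d p cr S ω q i

end HashIndex

/-! At each position the random choices let the scan stay (write `⊥`), skip (write `⊥` and move on)
or keep (write the character and move on). The parameters make stay and skip equally likely, with
probability `p_a` each (`one_sub_hashPa_mul_hashPr`), and `p_a² / (1 - p_a²) = p`. Run the scan on
two strings in parallel. At equal characters both scans decide alike. At different characters the
outputs can go on agreeing only if neither scan keeps its character; this leaves stay/stay,
stay/skip, skip/stay and skip/skip, each of probability `p_a²` by pairwise independence. Stay/stay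
changes nothing, and given that it does not occur, the other three have probability `p` each. They
are the three branches of the Levenshtein recursion. Following an optimal branch gives collision
probability at least `p ^ ED` (`pow_lev_le_collide`). Since a surviving move lowers the distance by
at most one, the probability is at most `(3p) ^ ED` plus an error for the cut-off at length `L`
(`collide_le`). As `(3p)^{cr} = 1/(ncr)`, far strings collide with probability `O(1/(ncr))`.

The real randomness is replaced by affine functions modulo a prime `P > 45dn + σ`: values at two
distinct characters determine the two coefficients, which is exact pairwise independence. Rounding
the thresholds to multiples of `1/P` perturbs `p` by a factor `1 - 4/P` below and `1 + 1/d` above;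
over at most `d` edits this costs only a constant (`half_pow_le_prob`, `prob_le`).

The index keeps `R = ⌈2/p^r⌉` hash functions and, for each of them, the order of the database by
hash. A query finds its own hash by binary search and runs through the bucket, testing each string
with a banded dynamic program, until a hit appears. Each failed test is a far string that collides,
and at most `6` of these are expected per hash function (`sum_farCount_le`). This bounds the
expected time; Markov's inequality and the `R` independent chances of a collision with the close
string give the success probability (`exists_search`). The stray factors `r` and `log n` are
logarithmic in the bounds because `3^r` and `n^{1/c}` occur there.

The time bound is proved for an actual word RAM program, by a Hoare logic for total correctness with
step counts (`Runs`). It culminates in `exec_query`, a statement without probability: correctness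
for every seed, and a time bound in terms of the number of far colliding strings. -/

/-! ## Levenshtein recursion -/

section Lev

variable {α : Type} [DecidableEq α]

/-- The Levenshtein recursion for the edit distance. -/
def lev : List α → List α → ℕ
  | [], y => y.length
  | _ :: x, [] => x.length + 1
  | a :: x, b :: y =>
      min (lev x y + if a = b then 0 else 1) (min (lev x (b :: y) + 1) (lev (a :: x) y + 1))
termination_by x y => x.length + y.length

theorem lev_nil_left (y : List α) : lev [] y = y.length := by rw [lev]

theorem lev_nil_right (x : List α) : lev x [] = x.length := by
  cases x <;> rw [lev]
  rfl

theorem lev_cons_cons (a b : α) (x y : List α) : lev (a :: x) (b :: y) =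
    min (lev x y + if a = b then 0 else 1) (min (lev x (b :: y) + 1) (lev (a :: x) y + 1)) := by
  rw [lev]

theorem lev_comm (x y : List α) : lev x y = lev y x := by
  induction x generalizing y with
  | nil => rw [lev_nil_left, lev_nil_right]
  | cons a x ihx =>
    induction y with
    | nil => rw [lev_nil_left, lev_nil_right]
    | cons b y ihy =>
      rw [lev_cons_cons, lev_cons_cons, ihx, ihx, ihy]
      simp only [eq_comm (a := a)]
      omega

theorem lev_cons_left_le (a : α) (x y : List α) : lev (a :: x) y ≤ lev x y + 1 := by
  cases y with
  | nil => simp [lev_nil_right]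
  | cons b y => rw [lev_cons_cons]; omega

theorem lev_cons_right_le (a : α) (x y : List α) : lev x (a :: y) ≤ lev x y + 1 := by
  rw [lev_comm, lev_comm x]; exact lev_cons_left_le a y x

theorem lev_le_cons_left (a : α) (x y : List α) : lev x y ≤ lev (a :: x) y + 1 := by
  induction y with
  | nil => simp only [lev_nil_right, List.length_cons]; omega
  | cons b y ih =>
    have h := lev_cons_right_le b x y
    rw [lev_cons_cons]
    split_ifs <;> omega

theorem lev_le_cons_right (a : α) (x y : List α) : lev x y ≤ lev x (a :: y) + 1 := by
  rw [lev_comm, lev_comm x]; exact lev_le_cons_left a y x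

theorem lev_cons_same (a : α) (x y : List α) : lev (a :: x) (a :: y) = lev x y := by
  have h₁ := lev_le_cons_right a x y
  have h₂ := lev_le_cons_left a x y
  rw [lev_cons_cons, if_pos rfl]
  omega

theorem lev_cons_ne {a b : α} (h : a ≠ b) (x y : List α) : lev (a :: x) (b :: y) =
    min (lev x y) (min (lev x (b :: y)) (lev (a :: x) y)) + 1 := by
  rw [lev_cons_cons, if_neg h]; omega

theorem lev_self (x : List α) : lev x x = 0 := by
  induction x with
  | nil => rw [lev_nil_left]; rfl
  | cons a x ih => rw [lev_cons_same, ih]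

/-- Induction on `z` is needed because one branch of the recursion shortens only `z` and keeps the
head `c`. The hypothesis for all `z` covers the other two branches. -/
theorem lev_cons_cons_le_add_one (c : α) {x x' : List α}
    (h : ∀ z, lev x z ≤ lev x' z + 1) (z : List α) : lev (c :: x) z ≤ lev (c :: x') z + 1 := by
  induction z with
  | nil =>
    have := h []
    simp only [lev_nil_right, List.length_cons] at *
    omega
  | cons b z ih =>
    have h₁ := h z
    have h₂ := h (b :: z)
    rw [lev_cons_cons, lev_cons_cons]
    omega

/-- The triangle inequality for a single edit. Keeping `z` arbitrary lets the induction strip the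
common prefix `u`; summed along a sequence of edits it shows that no sequence is shorter than `lev`.
-/
theorem Edit.lev_le {x x' : List α} (h : Edit x x') (z : List α) : lev x z ≤ lev x' z + 1 := by
  cases h with
  | insert u v a =>
    induction u generalizing z with
    | nil => exact lev_le_cons_left a v z
    | cons c u ih => exact lev_cons_cons_le_add_one c ih z
  | delete u v a =>
    induction u generalizing z with
    | nil => exact lev_cons_left_le a v z
    | cons c u ih => exact lev_cons_cons_le_add_one c ih z
  | replace u v a b =>
    induction u generalizing z with
    | nil =>
      simp only [List.nil_append]
      induction z with
      | nil => simp [lev_nil_right]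
      | cons e z ih =>
        rw [lev_cons_cons, lev_cons_cons]
        split_ifs <;> omega
    | cons c u ih => exact lev_cons_cons_le_add_one c ih z

theorem Edits.lev_le {k : ℕ} {x y : List α} (h : Edits k x y) : lev x y ≤ k := by
  induction h with
  | nil x => rw [lev_self]
  | cons h _ ih =>
    have := h.lev_le
    exact (this _).trans (by omega)

omit [DecidableEq α] in
theorem Edit.cons {x y : List α} (a : α) (h : Edit x y) : Edit (a :: x) (a :: y) := by
  cases h with
  | insert u v b => exact Edit.insert (a :: u) v b
  | delete u v b => exact Edit.delete (a :: u) v b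
  | replace u v b c => exact Edit.replace (a :: u) v b c

omit [DecidableEq α] in
theorem Edits.map_cons {k : ℕ} {x y : List α} (a : α) (h : Edits k x y) :
    Edits k (a :: x) (a :: y) := by
  induction h with
  | nil x => exact Edits.nil _
  | cons h _ ih => exact Edits.cons (h.cons a) ih

theorem edits_lev (x y : List α) : Edits (lev x y) x y := by
  induction x generalizing y with
  | nil =>
    rw [lev_nil_left]
    induction y with
    | nil => exact Edits.nil _
    | cons b y ih => exact Edits.cons (Edit.insert [] [] b) (by simpa using ih.map_cons b)
  | cons a x ihx =>
    induction y with
    | nil =>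
      have := ihx []
      rw [lev_nil_right] at this ⊢
      exact Edits.cons (Edit.delete [] x a) this
    | cons b y ihy =>
      rw [lev_cons_cons]
      have h₁ : Edits (lev x y + if a = b then 0 else 1) (a :: x) (b :: y) := by
        split_ifs with h
        · subst h; exact (ihx y).map_cons a
        · exact Edits.cons (Edit.replace [] x a b) ((ihx y).map_cons b)
      have h₂ : Edits (lev x (b :: y) + 1) (a :: x) (b :: y) :=
        Edits.cons (Edit.delete [] x a) (ihx _)
      have h₃ : Edits (lev (a :: x) y + 1) (a :: x) (b :: y) :=
        Edits.cons (Edit.insert [] (a :: x) b) (ihy.map_cons b)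
      rcases min_choice (lev x y + if a = b then 0 else 1)
        (min (lev x (b :: y) + 1) (lev (a :: x) y + 1)) with h | h <;> rw [h]
      · exact h₁
      · rcases min_choice (lev x (b :: y) + 1) (lev (a :: x) y + 1) with h | h <;> rw [h]
        · exact h₂
        · exact h₃

omit [DecidableEq α] in
theorem Edits.reverse {k : ℕ} {x y : List α} (h : Edits k x y) :
    Edits k x.reverse y.reverse := by
  induction h with
  | nil x => exact Edits.nil _
  | cons h _ ih =>
    refine Edits.cons ?_ ih
    cases h with
    | insert u v a => simpa using Edit.insert v.reverse u.reverse a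
    | delete u v a => simpa using Edit.delete v.reverse u.reverse a
    | replace u v a b => simpa using Edit.replace v.reverse u.reverse a b

/-- The recursion peels off first characters, whereas the dynamic program extends prefixes at their
end. Edits, unlike the recursion, are visibly symmetric under reversal. -/
theorem lev_reverse (x y : List α) : lev x.reverse y.reverse = lev x y := by
  apply le_antisymm
  · exact (edits_lev x y).reverse.lev_le
  · simpa using (edits_lev x.reverse y.reverse).reverse.lev_le

/-- Needed because the machine sees characters only through their numerical codes. -/
theorem lev_map_of_injective {β : Type} [DecidableEq β] {f : α → β} (hf : Function.Injective f)
    (x y : List α) : lev (x.map f) (y.map f) = lev x y := by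
  induction x generalizing y with
  | nil => simp [lev_nil_left]
  | cons a x ihx =>
    induction y with
    | nil => simp [lev_nil_right]
    | cons b y ihy =>
      rw [List.map_cons, List.map_cons, lev_cons_cons, lev_cons_cons, ihx, ← List.map_cons, ihx,
        ← List.map_cons, ihy]
      simp only [hf.eq_iff]

theorem lev_le_max (x y : List α) : lev x y ≤ max x.length y.length := by
  induction x generalizing y with
  | nil => simp [lev_nil_left]
  | cons a x ih =>
    cases y with
    | nil => simp [lev_nil_right]
    | cons b y =>
      have := ih y
      rw [lev_cons_cons]
      simp only [List.length_cons]
      split_ifs <;> omega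

theorem length_sub_le_lev (x y : List α) : x.length ≤ y.length + lev x y := by
  induction x generalizing y with
  | nil => simp
  | cons a x ihx =>
    induction y with
    | nil => simp [lev_nil_right]
    | cons b y ihy =>
      have h₁ := ihx y
      have h₂ := ihx (b :: y)
      rw [lev_cons_cons]
      simp only [List.length_cons] at *
      omega

end Lev

theorem editDist_eq_lev {σ : ℕ} (x y : List (Fin σ)) : editDist x y = lev x y := by
  apply le_antisymm
  · exact Nat.sInf_le (edits_lev x y)
  · exact Edits.lev_le (Nat.sInf_mem (s := {k | Edits k x y}) ⟨_, edits_lev x y⟩)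

/-! ## Expressions and a program logic with running times for the word RAM -/

namespace WordRAM

/-- Arithmetic expressions over registers, literals, the stored data, the working memory and the
query. -/
inductive Ex
  | var (i : ℕ)
  | lit (v : ℕ)
  | add (a b : Ex)
  | sub (a b : Ex)
  | mul (a b : Ex)
  | div (a b : Ex)
  | data (a : Ex)
  | load (a : Ex)
  | inp (a : Ex)

namespace Ex

/-- Value of an expression, without reduction to the word size. -/
def eval (E : Env) (s : State) : Ex → ℕ
  | var i => s.reg i
  | lit v => v
  | add a b => a.eval E s + b.eval E s
  | sub a b => a.eval E s - b.eval E s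
  | mul a b => a.eval E s * b.eval E s
  | div a b => a.eval E s / b.eval E s
  | data a => E.data.getD (a.eval E s) 0
  | load a => s.mem (a.eval E s)
  | inp a => E.input.getD (a.eval E s) 0

/-- No intermediate result exceeds the word size, and only the registers below `50` are read. -/
def Ok (E : Env) (s : State) : Ex → Prop
  | var i => i < 50
  | lit v => v < 2 ^ E.wordSize
  | add a b => a.Ok E s ∧ b.Ok E s ∧ a.eval E s + b.eval E s < 2 ^ E.wordSize
  | sub a b => a.Ok E s ∧ b.Ok E s
  | mul a b => a.Ok E s ∧ b.Ok E s ∧ a.eval E s * b.eval E s < 2 ^ E.wordSize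
  | div a b => a.Ok E s ∧ b.Ok E s
  | data a => a.Ok E s
  | load a => a.Ok E s
  | inp a => a.Ok E s

/-- Code that leaves the value of the expression in register `t`, using registers from `t` on. -/
def code : Ex → ℕ → Prog
  -- A register is copied by adding it to zero.
  | var i, t => .seq (.instr (.const t 0)) (.instr (.add t i t))
  | lit v, t => .instr (.const t v)
  | add a b, t => .seq (a.code t) (.seq (b.code (t + 1)) (.instr (.add t t (t + 1))))
  | sub a b, t => .seq (a.code t) (.seq (b.code (t + 1)) (.instr (.sub t t (t + 1))))
  | mul a b, t => .seq (a.code t) (.seq (b.code (t + 1)) (.instr (.mul t t (t + 1))))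
  | div a b, t => .seq (a.code t) (.seq (b.code (t + 1)) (.instr (.div t t (t + 1))))
  | data a, t => .seq (a.code t) (.instr (.data t t))
  | load a, t => .seq (a.code t) (.instr (.load t t))
  | inp a, t => .seq (a.code t) (.instr (.input t t))

/-- Number of steps of the code of an expression. -/
def cost : Ex → ℕ
  | var _ => 2
  | lit _ => 1
  | add a b => a.cost + (b.cost + 1)
  | sub a b => a.cost + (b.cost + 1)
  | mul a b => a.cost + (b.cost + 1)
  | div a b => a.cost + (b.cost + 1)
  | data a => a.cost + 1
  | load a => a.cost + 1
  | inp a => a.cost + 1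

end Ex

/-- The words of the query and of the stored data fit into the word size. -/
structure Env.Fits (E : Env) : Prop where
  input : ∀ a, E.input.getD a 0 < 2 ^ E.wordSize
  data : ∀ a, E.data.getD a 0 < 2 ^ E.wordSize

/-- The state `s` of the machine agrees with the state `v` on the registers below `50` and the
working memory, and the words there fit into the word size. -/
structure Sim (E : Env) (s v : State) : Prop where
  reg : ∀ i < 50, s.reg i = v.reg i
  mem : s.mem = v.mem
  reg_lt : ∀ i < 50, v.reg i < 2 ^ E.wordSize
  mem_lt : ∀ a, v.mem a < 2 ^ E.wordSize

/-- Under `Ok` the reduction modulo `2 ^ wordSize` never takes effect, so programs may be analysed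
over the natural numbers. -/
theorem Ex.eval_lt {E : Env} (hE : E.Fits) {v : State} (hr : ∀ i < 50, v.reg i < 2 ^ E.wordSize)
    (hm : ∀ a, v.mem a < 2 ^ E.wordSize) {e : Ex} (h : e.Ok E v) :
    e.eval E v < 2 ^ E.wordSize := by
  induction e with
  | var i => exact hr i h
  | lit v => exact h
  | add a b _ _ => exact h.2.2
  | sub a b iha _ => exact (Nat.sub_le _ _).trans_lt (iha h.1)
  | mul a b _ _ => exact h.2.2
  | div a b iha _ => exact (Nat.div_le_self _ _).trans_lt (iha h.1)
  | data a _ => exact hE.data _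
  | load a _ => exact hm _
  | inp a _ => exact hE.input _

theorem State.setReg_reg_self (E : Env) (s : State) (i v : ℕ) :
    (s.setReg E i v).reg i = v % 2 ^ E.wordSize := by simp [State.setReg]

theorem State.setReg_reg_of_ne (E : Env) (s : State) {i j : ℕ} (v : ℕ) (h : j ≠ i) :
    (s.setReg E i v).reg j = s.reg j := by simp [State.setReg, h]

theorem State.setReg_mem (E : Env) (s : State) (i v : ℕ) : (s.setReg E i v).mem = s.mem := rfl

/-- Started in a state that agrees with `v`, the program `P` puts `w` into register `t` in `c` steps
and changes neither the working memory nor the registers below `t`. -/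
def Computes (E : Env) (v : State) (P : Prog) (t c w : ℕ) : Prop :=
  ∀ s, Sim E s v → ∃ s', Exec E P s c s' ∧ s'.reg t = w ∧ (∀ i < t, s'.reg i = s.reg i) ∧
    s'.mem = s.mem

/-- The second operand is computed from register `t + 1` on, so the first one survives in `t`; as
`50 ≤ t`, the registers visible to `Sim` are untouched. -/
theorem Computes.binary {E : Env} {v : State} {P Q : Prog} {t c₁ c₂ x y : ℕ} (ht : 50 ≤ t)
    (hP : Computes E v P t c₁ x) (hQ : Computes E v Q (t + 1) c₂ y) (op : ℕ → ℕ → ℕ) (I : Instr)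
    (hI : ∀ s, I.exec E s = s.setReg E t (op (s.reg t) (s.reg (t + 1))))
    (hlt : op x y < 2 ^ E.wordSize) :
    Computes E v (.seq P (.seq Q (.instr I))) t (c₁ + (c₂ + 1)) (op x y) := by
  intro s hs
  obtain ⟨s₁, e₁, r₁, f₁, m₁⟩ := hP s hs
  obtain ⟨s₂, e₂, r₂, f₂, m₂⟩ := hQ s₁
    ⟨fun i hi => by rw [f₁ i (by omega), hs.reg i hi], by rw [m₁, hs.mem], hs.reg_lt, hs.mem_lt⟩
  refine ⟨_, .seq e₁ (.seq e₂ (.instr I s₂)), ?_, ?_, ?_⟩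
  · rw [hI, State.setReg_reg_self, r₂, f₂ t (by omega), r₁, Nat.mod_eq_of_lt hlt]
  · intro i hi
    rw [hI, State.setReg_reg_of_ne _ _ _ (by omega), f₂ i (by omega), f₁ i hi]
  · rw [hI, State.setReg_mem, m₂, m₁]

theorem Computes.unary {E : Env} {v : State} {P : Prog} {t c x : ℕ}
    (hP : Computes E v P t c x) (op : (ℕ → ℕ) → ℕ → ℕ) (I : Instr)
    (hI : ∀ s, I.exec E s = s.setReg E t (op s.mem (s.reg t)))
    (hlt : op v.mem x < 2 ^ E.wordSize) :
    Computes E v (.seq P (.instr I)) t (c + 1) (op v.mem x) := by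
  intro s hs
  obtain ⟨s₁, e₁, r₁, f₁, m₁⟩ := hP s hs
  refine ⟨_, .seq e₁ (.instr I s₁), ?_, ?_, ?_⟩
  · rw [hI, State.setReg_reg_self, r₁, m₁, hs.mem, Nat.mod_eq_of_lt hlt]
  · intro i hi
    rw [hI, State.setReg_reg_of_ne _ _ _ (by omega), f₁ i hi]
  · rw [hI, State.setReg_mem, m₁]

theorem Ex.computes {E : Env} (hE : E.Fits) {v : State} (hr : ∀ i < 50, v.reg i < 2 ^ E.wordSize)
    (hm : ∀ a, v.mem a < 2 ^ E.wordSize) (e : Ex) (h : e.Ok E v) (t : ℕ) (ht : 50 ≤ t) :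
    Computes E v (e.code t) t e.cost (e.eval E v) := by
  have lt := @Ex.eval_lt E hE v hr hm _ h
  induction e generalizing t with
  | var i =>
    intro s hs
    have hi : i < 50 := h
    refine ⟨_, .seq (.instr _ _) (.instr _ _), ?_, ?_, rfl⟩
    · simp only [Instr.exec, State.setReg_reg_self, Nat.zero_mod, add_zero]
      rw [State.setReg_reg_of_ne _ _ _ (by omega), hs.reg i hi, Nat.mod_eq_of_lt (hs.reg_lt i hi)]
      rfl
    · intro j hj
      simp only [Instr.exec]
      rw [State.setReg_reg_of_ne _ _ _ (by omega), State.setReg_reg_of_ne _ _ _ (by omega)]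
  | lit w =>
    intro s hs
    refine ⟨_, .instr _ _, ?_, ?_, rfl⟩
    · simp only [Instr.exec, State.setReg_reg_self, Nat.mod_eq_of_lt (show w < _ from h)]
      rfl
    · intro j hj
      simp only [Instr.exec]
      rw [State.setReg_reg_of_ne _ _ _ (by omega)]
  | add a b iha ihb =>
    exact (iha h.1 t ht (Ex.eval_lt hE hr hm h.1)).binary ht
      (ihb h.2.1 (t + 1) (by omega) (Ex.eval_lt hE hr hm h.2.1)) (· + ·) _ (fun _ => rfl) lt
  | sub a b iha ihb =>
    exact (iha h.1 t ht (Ex.eval_lt hE hr hm h.1)).binary ht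
      (ihb h.2 (t + 1) (by omega) (Ex.eval_lt hE hr hm h.2)) (· - ·) _ (fun _ => rfl) lt
  | mul a b iha ihb =>
    exact (iha h.1 t ht (Ex.eval_lt hE hr hm h.1)).binary ht
      (ihb h.2.1 (t + 1) (by omega) (Ex.eval_lt hE hr hm h.2.1)) (· * ·) _ (fun _ => rfl) lt
  | div a b iha ihb =>
    exact (iha h.1 t ht (Ex.eval_lt hE hr hm h.1)).binary ht
      (ihb h.2 (t + 1) (by omega) (Ex.eval_lt hE hr hm h.2)) (· / ·) _ (fun _ => rfl) lt
  | data a ih =>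
    exact (ih h t ht (Ex.eval_lt hE hr hm (e := a) h)).unary (fun _ x => E.data.getD x 0) _
      (fun _ => rfl) lt
  | load a ih =>
    exact (ih h t ht (Ex.eval_lt hE hr hm (e := a) h)).unary (fun m x => m x) _
      (fun _ => rfl) lt
  | inp a ih =>
    exact (ih h t ht (Ex.eval_lt hE hr hm (e := a) h)).unary (fun _ x => E.input.getD x 0) _
      (fun _ => rfl) lt

/-- `x := e`. -/
def asg (x : ℕ) (e : Ex) : Prog :=
  .seq (e.code 50) (.seq (.instr (.const 51 0)) (.instr (.add x 50 51)))

/-- `mem[a] := e`. -/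
def sto (a e : Ex) : Prog :=
  .seq (a.code 50) (.seq (e.code 51) (.instr (.store 50 51)))

/-- Assignment to a register, without reduction to the word size. -/
def State.set (s : State) (i v : ℕ) : State :=
  { s with reg := Function.update s.reg i v }

/-- Assignment to a cell of the working memory. -/
def State.put (s : State) (a v : ℕ) : State :=
  { s with mem := Function.update s.mem a v }

theorem State.set_reg (s : State) (i v j : ℕ) :
    (s.set i v).reg j = if j = i then v else s.reg j := by
  simp [State.set, Function.update_apply]

theorem State.set_mem (s : State) (i v : ℕ) : (s.set i v).mem = s.mem := rfl

theorem State.put_reg (s : State) (a v : ℕ) : (s.put a v).reg = s.reg := rfl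

theorem State.put_mem (s : State) (a v b : ℕ) :
    (s.put a v).mem b = if b = a then v else s.mem b := by
  simp [State.put, Function.update_apply]

/-- Total correctness with a time bound: started in any state that agrees with `v`, the program `P`
halts within `T` steps in a state that agrees with one that satisfies `Q`. -/
def Runs (E : Env) (P : Prog) (v : State) (T : ℕ) (Q : State → Prop) : Prop :=
  ∀ s, Sim E s v → ∃ t s' v', Exec E P s t s' ∧ t ≤ T ∧ Sim E s' v' ∧ Q v'

theorem Runs.mono {E : Env} {P : Prog} {v : State} {T T' : ℕ} {Q Q' : State → Prop}
    (h : Runs E P v T Q) (hT : T ≤ T') (hQ : ∀ v', Q v' → Q' v') : Runs E P v T' Q' := by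
  intro s hs
  obtain ⟨t, s', v', he, ht, hv, hq⟩ := h s hs
  exact ⟨t, s', v', he, ht.trans hT, hv, hQ _ hq⟩

theorem Runs.skip {E : Env} {v : State} {T : ℕ} {Q : State → Prop} (h : Q v) :
    Runs E .skip v T Q :=
  fun s hs => ⟨0, s, v, .skip s, by omega, hs, h⟩

theorem Runs.asg {E : Env} (hE : E.Fits) {v : State} {x T : ℕ} {e : Ex} {Q : State → Prop}
    (hx : x < 50) (he : e.Ok E v) (hT : e.cost + 2 ≤ T) (h : Q (v.set x (e.eval E v))) :
    Runs E (asg x e) v T Q := by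
  intro s hs
  have hlt := Ex.eval_lt hE hs.reg_lt hs.mem_lt he
  obtain ⟨s₁, e₁, r₁, f₁, m₁⟩ := Ex.computes hE hs.reg_lt hs.mem_lt e he 50 le_rfl s hs
  refine ⟨_, _, v.set x (e.eval E v), .seq e₁ (.seq (.instr _ _) (.instr _ _)), by omega,
    ⟨?_, ?_, ?_, hs.mem_lt⟩, h⟩
  · intro i hi
    rw [State.set_reg]
    simp only [Instr.exec]
    split_ifs with hix
    · subst hix
      rw [State.setReg_reg_self, State.setReg_reg_self, State.setReg_reg_of_ne _ _ _ (by omega), r₁,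
        Nat.zero_mod, add_zero, Nat.mod_eq_of_lt hlt]
    · rw [State.setReg_reg_of_ne _ _ _ hix, State.setReg_reg_of_ne _ _ _ (by omega), f₁ i hi,
        hs.reg i hi]
  · simp only [Instr.exec, State.setReg_mem, State.set_mem, m₁, hs.mem]
  · intro i hi
    rw [State.set_reg]
    split_ifs
    · exact hlt
    · exact hs.reg_lt i hi

theorem Runs.sto {E : Env} (hE : E.Fits) {v : State} {T : ℕ} {a e : Ex} {Q : State → Prop}
    (ha : a.Ok E v) (he : e.Ok E v) (hlt : a.eval E v < E.scratch) (hT : a.cost + e.cost + 1 ≤ T)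
    (h : Q (v.put (a.eval E v) (e.eval E v))) : Runs E (sto a e) v T Q := by
  intro s hs
  have hle := Ex.eval_lt hE hs.reg_lt hs.mem_lt he
  obtain ⟨s₁, e₁, r₁, f₁, m₁⟩ := Ex.computes hE hs.reg_lt hs.mem_lt a ha 50 le_rfl s hs
  obtain ⟨s₂, e₂, r₂, f₂, m₂⟩ := Ex.computes hE hs.reg_lt hs.mem_lt e he 51 (by omega) s₁
    ⟨fun i hi => by rw [f₁ i (by omega), hs.reg i hi], by rw [m₁, hs.mem], hs.reg_lt, hs.mem_lt⟩
  refine ⟨_, _, v.put (a.eval E v) (e.eval E v), .seq e₁ (.seq e₂ (.instr _ _)), by omega,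
    ⟨?_, ?_, hs.reg_lt, ?_⟩, h⟩
  · intro i hi
    simp only [Instr.exec, f₂ 50 (by omega), r₁, hlt, if_true, State.put_reg]
    rw [f₂ i (by omega), f₁ i (by omega), hs.reg i hi]
  · simp only [Instr.exec, f₂ 50 (by omega), r₁, r₂, hlt, if_true, State.put, m₂, m₁, hs.mem]
  · intro b
    rw [State.put_mem]
    split_ifs
    · exact hle
    · exact hs.mem_lt b

theorem Runs.seq {E : Env} {P P' : Prog} {v : State} {T T' : ℕ} {Q Q' : State → Prop}
    (h : Runs E P v T Q) (h' : ∀ v', Q v' → Runs E P' v' T' Q') :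
    Runs E (.seq P P') v (T + T') Q' := by
  intro s hs
  obtain ⟨t, s₁, v₁, he, ht, hv, hq⟩ := h s hs
  obtain ⟨t', s₂, v₂, he', ht', hv', hq'⟩ := h' v₁ hq s₁ hv
  exact ⟨_, s₂, v₂, .seq he he', by omega, hv', hq'⟩

theorem Runs.seq_of_le {E : Env} {P P' : Prog} {v : State} {T T₀ : ℕ} {Q Q' : State → Prop}
    (h : Runs E P v T₀ Q) (hT : T₀ ≤ T) (h' : ∀ v', Q v' → Runs E P' v' (T - T₀) Q') :
    Runs E (.seq P P') v T Q' :=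
  (h.seq h').mono (by omega) (fun _ => id)

theorem Runs.asg_seq {E : Env} (hE : E.Fits) {v : State} {x T : ℕ} {e : Ex} {P : Prog}
    {Q : State → Prop} (hx : x < 50) (he : e.Ok E v) (hT : e.cost + 2 ≤ T)
    (h : Runs E P (v.set x (e.eval E v)) (T - (e.cost + 2)) Q) :
    Runs E (.seq (WordRAM.asg x e) P) v T Q :=
  (Runs.asg (Q := fun v' => v' = v.set x (e.eval E v)) hE hx he le_rfl rfl).seq_of_le hT
    (fun _ hv => hv ▸ h)

theorem Runs.sto_seq {E : Env} (hE : E.Fits) {v : State} {T : ℕ} {a e : Ex} {P : Prog}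
    {Q : State → Prop} (ha : a.Ok E v) (he : e.Ok E v) (hlt : a.eval E v < E.scratch)
    (hT : a.cost + e.cost + 1 ≤ T)
    (h : Runs E P (v.put (a.eval E v) (e.eval E v)) (T - (a.cost + e.cost + 1)) Q) :
    Runs E (.seq (WordRAM.sto a e) P) v T Q :=
  (Runs.sto (Q := fun v' => v' = v.put (a.eval E v) (e.eval E v)) hE ha he hlt le_rfl rfl).seq_of_le
    hT (fun _ hv => hv ▸ h)

/-- The registers that a test reads are below `50`. -/
def Test.Ok : Test → Prop
  | .lt i j => i < 50 ∧ j < 50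
  | .eq i j => i < 50 ∧ j < 50

theorem Sim.holds_iff {E : Env} {s v : State} (h : Sim E s v) {b : Test} (hb : b.Ok) :
    b.holds s ↔ b.holds v := by
  cases b <;> simp only [Test.holds, h.reg _ hb.1, h.reg _ hb.2]

theorem Runs.ite {E : Env} {b : Test} {P P' : Prog} {v : State} {T : ℕ} {Q : State → Prop}
    (hb : b.Ok) (h : b.holds v → Runs E P v (T - 1) Q) (h' : ¬ b.holds v → Runs E P' v (T - 1) Q)
    (hT : 1 ≤ T) : Runs E (.ite b P P') v T Q := by
  intro s hs
  by_cases hv : b.holds v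
  · obtain ⟨t, s', v', he, ht, hr⟩ := h hv s hs
    exact ⟨_, s', v', .ite_true ((hs.holds_iff hb).2 hv) he, by omega, hr⟩
  · obtain ⟨t, s', v', he, ht, hr⟩ := h' hv s hs
    exact ⟨_, s', v', .ite_false (fun h => hv ((hs.holds_iff hb).1 h)) he, by omega, hr⟩

/-- A loop with invariant `I`; the potential `Φ` bounds the time still to be spent. -/
theorem Runs.loop {E : Env} {b : Test} {P : Prog} (hb : b.Ok) (I : State → Prop) (Φ : State → ℕ)
    (h : ∀ v, I v → b.holds v →
      ∃ T, Runs E P v T (fun v' => I v' ∧ T + 1 + Φ v' ≤ Φ v))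
    {v : State} (hv : I v) : Runs E (.loop b P) v (Φ v + 1) (fun v' => I v' ∧ ¬ b.holds v') := by
  obtain ⟨m, hm⟩ : ∃ m, Φ v = m := ⟨_, rfl⟩
  induction m using Nat.strong_induction_on generalizing v with
  | _ m ih =>
    intro s hs
    by_cases hvb : b.holds v
    · obtain ⟨T, hT⟩ := h v hv hvb
      obtain ⟨t, s₁, v₁, he, ht, hs₁, hI, hΦ⟩ := hT s hs
      obtain ⟨t', s₂, v₂, he', ht', hs₂, hq⟩ := ih (Φ v₁) (by omega) hI rfl s₁ hs₁
      exact ⟨_, s₂, v₂, .loop_true ((hs.holds_iff hb).2 hvb) he he', by omega, hs₂, hq⟩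
    · exact ⟨1, s, v, .loop_false (fun h => hvb ((hs.holds_iff hb).1 h)), by omega, hs, hv, hvb⟩

/-- A loop with at most `μ` iterations of at most `c` steps each. -/
theorem Runs.loop_of_le {E : Env} {b : Test} {P : Prog} (hb : b.Ok) (I : State → Prop)
    (μ : State → ℕ) (c : ℕ)
    (h : ∀ v, I v → b.holds v → Runs E P v c (fun v' => I v' ∧ μ v' < μ v))
    {v : State} (hv : I v) {T : ℕ} (hT : (c + 1) * μ v + 1 ≤ T) :
    Runs E (.loop b P) v T (fun v' => I v' ∧ ¬ b.holds v') := by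
  refine (Runs.loop hb I (fun v => (c + 1) * μ v) (fun v hI hbv => ⟨c, ?_⟩) hv).mono hT
    (fun _ => id)
  refine (h v hI hbv).mono le_rfl fun v' hv' => ⟨hv'.1, ?_⟩
  have := Nat.mul_le_mul_left (c + 1) (Nat.succ_le_of_lt hv'.2)
  rw [Nat.mul_succ] at this
  omega

end WordRAM

namespace WordRAM

/-! ### Sequences of programs -/

/-- The programs of a list, one after the other. -/
def seqs : List Prog → Prog
  | [] => .skip
  | P :: l => .seq P (seqs l)

/-- `x := min x y` for two registers. -/
def setMin (x y : ℕ) : Prog := .ite (.lt y x) (asg x (.var y)) .skip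

theorem State.set_self (s : State) (i : ℕ) : s.set i (s.reg i) = s := by
  simp [State.set]

section Rules

variable {E : Env} {v : State} {T : ℕ} {Q : State → Prop} {l : List Prog}

theorem Runs.nil (h : Q v) : Runs E (seqs []) v T Q := Runs.skip h

theorem Runs.cons_asg (hE : E.Fits) {x : ℕ} {e : Ex} (hx : x < 50) (he : e.Ok E v)
    (hT : e.cost + 2 ≤ T) (h : Runs E (seqs l) (v.set x (e.eval E v)) (T - (e.cost + 2)) Q) :
    Runs E (seqs (WordRAM.asg x e :: l)) v T Q := Runs.asg_seq hE hx he hT h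

theorem Runs.cons_sto (hE : E.Fits) {a e : Ex} (ha : a.Ok E v) (he : e.Ok E v)
    (hlt : a.eval E v < E.scratch) (hT : a.cost + e.cost + 1 ≤ T)
    (h : Runs E (seqs l) (v.put (a.eval E v) (e.eval E v)) (T - (a.cost + e.cost + 1)) Q) :
    Runs E (seqs (WordRAM.sto a e :: l)) v T Q := Runs.sto_seq hE ha he hlt hT h

theorem Runs.cons {P : Prog} {T₀ : ℕ} {Q₀ : State → Prop} (h : Runs E P v T₀ Q₀) (hT : T₀ ≤ T)
    (h' : ∀ v', Q₀ v' → Runs E (seqs l) v' (T - T₀) Q) : Runs E (seqs (P :: l)) v T Q :=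
  h.seq_of_le hT h'

theorem Runs.cons_setMin (hE : E.Fits) {x y : ℕ} (hx : x < 50) (hy : y < 50) (hT : 5 ≤ T)
    (h : Runs E (seqs l) (v.set x (min (v.reg x) (v.reg y))) (T - 5) Q) :
    Runs E (seqs (setMin x y :: l)) v T Q := by
  refine Runs.cons (T₀ := 5) (Q₀ := fun v' => v' = v.set x (min (v.reg x) (v.reg y))) ?_ hT
    (fun _ hv => hv ▸ h)
  refine Runs.ite ⟨hy, hx⟩ (fun hb => ?_) (fun hb => ?_) (by omega)
  · refine Runs.asg hE hx hy (by simp [Ex.cost]) ?_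
    rw [min_eq_right (le_of_lt hb)]; rfl
  · refine Runs.skip ?_
    rw [min_eq_left (not_lt.1 hb), State.set_self]

end Rules

/-! ### The query program -/

section Program

open Ex

/-- Copy the first `m` words of the data to the registers from `20` on. -/
def loadHeader : ℕ → Prog
  | 0 => .skip
  | m + 1 => .seq (loadHeader m) (asg (20 + m) (data (lit m)))

/-- Copy the query to the working memory. -/
def copyQuery : Prog := seqs [
  -- Register `0` arrives with the length of the query but must end with the answer, so the length
  -- moves to register `1`.
  asg 1 (var 0),
  asg 0 (lit 0),
  asg 3 (lit 0),
  .loop (.lt 3 1) (seqs [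
    sto (var 3) (inp (var 3)),
    asg 3 (add (var 3) (lit 1))]),
  sto (var 1) (var 27),
  sto (add (var 1) (lit 1)) (var 36)]

/-- Copy the database string whose number is in register `13` to the working memory. -/
def copyString : Prog := seqs [
  asg 4 (add (var 29) (mul (var 13) (var 28))),
  asg 14 (data (var 4)),
  asg 3 (lit 0),
  .loop (.lt 3 37) (seqs [
    sto (add (var 32) (var 3)) (data (add (var 4) (add (var 3) (lit 1)))),
    asg 3 (add (var 3) (lit 1))])]

/-- The value of the underlying function whose two coefficients are stored at `x`. -/
def affine (x : Ex) : Ex :=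
  add (data x) (mul (data (add x (lit 1))) (var 6))

/-- One character of the hash. -/
def hashStep : Prog :=
  -- Register `36` holds the padding character `σ + 1`: past the end marker the scan stands still
  -- and pads the hash with `0`.
  .ite (.eq 6 36) (asg 8 (lit 0)) (seqs [
    asg 7 (affine (var 5)),
    asg 7 (sub (var 7) (mul (div (var 7) (var 23)) (var 23))),
    .ite (.lt 7 24) (asg 8 (lit 1)) (seqs [
      asg 4 (add (var 4) (lit 1)),
      asg 7 (affine (add (var 5) (lit 2))),
      asg 7 (sub (var 7) (mul (div (var 7) (var 23)) (var 23))),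
      .ite (.lt 7 25) (asg 8 (lit 1)) (asg 8 (add (var 6) (lit 2)))])])

/-- Write the hash of the string at the address in register `src` to the address in register
`dst`. -/
def hash (src dst : ℕ) : Prog := seqs [
  asg 3 (lit 0),
  asg 4 (var src),
  asg 5 (add (var 30) (mul (var 2) (var 38))),
  .loop (.lt 3 22) (seqs [
    asg 6 (load (var 4)),
    hashStep,
    sto (add (var dst) (var 3)) (var 8),
    asg 5 (add (var 5) (lit 4)),
    asg 3 (add (var 3) (lit 1))])]

/-- Compare the hash of a database string with that of the query: register `12` becomes `0`, `1`
or `2` according as the former is smaller, equal or larger. -/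
def compareHash : Prog := seqs [
  asg 12 (lit 1),
  asg 3 (lit 0),
  .loop (.lt 3 22) (seqs [
    asg 6 (load (add (var 33) (var 3))),
    asg 7 (load (add (var 34) (var 3))),
    .ite (.eq 6 7) (asg 3 (add (var 3) (lit 1))) (seqs [
      asg 3 (var 22),
      .ite (.lt 7 6) (asg 12 (lit 0)) (asg 12 (lit 2))])])]

/-- Compare with the database string at the position of the sorted order that is held in register
`11`. -/
def compareAt : Prog := seqs [
  asg 13 (data (add (var 31) (add (mul (var 2) (var 20)) (var 11)))),
  copyString,
  hash 32 34,
  compareHash]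

/-- Binary search for the first position whose hash is not smaller than that of the query. -/
def binarySearch : Prog := seqs [
  asg 9 (lit 0),
  asg 10 (var 20),
  .loop (.lt 9 10) (seqs [
    asg 11 (div (add (var 9) (var 10)) (lit 2)),
    compareAt,
    .ite (.eq 12 41) (asg 9 (add (var 11) (lit 1))) (asg 10 (var 11))])]

/-- One cell of the dynamic program for the edit distance. -/
def editCell : Prog := seqs [
  -- Registers `17`, `18` and `19` carry the diagonal, the left and the upper neighbour of the cell.
  -- A single row is stored and overwritten in place.
  asg 19 (load (add (var 35) (add (var 16) (lit 1)))),
  asg 5 (load (var 15)),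
  asg 6 (load (add (var 32) (var 16))),
  asg 8 (var 17),
  .ite (.eq 5 6) .skip (asg 8 (add (var 8) (lit 1))),
  asg 17 (var 19),
  asg 19 (add (var 19) (lit 1)),
  setMin 8 19,
  asg 18 (add (var 18) (lit 1)),
  setMin 8 18,
  setMin 8 40,
  asg 18 (var 8),
  sto (add (var 35) (add (var 16) (lit 1))) (var 18),
  asg 16 (add (var 16) (lit 1))]

/-- The first row of the dynamic program. -/
def editInit : Prog := seqs [
  asg 3 (lit 0),
  .loop (.lt 3 39) (seqs [
    asg 19 (var 3),
    setMin 19 40,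
    sto (add (var 35) (var 3)) (var 19),
    asg 3 (add (var 3) (lit 1))])]

/-- The next row of the dynamic program. -/
def editRow : Prog := seqs [
  -- Subtraction stops at `0`, so the band starts at column `max 0 (i - K)`.
  asg 16 (sub (var 15) (var 26)),
  asg 17 (load (add (var 35) (var 16))),
  asg 18 (add (var 15) (lit 1)),
  setMin 18 40,
  sto (add (var 35) (var 16)) (var 18),
  asg 7 (add (var 15) (var 40)),
  .loop (.lt 16 7) editCell,
  asg 15 (add (var 15) (lit 1))]

/-- Edit distance of the query and the current database string, cut off above the threshold. -/
def editDistance : Prog := seqs [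
  editInit,
  asg 15 (lit 0),
  .loop (.lt 15 1) editRow,
  asg 12 (load (add (var 35) (var 14)))]

/-- Search the strings that collide with the query. -/
def searchBucket : Prog := seqs [
  asg 11 (var 9),
  .loop (.lt 11 20) (seqs [
    compareAt,
    .ite (.eq 12 42) (seqs [
        editDistance,
        .ite (.lt 12 40) (seqs [asg 0 (add (var 13) (lit 1)), asg 11 (var 20)])
          (asg 11 (add (var 11) (lit 1)))])
      (asg 11 (var 20))])]

/-- The query program. -/
def query : Prog := seqs [
  loadHeader 24,
  copyQuery,
  asg 2 (lit 0),
  .loop (.lt 2 21) (seqs [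
    -- Register `41` holds `0`, the address of the query.
    hash 41 33,
    binarySearch,
    searchBucket,
    .ite (.eq 0 41) (asg 2 (add (var 2) (lit 1))) (asg 2 (var 21))])]

end Program

/-! ### What the data structure stores -/

/-- The contents of the data structure together with a query. -/
structure Inst where
  (n R ℓ P ta tr K σ d : ℕ)
  q : List ℕ
  S : ℕ → List ℕ
  seed : ℕ → ℕ → ℕ
  perm : ℕ → ℕ → ℕ

namespace Inst

variable (I : Inst)

def seedBase : ℕ := 24 + I.n * (I.d + 3)

def permBase : ℕ := I.seedBase + I.R * (4 * I.ℓ)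

/-- Layout of the working memory: the query from `0`, the current database string from `d + 2`, the
hash of the query from `3d + 5`, the hash of the string `ℓ` cells later, and after another `ℓ` cells
one row of `2d + 3` cells of the dynamic program. The string has room to spare because the band of
the dynamic program may run past its end. -/
def scratch : ℕ := 5 * I.d + 2 * I.ℓ + 8

/-- The first words of the data. -/
def header : List ℕ :=
  [I.n, I.R, I.ℓ, I.P, I.ta, I.tr, I.K, I.σ, I.d + 3, 24, I.seedBase, I.permBase, I.d + 2,
    3 * I.d + 5, 3 * I.d + 5 + I.ℓ, 3 * I.d + 5 + 2 * I.ℓ, I.σ + 1, I.d + 2, 4 * I.ℓ, 2 * I.d + 3,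
    I.K + 1, 0, 1, 0]

/-- A string with its end marker and a padding character, followed by zeros. -/
def buf (x : List ℕ) (t : ℕ) : ℕ := (x ++ [I.σ, I.σ + 1]).getD t 0

/-- The environment `E` holds the contents described by `I`. -/
structure Holds (E : Env) : Prop where
  fits : E.Fits
  n_pos : 0 < I.n
  input : E.input = I.q
  length_q : I.q.length ≤ I.d
  length_S : ∀ i < I.n, (I.S i).length ≤ I.d
  mem_q : ∀ c ∈ I.q, c < I.σ
  mem_S : ∀ i < I.n, ∀ c ∈ I.S i, c < I.σ
  K_le : I.K ≤ I.d
  header : ∀ k < 24, E.data.getD k 0 = I.header.getD k 0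
  data_length : ∀ i < I.n, E.data.getD (24 + i * (I.d + 3)) 0 = (I.S i).length
  data_buf : ∀ i < I.n, ∀ t < I.d + 2,
    E.data.getD (24 + i * (I.d + 3) + (t + 1)) 0 = I.buf (I.S i) t
  data_seed : ∀ j < I.R, ∀ t < 4 * I.ℓ,
    E.data.getD (I.seedBase + j * (4 * I.ℓ) + t) 0 = I.seed j t
  data_perm : ∀ j < I.R, ∀ m < I.n, E.data.getD (I.permBase + (j * I.n + m)) 0 = I.perm j m
  perm_lt : ∀ j < I.R, ∀ m < I.n, I.perm j m < I.n
  seed_lt : ∀ j < I.R, ∀ t < 4 * I.ℓ, I.seed j t < I.P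
  scratch : I.scratch ≤ E.scratch
  address_lt : I.permBase + I.R * I.n + I.scratch + I.σ + 100 < 2 ^ E.wordSize
  value_lt : I.P * (I.σ + 3) < 2 ^ E.wordSize

/-- The registers that are loaded from the header. -/
structure Ctx (v : State) : Prop where
  r20 : v.reg 20 = I.n
  r21 : v.reg 21 = I.R
  r22 : v.reg 22 = I.ℓ
  r23 : v.reg 23 = I.P
  r24 : v.reg 24 = I.ta
  r25 : v.reg 25 = I.tr
  r26 : v.reg 26 = I.K
  r27 : v.reg 27 = I.σ
  r28 : v.reg 28 = I.d + 3
  r29 : v.reg 29 = 24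
  r30 : v.reg 30 = I.seedBase
  r31 : v.reg 31 = I.permBase
  r32 : v.reg 32 = I.d + 2
  r33 : v.reg 33 = 3 * I.d + 5
  r34 : v.reg 34 = 3 * I.d + 5 + I.ℓ
  r35 : v.reg 35 = 3 * I.d + 5 + 2 * I.ℓ
  r36 : v.reg 36 = I.σ + 1
  r37 : v.reg 37 = I.d + 2
  r38 : v.reg 38 = 4 * I.ℓ
  r39 : v.reg 39 = 2 * I.d + 3
  r40 : v.reg 40 = I.K + 1
  r41 : v.reg 41 = 0
  r42 : v.reg 42 = 1

variable {I}

theorem Ctx.of_eq {v v' : State} (h : I.Ctx v) (e : ∀ i, 20 ≤ i → v'.reg i = v.reg i) :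
    I.Ctx v' := by
  constructor <;> rw [e _ (by decide)]
  exacts [h.r20, h.r21, h.r22, h.r23, h.r24, h.r25, h.r26, h.r27, h.r28, h.r29, h.r30, h.r31, h.r32,
    h.r33, h.r34, h.r35, h.r36, h.r37, h.r38, h.r39, h.r40, h.r41, h.r42]

end Inst

/-! ### Loading the header and the query -/

theorem runs_loadHeader {E : Env} (hE : E.Fits) (m : ℕ) (hm : m ≤ 30) (hw : m < 2 ^ E.wordSize)
    (v : State) : Runs E (loadHeader m) v (4 * m) (fun v' => v'.mem = v.mem ∧
      (∀ k < m, v'.reg (20 + k) = E.data.getD k 0) ∧ ∀ i < 20, v'.reg i = v.reg i) := by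
  induction m with
  | zero => exact Runs.skip ⟨rfl, by simp, by simp⟩
  | succ m ih =>
    refine (ih (by omega) (by omega)).seq_of_le (by omega) fun v' ⟨h₁, h₂, h₃⟩ => ?_
    refine Runs.asg hE (by omega) ?_ ?_ ⟨?_, ?_, ?_⟩
    · simp only [Ex.Ok]; omega
    · simp only [Ex.cost]; omega
    · exact h₁
    · intro k hk
      rw [State.set_reg]
      split_ifs with h
      · simp only [Ex.eval]; congr 1; omega
      · exact h₂ k (by omega)
    · intro i hi
      rw [State.set_reg, if_neg (by omega), h₃ i hi]

open Inst

/-- The string `x` lies in the working memory at address `a`. -/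
def State.HasString (v : State) (I : Inst) (a : ℕ) (x : List ℕ) : Prop :=
  ∀ t < x.length + 2, v.mem (a + t) = I.buf x t

theorem runs_copyQuery {I : Inst} {E : Env} (hI : I.Holds E) {v : State} (hC : I.Ctx v)
    (h0 : v.reg 0 = I.q.length) :
    Runs E copyQuery v (30 * (I.d + 1)) (fun v' => I.Ctx v' ∧ v'.reg 0 = 0 ∧
      v'.reg 1 = I.q.length ∧ v'.HasString I 0 I.q) := by
  have hq := hI.length_q
  have hs := hI.scratch
  have hw := hI.address_lt
  have hE := hI.fits
  simp only [Inst.scratch] at hs hw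
  unfold copyQuery
  refine Runs.cons_asg hE (by decide) (by simp [Ex.Ok]) (by norm_num [Ex.cost]; omega) ?_
  refine Runs.cons_asg hE (by decide) (by simp only [Ex.Ok]; omega) (by norm_num [Ex.cost]; omega) ?_
  refine Runs.cons_asg hE (by decide) (by simp only [Ex.Ok]; omega) (by norm_num [Ex.cost]; omega) ?_
  simp only [Ex.eval, Ex.cost, h0]
  refine Runs.cons (Runs.loop_of_le (c := 20) (T := 21 * I.q.length + 1) (by simp [Test.Ok])
    (fun v' => (∀ i, i ≠ 0 → i ≠ 1 → i ≠ 3 → v'.reg i = v.reg i) ∧ v'.reg 0 = 0 ∧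
      v'.reg 1 = I.q.length ∧ v'.reg 3 ≤ I.q.length ∧
      ∀ t < v'.reg 3, v'.mem t = I.q.getD t 0) (fun v' => I.q.length - v'.reg 3) ?_ ?_ ?_) ?_ ?_
  · rintro v' ⟨hf, r0, r1, hle, hm⟩ hb
    simp only [Test.holds, r1] at hb
    refine Runs.cons_sto hE (by simp [Ex.Ok]) (by simp [Ex.Ok]) (by simp only [Ex.eval]; omega) (by decide) ?_
    refine Runs.cons_asg hE (by decide) ?_ (by decide) ?_
    · simp only [Ex.Ok, Ex.eval, State.put_reg]; omega
    refine Runs.nil ⟨⟨?_, ?_, ?_, ?_, ?_⟩, ?_⟩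
    · intro i h0 h1 h3
      simp only [State.set_reg, State.put_reg, h3, if_false]
      exact hf i h0 h1 h3
    · simp [State.set_reg, State.put_reg, r0]
    · simp [State.set_reg, State.put_reg, r1]
    · simp [State.set_reg, State.put_reg, Ex.eval]; omega
    · intro t ht
      simp only [State.set_reg, State.put_reg, Ex.eval, if_true] at ht
      simp only [State.set_mem, State.put_mem, Ex.eval, hI.input]
      split_ifs with h
      · rw [h]
      · exact hm t (by omega)
    · simp [State.set_reg, State.put_reg, Ex.eval]; omega
  · refine ⟨?_, ?_, ?_, ?_, ?_⟩ <;> simp +contextual [State.set_reg]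
  · simp [State.set_reg]
  · omega
  · rintro v' ⟨⟨hf, r0, r1, hle, hm⟩, hb⟩
    have r3 : v'.reg 3 = I.q.length := by simp only [Test.holds] at hb; omega
    have hC' : I.Ctx v' := hC.of_eq fun i hi => hf i (by omega) (by omega) (by omega)
    refine Runs.cons_sto hE (by simp [Ex.Ok]) (by simp [Ex.Ok]) (by simp only [Ex.eval]; omega)
      (by norm_num [Ex.cost]; omega) ?_
    refine Runs.cons_sto hE ?_ (by simp [Ex.Ok]) ?_
      (by norm_num [Ex.cost]; omega) ?_
    · simp only [Ex.Ok, Ex.eval, State.put_reg, r1]; omega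
    · simp only [Ex.eval, State.put_reg, r1]; omega
    refine Runs.nil ⟨hC'.of_eq fun i _ => rfl, r0, r1, ?_⟩
    intro t ht
    simp only [State.put_mem, State.put_reg, Ex.eval, r1, hC'.r27, hC'.r36, zero_add, Inst.buf]
    split_ifs with h h'
    · rw [h]; simp
    · rw [h']; simp
    · rw [hm t (by omega), List.getD_append _ _ _ _ (by omega)]

end WordRAM

/-! ### Frame conditions and copying of database strings -/

namespace WordRAM

open Inst

/-- Only the registers in `W` may differ. -/
def Keeps (W : List ℕ) (v v' : State) : Prop := ∀ i, i ∉ W → v'.reg i = v.reg i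

theorem Keeps.trans {W W' : List ℕ} {v v' v'' : State} (h : Keeps W v v') (h' : Keeps W' v' v'') :
    Keeps (W ++ W') v v'' := by
  intro i hi
  simp only [List.mem_append, not_or] at hi
  rw [h' i hi.2, h i hi.1]

theorem Keeps.mono {W W' : List ℕ} {v v' : State} (h : Keeps W v v') (hW : W ⊆ W') :
    Keeps W' v v' := fun i hi => h i fun hi' => hi (hW hi')

theorem Keeps.ctx {W : List ℕ} {I : Inst} {v v' : State} (h : Keeps W v v') (hC : I.Ctx v)
    (hW : ∀ i ∈ W, i < 20) : I.Ctx v' :=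
  hC.of_eq fun i hi => h i fun hi' => by have := hW i hi'; omega

theorem Keeps.set {W : List ℕ} {v v' : State} (h : Keeps W v v') {x : ℕ} (hx : x ∈ W) (w : ℕ) :
    Keeps W v (v'.set x w) := by
  intro i hi
  rw [State.set_reg, if_neg (fun e : i = x => hi (e ▸ hx)), h i hi]

theorem Keeps.put {W : List ℕ} {v v' : State} (h : Keeps W v v') (a w : ℕ) :
    Keeps W v (v'.put a w) := h

theorem Keeps.refl (W : List ℕ) (v : State) : Keeps W v v := fun _ _ => rfl

/-- Keeps row-major addresses inside their table. -/
theorem mul_add_lt_mul {a b i t : ℕ} (hi : i < a) (ht : t < b) : i * b + t < a * b := by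
  have := Nat.mul_le_mul_right b (Nat.succ_le_of_lt hi)
  rw [Nat.succ_mul] at this
  omega

theorem runs_copyString {I : Inst} {E : Env} (hI : I.Holds E) {v : State} (hC : I.Ctx v)
    {i : ℕ} (hi : i < I.n) (h13 : v.reg 13 = i) :
    Runs E copyString v (50 * (I.d + 2)) (fun v' => Keeps [3, 4, 14] v v' ∧
      v'.reg 14 = (I.S i).length ∧ v'.HasString I (I.d + 2) (I.S i) ∧
      ∀ a, ¬ (I.d + 2 ≤ a ∧ a < 2 * I.d + 4) → v'.mem a = v.mem a) := by
  have hs := hI.scratch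
  have hw := hI.address_lt
  have hE := hI.fits
  have hrow : i * (I.d + 3) + (I.d + 2) < I.n * (I.d + 3) := mul_add_lt_mul hi (by omega)
  simp only [Inst.scratch, Inst.permBase, Inst.seedBase] at hs hw
  unfold copyString
  refine Runs.cons_asg hE (by decide) ?_ (by norm_num [Ex.cost]; omega) ?_
  · simp only [Ex.Ok, Ex.eval, h13, hC.r28, hC.r29]
    omega
  refine Runs.cons_asg hE (by decide) (by simp [Ex.Ok]) (by norm_num [Ex.cost]; omega) ?_
  refine Runs.cons_asg hE (by decide) (by simp [Ex.Ok]) (by norm_num [Ex.cost]; omega) ?_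
  refine Runs.cons (Runs.loop_of_le (c := 30) (T := 31 * (I.d + 2) + 1) (by simp [Test.Ok])
    (fun v' => Keeps [3, 4, 14] v v' ∧ v'.reg 4 = 24 + i * (I.d + 3) ∧
      v'.reg 14 = (I.S i).length ∧ v'.reg 3 ≤ I.d + 2 ∧
      (∀ t < v'.reg 3, v'.mem (I.d + 2 + t) = I.buf (I.S i) t) ∧
      ∀ a, ¬ (I.d + 2 ≤ a ∧ a < 2 * I.d + 4) → v'.mem a = v.mem a)
    (fun v' => I.d + 2 - v'.reg 3) ?_ ?_ ?_) ?_ ?_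
  · rintro v' ⟨hf, r4, r14, hle, hm, hm'⟩ hb
    have hC' := hf.ctx hC (by decide)
    simp only [Test.holds, hC'.r37] at hb
    refine Runs.cons_sto hE ?_ ?_ ?_ (by decide) ?_
    · simp only [Ex.Ok, Ex.eval, hC'.r32]; omega
    · simp only [Ex.Ok, Ex.eval, r4]; omega
    · simp only [Ex.eval, hC'.r32]; omega
    refine Runs.cons_asg hE (by decide) ?_ (by decide) ?_
    · simp only [Ex.Ok, Ex.eval, State.put_reg]; omega
    refine Runs.nil ⟨⟨(hf.put _ _).set (by decide) _, ?_, ?_, ?_, ?_, ?_⟩, ?_⟩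
    · simp [State.set_reg, State.put_reg, r4]
    · simp [State.set_reg, State.put_reg, r14]
    · simp [State.set_reg, State.put_reg, Ex.eval]; omega
    · intro t ht
      simp only [State.set_reg, State.put_reg, Ex.eval, if_true] at ht
      simp only [State.set_mem, State.put_mem, Ex.eval, r4, hC'.r32]
      split_ifs with h
      · rw [hI.data_buf i hi _ (by omega)]; congr 1; omega
      · exact hm t (by omega)
    · intro a ha
      simp only [State.set_mem, State.put_mem, Ex.eval, hC'.r32]
      rw [if_neg (by omega), hm' a ha]
    · simp [State.set_reg, State.put_reg, Ex.eval]; omega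
  · refine ⟨?_, ?_, ?_, ?_, ?_, ?_⟩
    · exact (((Keeps.refl _ v).set (by decide) _).set (by decide) _).set (by decide) _
    · simp [State.set_reg, Ex.eval, h13, hC.r28, hC.r29]
    · simp [State.set_reg, Ex.eval, h13, hC.r28, hC.r29, ← hI.data_length i hi]
    · simp [State.set_reg, Ex.eval]
    · simp [State.set_reg, Ex.eval]
    · intro a _; rfl
  · simp [State.set_reg, Ex.eval]
  · norm_num [Ex.cost]; omega
  · rintro v' ⟨⟨hf, r4, r14, hle, hm, hm'⟩, hb⟩
    have hC' := hf.ctx hC (by decide)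
    have r3 : v'.reg 3 = I.d + 2 := by simp only [Test.holds, hC'.r37] at hb; omega
    refine Runs.nil ⟨hf, r14, ?_, hm'⟩
    intro t ht
    have := hI.length_S i hi
    exact hm t (by omega)

/-! ### The hash -/

namespace Inst

variable (I : Inst)

/-- The value at the character `c` of the underlying function whose coefficients are at `t`. -/
def value (j t c : ℕ) : ℕ := (I.seed j t + I.seed j (t + 1) * c) % I.P

/-- The character written at position `k`, and whether the scan moves on. -/
def step (j k c : ℕ) : ℕ × Bool :=
  if I.value j (4 * k) c < I.ta then (1, false)
  else if I.value j (4 * k + 2) c < I.tr then (1, true)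
  else (c + 2, true)

/-- The codes of the hash, padded with `0` to the full length. -/
def scan (j : ℕ) : ℕ → ℕ → List ℕ → List ℕ
  | 0, _, _ => []
  | m + 1, k, [] => 0 :: scan j m (k + 1) []
  | m + 1, k, c :: x =>
      (I.step j k c).1 :: scan j m (k + 1) (if (I.step j k c).2 then x else c :: x)

/-- The padded hash of a string. -/
def key (j : ℕ) (x : List ℕ) : List ℕ := I.scan j I.ℓ 0 (x ++ [I.σ])

theorem length_scan (j m k : ℕ) (x : List ℕ) : (I.scan j m k x).length = m := by
  induction m generalizing k x with
  | zero => rw [scan]; rfl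
  | succ m ih => cases x <;> simp [scan, ih]

theorem length_key (j : ℕ) (x : List ℕ) : (I.key j x).length = I.ℓ := I.length_scan _ _ _ _

end Inst

theorem Ex.var_ok {E : Env} {v : State} {i : ℕ} (h : i < 50) : (Ex.var i).Ok E v := h

theorem Ex.load_var_ok {E : Env} {v : State} {i : ℕ} (h : i < 50) : (Ex.var i).load.Ok E v := h

theorem State.set_set (s : State) (i v w : ℕ) : (s.set i v).set i w = s.set i w := by
  simp [State.set]

/-- The remainder modulo `P` is obtained as `a - a / P * P`. No product overflows because the
coefficients are below `P`, the character is at most `σ + 1`, and `P * (σ + 3)` fits into a word. -/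
theorem Runs.cons_value {I : Inst} {E : Env} (hI : I.Holds E) {v : State} (hC : I.Ctx v)
    {j t : ℕ} (hj : j < I.R) (ht : t + 1 < 4 * I.ℓ) (h6 : v.reg 6 ≤ I.σ + 1) (a : Ex)
    (ha : a.Ok E v) (hcost : a.cost ≤ 10) (hval : a.eval E v = I.seedBase + j * (4 * I.ℓ) + t)
    {T : ℕ} (hT : 60 ≤ T) {l : List Prog} {Q : State → Prop}
    (h : Runs E (seqs l) (v.set 7 (I.value j t (v.reg 6))) (T - 60) Q) :
    Runs E (seqs (WordRAM.asg 7 (affine a) ::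
      WordRAM.asg 7 (.sub (.var 7) (.mul (.div (.var 7) (.var 23)) (.var 23))) :: l)) v T Q := by
  have hw := hI.address_lt
  have hw' := hI.value_lt
  have hE := hI.fits
  have hrow : j * (4 * I.ℓ) + (t + 1) < I.R * (4 * I.ℓ) := mul_add_lt_mul hj (by omega)
  have d0 := hI.data_seed j hj t (by omega)
  have d1 := hI.data_seed j hj (t + 1) (by omega)
  have l0 := hI.seed_lt j hj t (by omega)
  have l1 := hI.seed_lt j hj (t + 1) (by omega)
  have hmul : I.seed j t + I.seed j (t + 1) * v.reg 6 < 2 ^ E.wordSize := by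
    have h₁ : I.seed j (t + 1) * v.reg 6 ≤ I.P * (I.σ + 1) := Nat.mul_le_mul l1.le h6
    have h₂ : I.P * (I.σ + 3) = I.P * (I.σ + 1) + 2 * I.P := by ring
    omega
  have hmod : ∀ a, a - a / I.P * I.P = a % I.P := fun a => by
    have := Nat.div_add_mod a I.P
    rw [mul_comm] at this
    omega
  simp only [Inst.permBase] at hw
  have e : (affine a).eval E v = I.seed j t + I.seed j (t + 1) * v.reg 6 := by
    simp only [affine, Ex.eval, hval, add_assoc] at d0 d1 ⊢
    rw [d0, d1]
  have hok : (affine a).Ok E v := by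
    refine ⟨ha, ⟨⟨ha, ?_, ?_⟩, Ex.var_ok (by decide), ?_⟩, ?_⟩
    · simp only [Ex.Ok]; omega
    · simp only [Ex.eval, hval]; omega
    · simp only [Ex.eval, hval, add_assoc] at d1 ⊢
      rw [d1]; omega
    · have := e
      simp only [affine, Ex.eval] at this ⊢
      omega
  have ec : (affine a).cost + 2 ≤ 40 := by simp only [affine, Ex.cost]; omega
  have hr7 : (v.set 7 ((affine a).eval E v)).reg 7 = I.seed j t + I.seed j (t + 1) * v.reg 6 := by
    rw [State.set_reg, if_pos rfl, e]
  have hr23 : (v.set 7 ((affine a).eval E v)).reg 23 = I.P := by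
    rw [State.set_reg, if_neg (by decide), hC.r23]
  refine Runs.cons_asg hE (by decide) hok (by omega) ?_
  refine Runs.cons_asg hE (by decide) ?_ (by simp only [Ex.cost]; omega) ?_
  · simp only [Ex.Ok, Ex.eval, hr7, hr23]
    exact ⟨by decide, ⟨by decide, by decide⟩, by decide,
      (Nat.div_mul_le_self _ _).trans_lt hmul⟩
  · simp only [Ex.eval, hr7, hr23, State.set_set, hmod]
    exact h.mono (by simp only [Ex.cost]; omega) fun _ => id

theorem runs_hashStep {I : Inst} {E : Env} (hI : I.Holds E) {v : State} (hC : I.Ctx v)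
    {j k : ℕ} (hj : j < I.R) (hk : k < I.ℓ) (h6 : v.reg 6 ≤ I.σ + 1)
    (h4 : v.reg 4 + 1 < 2 ^ E.wordSize)
    (h5 : v.reg 5 = I.seedBase + j * (4 * I.ℓ) + 4 * k) :
    Runs E hashStep v 200 (fun v' => Keeps [4, 7, 8] v v' ∧ v'.mem = v.mem ∧
      (v.reg 6 = I.σ + 1 → v'.reg 8 = 0 ∧ v'.reg 4 = v.reg 4) ∧
      (v.reg 6 ≠ I.σ + 1 → v'.reg 8 = (I.step j k (v.reg 6)).1 ∧
        v'.reg 4 = if (I.step j k (v.reg 6)).2 then v.reg 4 + 1 else v.reg 4)) := by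
  have hw := hI.address_lt
  have hE := hI.fits
  have hrow : j * (4 * I.ℓ) + (4 * k + 3) < I.R * (4 * I.ℓ) := mul_add_lt_mul hj (by omega)
  simp only [Inst.permBase] at hw
  have hlit : ∀ v', (Ex.lit 1).Ok E v' := fun v' => by simp only [Ex.Ok]; omega
  have hlit0 : ∀ v', (Ex.lit 0).Ok E v' := fun v' => by simp only [Ex.Ok]; omega
  unfold hashStep
  refine Runs.ite (by simp [Test.Ok]) (fun hb => ?_) (fun hb => ?_) (by omega)
  · simp only [Test.holds, hC.r36] at hb
    refine Runs.asg hE (by decide) (hlit0 _) (by decide) ⟨?_, rfl, ?_, ?_⟩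
    · exact (Keeps.refl _ v).set (by decide) _
    · simp [State.set_reg, Ex.eval]
    · intro h; exact absurd hb h
  · simp only [Test.holds, hC.r36] at hb
    refine Runs.cons_value hI hC hj (t := 4 * k) (by omega) h6 (.var 5) (Ex.var_ok (by decide))
      (by decide) h5
      (by omega) ?_
    refine Runs.cons (T₀ := 110) ?_ (by decide) fun v' h => Runs.nil h
    refine Runs.ite (by simp [Test.Ok]) (fun hb' => ?_) (fun hb' => ?_) (by omega)
    · simp only [Test.holds, State.set_reg, hC.r24, Nat.reduceEqDiff, if_true, if_false] at hb'
      refine Runs.asg hE (by decide) (hlit _) (by decide) ⟨?_, rfl, ?_, ?_⟩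
      · exact ((Keeps.refl _ v).set (by decide) _).set (by decide) _
      · intro h; exact absurd h hb
      · intro _
        simp [State.set_reg, Ex.eval, Inst.step, hb']
    · simp only [Test.holds, State.set_reg, hC.r24, Nat.reduceEqDiff, if_true, if_false] at hb'
      refine Runs.cons_asg hE (by decide) ⟨Ex.var_ok (by decide), hlit _, ?_⟩ (by decide) ?_
      · simpa only [Ex.eval, State.set_reg, Nat.reduceEqDiff, if_false] using h4
      set v₁ := (v.set 7 (I.value j (4 * k) (v.reg 6))).set 4
        (((Ex.var 4).add (Ex.lit 1)).eval E (v.set 7 (I.value j (4 * k) (v.reg 6)))) with hv₁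
      have f₁ : Keeps [4, 7, 8] v v₁ :=
        ((Keeps.refl _ v).set (by decide) _).set (by decide) _
      have r4 : v₁.reg 4 = v.reg 4 + 1 := by simp [hv₁, State.set_reg, Ex.eval]
      have r5 : v₁.reg 5 = v.reg 5 := f₁ 5 (by decide)
      have r6 : v₁.reg 6 = v.reg 6 := f₁ 6 (by decide)
      have C₁ := f₁.ctx hC (by decide)
      refine Runs.cons_value hI C₁ hj (t := 4 * k + 2) (by omega) (by omega)
        (.add (.var 5) (.lit 2)) ⟨Ex.var_ok (by decide), ?_, ?_⟩ (by decide) (by simp only [Ex.eval]; omega) (by decide) ?_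
      · simp only [Ex.Ok]; omega
      · simp only [Ex.eval]; omega
      refine Runs.cons (T₀ := 20) (Q₀ := fun v' => Keeps [4, 7, 8] v v' ∧ v'.mem = v.mem ∧
        v'.reg 4 = v.reg 4 + 1 ∧ v'.reg 8 = (I.step j k (v.reg 6)).1 ∧
        (I.step j k (v.reg 6)).2 = true) ?_ (by decide) ?_
      · rw [r6]
        refine Runs.ite (by simp [Test.Ok]) (fun hb₂ => ?_) (fun hb₂ => ?_) (by omega)
        · simp only [Test.holds, State.set_reg, C₁.r25, Nat.reduceEqDiff, if_true, if_false] at hb₂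
          refine Runs.asg hE (by decide) (hlit _) (by decide) ⟨?_, rfl, ?_, ?_⟩
          · exact (f₁.set (by decide) _).set (by decide) _
          · simp [State.set_reg, r4]
          · simp [State.set_reg, Ex.eval, Inst.step, hb', hb₂]
        · simp only [Test.holds, State.set_reg, C₁.r25, Nat.reduceEqDiff, if_true, if_false] at hb₂
          refine Runs.asg hE (by decide) ⟨Ex.var_ok (by decide), ?_, ?_⟩ (by decide) ⟨?_, rfl, ?_, ?_⟩
          · simp only [Ex.Ok]; omega
          · simp only [Ex.eval, State.set_reg, Nat.reduceEqDiff, if_false]; omega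
          · exact (f₁.set (by decide) _).set (by decide) _
          · simp [State.set_reg, r4]
          · simp [State.set_reg, Ex.eval, Inst.step, hb', hb₂, r6]
      · rintro v' ⟨h₁, h₂, h₃, h₄, h₅⟩
        refine Runs.nil ⟨h₁, h₂, fun h => absurd h hb, fun _ => ⟨h₄, ?_⟩⟩
        rw [h₃, h₅, if_pos rfl]

end WordRAM

namespace WordRAM

open Inst

theorem Inst.buf_of_lt (I : Inst) (x : List ℕ) {i : ℕ} (h : i < (x ++ [I.σ]).length) :
    I.buf x i = (x ++ [I.σ])[i] := by
  have e : x ++ [I.σ, I.σ + 1] = (x ++ [I.σ]) ++ [I.σ + 1] := by simp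
  rw [Inst.buf, e, List.getD_append _ _ _ _ h, List.getD_eq_getElem _ _ h]

theorem Inst.buf_length (I : Inst) (x : List ℕ) : I.buf x (x ++ [I.σ]).length = I.σ + 1 := by
  have e : x ++ [I.σ, I.σ + 1] = (x ++ [I.σ]) ++ [I.σ + 1] := by simp
  rw [Inst.buf, e, List.getD_append_right _ _ _ _ le_rfl]
  simp

/-- Invariant: the part of the key still to be written is the scan of the suffix of `x ++ [σ]` that
starts at the reading position. The position may equal the length of `x ++ [σ]`, where the padding
character lies. By `hab` the output is written beyond the string, so reading is not disturbed. -/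
theorem runs_hash {I : Inst} {E : Env} (hI : I.Holds E) {v : State} (hC : I.Ctx v)
    {src dst a b j : ℕ} (hs1 : 20 ≤ src) (hs2 : src < 50) (hd1 : 20 ≤ dst) (hd2 : dst < 50)
    (ha : v.reg src = a) (hb : v.reg dst = b) (hj : v.reg 2 = j) (hjR : j < I.R)
    {x : List ℕ} (hx : x.length ≤ I.d) (hxσ : ∀ c ∈ x, c < I.σ) (hv : v.HasString I a x)
    (hab : a + (I.d + 2) ≤ b) (hbs : b + I.ℓ ≤ I.scratch) :
    Runs E (hash src dst) v (300 * (I.ℓ + 1)) (fun v' => Keeps [3, 4, 5, 6, 7, 8] v v' ∧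
      (∀ t < I.ℓ, v'.mem (b + t) = (I.key j x).getD t 0) ∧
      ∀ t, ¬ (b ≤ t ∧ t < b + I.ℓ) → v'.mem t = v.mem t) := by
  have hs := hI.scratch
  have hw := hI.address_lt
  have hE := hI.fits
  simp only [Inst.permBase] at hw
  have hlen : (x ++ [I.σ]).length = x.length + 1 := by simp
  have hmul : j * (4 * I.ℓ) ≤ I.R * (4 * I.ℓ) := Nat.mul_le_mul_right _ hjR.le
  have hlit : ∀ c < 50, ∀ v', (Ex.lit c).Ok E v' := fun c hc v' => by simp only [Ex.Ok]; omega
  unfold hash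
  refine Runs.cons_asg hE (by decide) (hlit _ (by decide) _) (by norm_num [Ex.cost]; omega) ?_
  refine Runs.cons_asg hE (by decide) (Ex.var_ok hs2) (by norm_num [Ex.cost]; omega) ?_
  refine Runs.cons_asg hE (by decide) ?_ (by norm_num [Ex.cost]; omega) ?_
  · simp only [Ex.Ok, Ex.eval, State.set_reg, Nat.reduceEqDiff, if_false, hC.r30, hC.r38, hj]
    omega
  refine Runs.cons (Runs.loop_of_le (c := 280) (T := 281 * I.ℓ + 1) (by simp [Test.Ok])
    (fun v' => Keeps [3, 4, 5, 6, 7, 8] v v' ∧ v'.reg 3 ≤ I.ℓ ∧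
      v'.reg 5 = I.seedBase + j * (4 * I.ℓ) + 4 * v'.reg 3 ∧
      (∀ t < v'.reg 3, v'.mem (b + t) = (I.key j x).getD t 0) ∧
      (∃ i ≤ (x ++ [I.σ]).length, v'.reg 4 = a + i ∧
        (I.key j x).drop (v'.reg 3) = I.scan j (I.ℓ - v'.reg 3) (v'.reg 3) ((x ++ [I.σ]).drop i)) ∧
      ∀ t, ¬ (b ≤ t ∧ t < b + I.ℓ) → v'.mem t = v.mem t)
    (fun v' => I.ℓ - v'.reg 3) ?_ ?_ ?_) ?_ ?_
  · rintro v' ⟨hf, hle, r5, hm, ⟨i, hi, r4, hkey⟩, hm'⟩ hb'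
    have hC' := hf.ctx hC (by decide)
    simp only [Test.holds, hC'.r22] at hb'
    obtain ⟨k, hk⟩ : ∃ k, v'.reg 3 = k := ⟨_, rfl⟩
    rw [hk] at hle r5 hm hkey hb'
    have hc : v'.mem (v'.reg 4) = I.buf x i := by
      rw [hm' _ (by omega), r4, hv i (by omega)]
    have hcσ : I.buf x i ≤ I.σ + 1 ∧ (i = (x ++ [I.σ]).length ↔ I.buf x i = I.σ + 1) := by
      rcases hi.lt_or_eq with h | h
      · rw [I.buf_of_lt x h]
        have : (x ++ [I.σ])[i] ≤ I.σ := by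
          have := List.getElem_mem h
          rw [List.mem_append, List.mem_singleton] at this
          rcases this with h' | h'
          · exact (hxσ _ h').le
          · exact h'.le
        constructor <;> omega
      · rw [h, I.buf_length]
        simp
    refine Runs.cons_asg hE (by decide) (Ex.load_var_ok (by decide)) (by decide) ?_
    simp only [Ex.eval, hc]
    set v₁ := v'.set 6 (I.buf x i) with hv₁
    have f₁ : Keeps [3, 4, 5, 6, 7, 8] v v₁ := hf.set (by decide) _
    have q6 : v₁.reg 6 = I.buf x i := by simp [hv₁, State.set_reg]
    have q4 : v₁.reg 4 = a + i := by simp [hv₁, State.set_reg, r4]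
    have q3 : v₁.reg 3 = k := by simp [hv₁, State.set_reg, hk]
    have q5 : v₁.reg 5 = I.seedBase + j * (4 * I.ℓ) + 4 * k := by simp [hv₁, State.set_reg, r5]
    refine Runs.cons (runs_hashStep hI (f₁.ctx hC (by decide)) hjR hb'
      (by rw [q6]; exact hcσ.1) (by omega) q5)
      (by decide) ?_
    rintro v₂ ⟨f₂, m₂, hend, hstep⟩
    have p3 : v₂.reg 3 = k := by rw [f₂ 3 (by decide), q3]
    have p5 : v₂.reg 5 = I.seedBase + j * (4 * I.ℓ) + 4 * k := by rw [f₂ 5 (by decide), q5]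
    have F₂ : Keeps [3, 4, 5, 6, 7, 8] v v₂ := (f₁.trans f₂).mono (by decide)
    have C₂ := F₂.ctx hC (by decide)
    have pd : v₂.reg dst = b := by
      rw [F₂ dst (by simp only [List.mem_cons, List.not_mem_nil, or_false]; omega), hb]
    have hrow : j * (4 * I.ℓ) + (4 * k + 3) < I.R * (4 * I.ℓ) := mul_add_lt_mul hjR (by omega)
    rw [q6, q4] at hend hstep
    obtain ⟨i', hi', p4, hkey'⟩ : ∃ i' ≤ (x ++ [I.σ]).length, v₂.reg 4 = a + i' ∧
        (I.key j x).drop k =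
          v₂.reg 8 :: I.scan j (I.ℓ - (k + 1)) (k + 1) ((x ++ [I.σ]).drop i') := by
      have em : I.ℓ - k = (I.ℓ - (k + 1)) + 1 := by omega
      rcases hi.lt_or_eq with h | h
      · have hne := mt hcσ.2.2 h.ne
        have hst := hstep hne
        rw [hkey, em, List.drop_eq_getElem_cons h, ← I.buf_of_lt x h, Inst.scan, ← hst.1]
        by_cases hmv : (I.step j k (I.buf x i)).2 = true
        · refine ⟨i + 1, h, ?_, ?_⟩
          · rw [hst.2, if_pos hmv]; omega
          · rw [if_pos hmv]
        · refine ⟨i, hi, ?_, ?_⟩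
          · rw [hst.2, if_neg hmv]
          · rw [if_neg hmv, I.buf_of_lt x h, ← List.drop_eq_getElem_cons h]
      · have hst := hend (hcσ.2.1 h)
        refine ⟨i, hi, hst.2, ?_⟩
        rw [hkey, em, h, List.drop_length, Inst.scan, hst.1]
    have hget : (I.key j x).getD k 0 = v₂.reg 8 := by
      have : ((I.key j x).drop k).getD 0 0 = v₂.reg 8 := by rw [hkey']; rfl
      simpa [List.getD_eq_getElem?_getD] using this
    refine Runs.cons_sto hE ⟨Ex.var_ok hd2, Ex.var_ok (by decide), ?_⟩ (Ex.var_ok (by decide)) ?_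
      (by norm_num [Ex.cost]) ?_
    · simp only [Ex.eval, pd, p3]; omega
    · simp only [Ex.eval, pd, p3]; omega
    refine Runs.cons_asg hE (by decide) ⟨Ex.var_ok (by decide), hlit _ (by decide) _, ?_⟩
      (by norm_num [Ex.cost]) ?_
    · simp only [Ex.eval, State.put_reg, p5]; omega
    refine Runs.cons_asg hE (by decide) ⟨Ex.var_ok (by decide), hlit _ (by decide) _, ?_⟩
      (by norm_num [Ex.cost]) ?_
    · simp only [Ex.eval, State.set_reg, State.put_reg, Nat.reduceEqDiff, if_false, p3]; omega
    simp only [Ex.eval, State.set_reg, State.put_reg, Nat.reduceEqDiff, if_false, p3, p5, pd]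
    refine Runs.nil ⟨⟨((F₂.put _ _).set (by decide) _).set (by decide) _, ?_, ?_, ?_, ?_, ?_⟩, ?_⟩
    · simp [State.set_reg]; omega
    · simp [State.set_reg]; omega
    · intro t ht
      simp only [State.set_reg, if_true] at ht
      simp only [State.set_mem, State.put_mem]
      split_ifs with h
      · rw [show t = k by omega, hget]
      · rw [m₂, hv₁, State.set_mem, hm t (by omega)]
    · refine ⟨i', hi', by simp [State.set_reg, State.put_reg, p4], ?_⟩
      simp only [State.set_reg, if_true]
      rw [← List.drop_drop, hkey', List.drop_one, List.tail_cons]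
    · intro t ht
      simp only [State.set_mem, State.put_mem]
      rw [if_neg (by omega), m₂, hv₁, State.set_mem, hm' t ht]
    · simp only [State.set_reg, if_true, hk]; omega
  · refine ⟨(((Keeps.refl _ v).set (by decide) _).set (by decide) _).set (by decide) _,
      ?_, ?_, ?_, ⟨0, ?_, ?_, ?_⟩, ?_⟩
    · simp [State.set_reg, Ex.eval]
    · simp [State.set_reg, Ex.eval, hC.r30, hC.r38, hj]
    · simp [State.set_reg, Ex.eval]
    · omega
    · simp [State.set_reg, Ex.eval, ha, show src ≠ 3 by omega]
    · simp [State.set_reg, Ex.eval, Inst.key]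
    · intro t _; rfl
  · simp [State.set_reg, Ex.eval]
  · norm_num [Ex.cost]; omega
  · rintro v' ⟨⟨hf, hle, r5, hm, _, hm'⟩, hb'⟩
    have hC' := hf.ctx hC (by decide)
    simp only [Test.holds, hC'.r22] at hb'
    exact Runs.nil ⟨hf, fun t ht => hm t (by omega), hm'⟩

/-- The padded hash, ordered lexicographically. -/
def Inst.lexKey (I : Inst) (j : ℕ) (x : List ℕ) : Lex (Fin I.ℓ → ℕ) :=
  toLex fun t => (I.key j x).getD t 0

/-- The first position where the keys differ decides the lexicographic order; the counter then jumps
to `ℓ`, which is the second alternative of the invariant. -/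
theorem runs_compareHash {I : Inst} {E : Env} (hI : I.Holds E) {v : State} (hC : I.Ctx v)
    {j : ℕ} {x y : List ℕ}
    (hx : ∀ t < I.ℓ, v.mem (3 * I.d + 5 + t) = (I.key j x).getD t 0)
    (hy : ∀ t < I.ℓ, v.mem (3 * I.d + 5 + I.ℓ + t) = (I.key j y).getD t 0) :
    Runs E compareHash v (50 * (I.ℓ + 1)) (fun v' => Keeps [3, 6, 7, 12] v v' ∧ v'.mem = v.mem ∧
      (v'.reg 12 = 0 ∧ I.lexKey j y < I.lexKey j x ∨ v'.reg 12 = 1 ∧ I.lexKey j y = I.lexKey j x ∨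
        v'.reg 12 = 2 ∧ I.lexKey j x < I.lexKey j y)) := by
  have hs := hI.scratch
  have hw := hI.address_lt
  have hE := hI.fits
  simp only [Inst.scratch] at hs hw
  have hlit : ∀ c < 50, ∀ v', (Ex.lit c).Ok E v' := fun c hc v' => by simp only [Ex.Ok]; omega
  unfold compareHash
  refine Runs.cons_asg hE (by decide) (hlit _ (by decide) _) (by norm_num [Ex.cost]; omega) ?_
  refine Runs.cons_asg hE (by decide) (hlit _ (by decide) _) (by norm_num [Ex.cost]; omega) ?_
  refine Runs.cons (Runs.loop_of_le (c := 40) (T := 41 * I.ℓ + 1) (by simp [Test.Ok])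
    (fun v' => Keeps [3, 6, 7, 12] v v' ∧ v'.mem = v.mem ∧ v'.reg 3 ≤ I.ℓ ∧
      (v'.reg 12 = 1 ∧ (∀ t < v'.reg 3, (I.key j y).getD t 0 = (I.key j x).getD t 0) ∨
       v'.reg 3 = I.ℓ ∧ (v'.reg 12 = 0 ∧ I.lexKey j y < I.lexKey j x ∨
        v'.reg 12 = 2 ∧ I.lexKey j x < I.lexKey j y)))
    (fun v' => I.ℓ - v'.reg 3) ?_ ?_ ?_) ?_ ?_
  · rintro v' ⟨hf, hm, hle, hcase⟩ hb'
    have hC' := hf.ctx hC (by decide)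
    simp only [Test.holds, hC'.r22] at hb'
    obtain ⟨r12, heq⟩ : v'.reg 12 = 1 ∧ (∀ t < v'.reg 3, (I.key j y).getD t 0 =
        (I.key j x).getD t 0) := by
      rcases hcase with h | h
      · exact h
      · omega
    obtain ⟨k, hk⟩ : ∃ k, v'.reg 3 = k := ⟨_, rfl⟩
    rw [hk] at hb' heq
    have hxk := hx k hb'
    have hyk := hy k hb'
    refine Runs.cons_asg hE (by decide) ⟨Ex.var_ok (by decide), Ex.var_ok (by decide), ?_⟩
      (by decide) ?_
    · simp only [Ex.eval, hC'.r33, hk]; omega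
    simp only [Ex.eval, hC'.r33, hk, hm, hxk]
    refine Runs.cons_asg hE (by decide) ⟨Ex.var_ok (by decide), Ex.var_ok (by decide), ?_⟩
      (by decide) ?_
    · simp only [Ex.eval, State.set_reg, Nat.reduceEqDiff, if_false, hC'.r34, hk]; omega
    simp only [Ex.eval, State.set_reg, State.set_mem, Nat.reduceEqDiff, if_false, hC'.r34, hk, hm,
      hyk]
    refine Runs.cons (T₀ := 20) ?_ (by decide) fun v' h => Runs.nil h
    have f₁ : Keeps [3, 6, 7, 12] v ((v'.set 6 ((I.key j x).getD k 0)).set 7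
        ((I.key j y).getD k 0)) := (hf.set (by decide) _).set (by decide) _
    refine Runs.ite (by simp [Test.Ok]) (fun h => ?_) (fun h => ?_) (by decide)
    · simp only [Test.holds, State.set_reg, Nat.reduceEqDiff, if_true, if_false] at h
      refine Runs.asg hE (by decide) ⟨Ex.var_ok (by decide), hlit _ (by decide) _, ?_⟩ (by decide) ?_
      · simp only [Ex.eval, State.set_reg, Nat.reduceEqDiff, if_false, hk]; omega
      refine ⟨⟨f₁.set (by decide) _, hm, ?_, .inl ⟨?_, ?_⟩⟩, ?_⟩
      · simp [Ex.eval, State.set_reg, hk]; omega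
      · simp [State.set_reg, r12]
      · intro t ht
        simp only [Ex.eval, State.set_reg, Nat.reduceEqDiff, if_true, if_false, hk] at ht
        rcases (show t < k ∨ t = k by omega) with h' | rfl
        · exact heq t h'
        · exact h.symm
      · simp [Ex.eval, State.set_reg, hk]; omega
    · simp only [Test.holds, State.set_reg, Nat.reduceEqDiff, if_true, if_false] at h
      refine Runs.cons_asg hE (by decide) (Ex.var_ok (by decide)) (by decide) ?_
      simp only [Ex.eval, State.set_reg, Nat.reduceEqDiff, if_false, hC'.r22]
      refine Runs.cons (T₀ := 10) ?_ (by decide) fun v' h => Runs.nil h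
      refine Runs.ite (by simp [Test.Ok]) (fun h' => ?_) (fun h' => ?_) (by decide)
      · simp only [Test.holds, State.set_reg, Nat.reduceEqDiff, if_true, if_false] at h'
        refine Runs.asg hE (by decide) (hlit _ (by decide) _) (by decide) ?_
        refine ⟨⟨(f₁.set (by decide) _).set (by decide) _, hm, ?_, .inr ⟨?_, .inl ⟨?_, ?_⟩⟩⟩, ?_⟩
        · simp [State.set_reg]
        · simp [State.set_reg]
        · simp [State.set_reg, Ex.eval]
        · exact ⟨⟨k, hb'⟩, fun t ht => heq t ht, h'⟩
        · simp [State.set_reg]; omega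
      · simp only [Test.holds, State.set_reg, Nat.reduceEqDiff, if_true, if_false] at h'
        refine Runs.asg hE (by decide) (hlit _ (by decide) _) (by decide) ?_
        refine ⟨⟨(f₁.set (by decide) _).set (by decide) _, hm, ?_, .inr ⟨?_, .inr ⟨?_, ?_⟩⟩⟩, ?_⟩
        · simp [State.set_reg]
        · simp [State.set_reg]
        · simp [State.set_reg, Ex.eval]
        · exact ⟨⟨k, hb'⟩, fun t ht => (heq t ht).symm, lt_of_le_of_ne (not_lt.1 h') h⟩
        · simp [State.set_reg]; omega
  · refine ⟨((Keeps.refl _ v).set (by decide) _).set (by decide) _, rfl, ?_, .inl ⟨?_, ?_⟩⟩ <;>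
      simp [State.set_reg, Ex.eval]
  · simp [State.set_reg, Ex.eval]
  · norm_num [Ex.cost]; omega
  · rintro v' ⟨⟨hf, hm, hle, hcase⟩, hb'⟩
    have hC' := hf.ctx hC (by decide)
    simp only [Test.holds, hC'.r22] at hb'
    refine Runs.nil ⟨hf, hm, ?_⟩
    rcases hcase with ⟨h, h'⟩ | ⟨_, h | h⟩
    · refine .inr (.inl ⟨h, ?_⟩)
      exact congrArg toLex (funext fun t => h' t (by omega))
    · exact .inl h
    · exact .inr (.inr h)

end WordRAM

/-! ### Comparison with a stored string and binary search -/

namespace WordRAM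

open Inst

/-- The working memory may differ only in the two buffers for database strings and their hashes. -/
def KeepsMem (I : Inst) (v v' : State) : Prop :=
  ∀ a, ¬ (I.d + 2 ≤ a ∧ a < 2 * I.d + 4) →
    ¬ (3 * I.d + 5 + I.ℓ ≤ a ∧ a < 3 * I.d + 5 + I.ℓ + I.ℓ) → v'.mem a = v.mem a

theorem KeepsMem.trans {I : Inst} {v v' v'' : State} (h : KeepsMem I v v')
    (h' : KeepsMem I v' v'') : KeepsMem I v v'' := fun a ha hb => by rw [h' a ha hb, h a ha hb]

/-- The hash of the query lies in the working memory. -/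
def Inst.HasHash (I : Inst) (v : State) (j : ℕ) : Prop :=
  ∀ t < I.ℓ, v.mem (3 * I.d + 5 + t) = (I.key j I.q).getD t 0

theorem KeepsMem.hasHash {I : Inst} {v v' : State} {j : ℕ} (h : KeepsMem I v v')
    (hv : I.HasHash v j) : I.HasHash v' j := fun t ht => by
  rw [h _ (by omega) (by omega), hv t ht]

theorem runs_compareAt {I : Inst} {E : Env} (hI : I.Holds E) {v : State} (hC : I.Ctx v)
    {j m : ℕ} (hj : v.reg 2 = j) (hjR : j < I.R) (hm : v.reg 11 = m) (hmn : m < I.n)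
    (hh : I.HasHash v j) :
    Runs E compareAt v (400 * (I.d + I.ℓ + 3)) (fun v' =>
      Keeps [3, 4, 5, 6, 7, 8, 12, 13, 14] v v' ∧ v'.reg 13 = I.perm j m ∧
      v'.reg 14 = (I.S (I.perm j m)).length ∧ v'.HasString I (I.d + 2) (I.S (I.perm j m)) ∧
      KeepsMem I v v' ∧
      (v'.reg 12 = 0 ∧ I.lexKey j (I.S (I.perm j m)) < I.lexKey j I.q ∨
        v'.reg 12 = 1 ∧ I.lexKey j (I.S (I.perm j m)) = I.lexKey j I.q ∨
        v'.reg 12 = 2 ∧ I.lexKey j I.q < I.lexKey j (I.S (I.perm j m)))) := by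
  have hs := hI.scratch
  have hw := hI.address_lt
  have hE := hI.fits
  have hrow : j * I.n + m < I.R * I.n := mul_add_lt_mul hjR hmn
  have hp := hI.perm_lt j hjR m hmn
  have hlen := hI.length_S _ hp
  unfold compareAt
  refine Runs.cons_asg hE (by decide) ⟨Ex.var_ok (by decide), ⟨⟨Ex.var_ok (by decide),
    Ex.var_ok (by decide), ?_⟩, Ex.var_ok (by decide), ?_⟩, ?_⟩ (by norm_num [Ex.cost]; omega) ?_
  · simp only [Ex.eval, hj, hC.r20]; omega
  · simp only [Ex.eval, hj, hC.r20, hm]; omega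
  · simp only [Ex.eval, hj, hC.r20, hC.r31, hm]; omega
  simp only [Ex.eval, hj, hC.r20, hC.r31, hm, hI.data_perm j hjR m hmn]
  set v₁ := v.set 13 (I.perm j m) with hv₁
  have f₁ : Keeps [3, 4, 5, 6, 7, 8, 12, 13, 14] v v₁ := (Keeps.refl _ v).set (by decide) _
  refine Runs.cons (runs_copyString hI (f₁.ctx hC (by decide)) hp
    (by simp [hv₁, State.set_reg])) (by norm_num [Ex.cost]; omega) ?_
  rintro v₂ ⟨f₂, r14, hstr, hm₂⟩
  have F₂ : Keeps [3, 4, 5, 6, 7, 8, 12, 13, 14] v v₂ := (f₁.trans f₂).mono (by decide)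
  have C₂ := F₂.ctx hC (by decide)
  refine Runs.cons (runs_hash hI C₂ (src := 32) (dst := 34) (by decide) (by decide) (by decide)
    (by decide) C₂.r32 C₂.r34 (by rw [F₂ 2 (by decide), hj]) hjR hlen (hI.mem_S _ hp) hstr
    (by omega) (by simp only [Inst.scratch]; omega)) (by norm_num [Ex.cost]; omega) ?_
  rintro v₃ ⟨f₃, hk₃, hm₃⟩
  have F₃ : Keeps [3, 4, 5, 6, 7, 8, 12, 13, 14] v v₃ := (F₂.trans f₃).mono (by decide)
  have K₃ : KeepsMem I v v₃ := fun a ha hb => by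
    rw [hm₃ a hb, hm₂ a ha]; rfl
  refine Runs.cons (runs_compareHash hI (F₃.ctx hC (by decide)) (K₃.hasHash hh) hk₃)
    (by norm_num [Ex.cost]; omega) ?_
  rintro v₄ ⟨f₄, hm₄, hcmp⟩
  refine Runs.nil ⟨(F₃.trans f₄).mono (by decide), ?_, ?_, ?_, ?_, hcmp⟩
  · rw [f₄ 13 (by decide), f₃ 13 (by decide), f₂ 13 (by decide)]
    simp [hv₁, State.set_reg]
  · rw [f₄ 14 (by decide), f₃ 14 (by decide), r14]
  · intro t ht
    rw [hm₄, hm₃ _ (by omega), hstr t ht]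
  · intro a ha hb
    rw [hm₄, K₃ a ha hb]

/-- Halving shortens the binary representation, so `Nat.size` of the interval length bounds the
number of rounds of the binary search. -/
theorem size_lt_size {m k : ℕ} (hk : 0 < k) (h : m ≤ k / 2) : m.size < k.size := by
  have h₁ : 0 < k.size := Nat.size_pos.2 hk
  have h₂ := Nat.lt_size_self k
  have h₃ : 2 ^ k.size = 2 * 2 ^ (k.size - 1) := by
    rw [← pow_succ', Nat.sub_add_cancel h₁]
  have : m.size ≤ k.size - 1 := Nat.size_le.2 (by omega)
  omega

/-- The stored permutations sort the database strings by their hashes. -/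
def Inst.Sorted (I : Inst) : Prop :=
  ∀ j < I.R, ∀ m m', m ≤ m' → m' < I.n →
    I.lexKey j (I.S (I.perm j m)) ≤ I.lexKey j (I.S (I.perm j m'))

/-- Invariant: keys before register `9` are smaller than that of the query, keys from register `10`
on are not. Sortedness extends the comparison at the midpoint to everything on one side of it. -/
theorem runs_binarySearch {I : Inst} {E : Env} (hI : I.Holds E) (hS : I.Sorted) {v : State}
    (hC : I.Ctx v) {j : ℕ} (hj : v.reg 2 = j) (hjR : j < I.R) (hh : I.HasHash v j) :
    Runs E binarySearch v (500 * (I.d + I.ℓ + 3) * (I.n.size + 1)) (fun v' =>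
      Keeps [3, 4, 5, 6, 7, 8, 9, 10, 11, 12, 13, 14] v v' ∧ KeepsMem I v v' ∧
      v'.reg 9 ≤ I.n ∧ (∀ m < v'.reg 9, I.lexKey j (I.S (I.perm j m)) < I.lexKey j I.q) ∧
      ∀ m, v'.reg 9 ≤ m → m < I.n → I.lexKey j I.q ≤ I.lexKey j (I.S (I.perm j m))) := by
  have hs := hI.scratch
  have hw := hI.address_lt
  have hE := hI.fits
  have hnR : I.n ≤ I.R * I.n := Nat.le_mul_of_pos_left _ (by omega)
  have hlit : ∀ c < 50, ∀ v', (Ex.lit c).Ok E v' := fun c hc v' => by simp only [Ex.Ok]; omega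
  have hnn : I.n ≤ I.n * (I.d + 3) := Nat.le_mul_of_pos_right _ (by omega)
  have hw₂ : 2 * I.n + 100 < 2 ^ E.wordSize := by
    simp only [Inst.permBase, Inst.seedBase] at hw
    omega
  have hT : 500 * (I.d + I.ℓ + 3) * (I.n.size + 1) =
      500 * (I.d + I.ℓ + 3) * I.n.size + 500 * (I.d + I.ℓ + 3) := by ring
  have hT' : (400 * (I.d + I.ℓ + 3) + 50 + 1) * I.n.size ≤
      500 * (I.d + I.ℓ + 3) * I.n.size := Nat.mul_le_mul_right _ (by omega)
  unfold binarySearch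
  refine Runs.cons_asg hE (by decide) (hlit _ (by decide) _) (by norm_num [Ex.cost]; omega) ?_
  refine Runs.cons_asg hE (by decide) (Ex.var_ok (by decide)) (by norm_num [Ex.cost]; omega) ?_
  simp only [Ex.eval, State.set_reg, Nat.reduceEqDiff, if_false, hC.r20]
  refine Runs.cons (Runs.loop_of_le (c := 400 * (I.d + I.ℓ + 3) + 50)
    (T := (400 * (I.d + I.ℓ + 3) + 50 + 1) * I.n.size + 1) (by simp [Test.Ok])
    (fun v' => Keeps [3, 4, 5, 6, 7, 8, 9, 10, 11, 12, 13, 14] v v' ∧ KeepsMem I v v' ∧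
      v'.reg 10 ≤ I.n ∧ v'.reg 9 ≤ v'.reg 10 ∧
      (∀ m < v'.reg 9, I.lexKey j (I.S (I.perm j m)) < I.lexKey j I.q) ∧
      ∀ m, v'.reg 10 ≤ m → m < I.n → I.lexKey j I.q ≤ I.lexKey j (I.S (I.perm j m)))
    (fun v' => (v'.reg 10 - v'.reg 9).size) ?_ ?_ ?_) ?_ ?_
  · rintro v' ⟨hf, hm, hn, hle, hlo, hhi⟩ hb
    simp only [Test.holds] at hb
    obtain ⟨lo, hlo'⟩ : ∃ k, v'.reg 9 = k := ⟨_, rfl⟩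
    obtain ⟨hi, hhi'⟩ : ∃ k, v'.reg 10 = k := ⟨_, rfl⟩
    rw [hlo'] at hlo hb hle
    rw [hhi'] at hhi hb hle hn
    refine Runs.cons_asg hE (by decide) ⟨⟨Ex.var_ok (by decide), Ex.var_ok (by decide), ?_⟩,
      hlit _ (by decide) _⟩ (by simp only [Ex.cost]; omega) ?_
    · simp only [Ex.eval, hlo', hhi']; omega
    simp only [Ex.eval, hlo', hhi']
    set v₁ := v'.set 11 ((lo + hi) / 2) with hv₁
    have f₁ : Keeps [3, 4, 5, 6, 7, 8, 9, 10, 11, 12, 13, 14] v v₁ := hf.set (by decide) _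
    have K₁ : KeepsMem I v v₁ := hm
    refine Runs.cons (runs_compareAt hI (f₁.ctx hC (by decide)) (by rw [f₁ 2 (by decide), hj]) hjR
      (m := (lo + hi) / 2) (by simp [hv₁, State.set_reg]) (by omega) (K₁.hasHash hh))
      (by simp only [Ex.cost]; omega) ?_
    rintro v₂ ⟨f₂, _, _, _, K₂, hcmp⟩
    have F₂ : Keeps [3, 4, 5, 6, 7, 8, 9, 10, 11, 12, 13, 14] v v₂ :=
      (f₁.trans f₂).mono (by decide)
    have C₂ := F₂.ctx hC (by decide)
    have q9 : v₂.reg 9 = lo := by rw [f₂ 9 (by decide)]; simp [hv₁, State.set_reg, hlo']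
    have q10 : v₂.reg 10 = hi := by rw [f₂ 10 (by decide)]; simp [hv₁, State.set_reg, hhi']
    have q11 : v₂.reg 11 = (lo + hi) / 2 := by
      rw [f₂ 11 (by decide)]; simp [hv₁, State.set_reg]
    refine Runs.cons (T₀ := 20) ?_ (by simp only [Ex.cost]; omega) fun v' h => Runs.nil h
    refine Runs.ite (by simp [Test.Ok]) (fun h => ?_) (fun h => ?_) (by decide)
    · simp only [Test.holds, C₂.r41] at h
      refine Runs.asg hE (by decide) ⟨Ex.var_ok (by decide), hlit _ (by decide) _, ?_⟩ (by decide) ?_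
      · simp only [Ex.eval, q11]; omega
      have hlt : I.lexKey j (I.S (I.perm j ((lo + hi) / 2))) < I.lexKey j I.q := by
        rcases hcmp with h' | h' | h'
        · exact h'.2
        · omega
        · omega
      refine ⟨⟨F₂.set (by decide) _, K₁.trans K₂, ?_, ?_, ?_, ?_⟩, ?_⟩
      · simpa [State.set_reg, q10] using hn
      · simp [State.set_reg, q10, Ex.eval, q11]; omega
      · intro m hm
        simp only [State.set_reg, if_true, Ex.eval, q11] at hm
        exact (hS j hjR m _ (by omega) (by omega)).trans_lt hlt
      · simpa [State.set_reg, q10] using hhi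
      · simp only [State.set_reg, Nat.reduceEqDiff, if_true, if_false, Ex.eval, q10, q11]
        exact size_lt_size (by omega) (by omega)
    · simp only [Test.holds, C₂.r41] at h
      refine Runs.asg hE (by decide) (Ex.var_ok (by decide)) (by decide) ?_
      have hlt : I.lexKey j I.q ≤ I.lexKey j (I.S (I.perm j ((lo + hi) / 2))) := by
        rcases hcmp with h' | h' | h'
        · omega
        · exact h'.2.ge
        · exact h'.2.le
      refine ⟨⟨F₂.set (by decide) _, K₁.trans K₂, ?_, ?_, ?_, ?_⟩, ?_⟩
      · simp [State.set_reg, Ex.eval, q11]; omega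
      · simp [State.set_reg, q9, Ex.eval, q11]; omega
      · simpa [State.set_reg, q9] using hlo
      · intro m hm hmn
        simp only [State.set_reg, if_true, Ex.eval, q11] at hm
        exact hlt.trans (hS j hjR _ m hm hmn)
      · simp only [State.set_reg, Nat.reduceEqDiff, if_true, if_false, Ex.eval, q9, q11]
        exact size_lt_size (by omega) (by omega)
  · refine ⟨((Keeps.refl _ v).set (by decide) _).set (by decide) _, fun a _ _ => rfl, ?_, ?_, ?_,
      ?_⟩
    · simp [State.set_reg]
    · simp [State.set_reg]
    · simp [State.set_reg]
    · simp [State.set_reg]; omega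
  · simp [State.set_reg]
  · simp only [Ex.cost]; omega
  · rintro v' ⟨⟨hf, hm, hn, hle, hlo, hhi⟩, hb⟩
    simp only [Test.holds] at hb
    have e : v'.reg 10 = v'.reg 9 := by omega
    rw [e] at hn hhi
    exact Runs.nil ⟨hf, hm, hn, hlo, hhi⟩

end WordRAM

namespace WordRAM

open Inst

/-! ### The dynamic program for the edit distance -/

/-- Edit distance of the first `i` characters of `f` and the first `j` characters of `g`, cut off
above `K`. -/
def cutLev (K : ℕ) (f g : ℕ → ℕ) (i j : ℕ) : ℕ :=
  min (lev ((List.range i).map f).reverse ((List.range j).map g).reverse) (K + 1)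

theorem cutLev_zero_left (K : ℕ) (f g : ℕ → ℕ) (j : ℕ) : cutLev K f g 0 j = min j (K + 1) := by
  simp [cutLev, lev_nil_left]

/-- The recursion only adds and takes minima, so cutting off its inputs at `K + 1` does not change
its output cut off at `K + 1`. -/
theorem cutLev_succ_succ (K : ℕ) (f g : ℕ → ℕ) (i j : ℕ) : cutLev K f g (i + 1) (j + 1) =
    min (min (min (cutLev K f g i j + if f i = g j then 0 else 1) (cutLev K f g i (j + 1) + 1))
      (cutLev K f g (i + 1) j + 1)) (K + 1) := by
  have h := lev_cons_cons (f i) (g j) ((List.range i).map f).reverse ((List.range j).map g).reverse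
  simp only [cutLev, List.range_succ, List.map_append, List.map_cons, List.map_nil,
    List.reverse_append, List.reverse_cons, List.reverse_nil, List.nil_append, List.cons_append] at h ⊢
  rw [h]
  split_ifs <;> omega

/-- The distance is at least the difference of the lengths. Hence only a band of diagonals has to be
computed, which makes the test cost `O(d (K + 1))` instead of `O(d²)`. -/
theorem cutLev_of_le_right {K : ℕ} (f g : ℕ → ℕ) {i j : ℕ} (h : i + K + 1 ≤ j) :
    cutLev K f g i j = K + 1 := by
  have := length_sub_le_lev ((List.range j).map g).reverse ((List.range i).map f).reverse
  rw [lev_comm] at this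
  simp only [List.length_reverse, List.length_map, List.length_range] at this
  rw [cutLev]
  omega

theorem cutLev_of_le_left {K : ℕ} (f g : ℕ → ℕ) {i j : ℕ} (h : j + K + 1 ≤ i) :
    cutLev K f g i j = K + 1 := by
  have := length_sub_le_lev ((List.range i).map f).reverse ((List.range j).map g).reverse
  simp only [List.length_reverse, List.length_map, List.length_range] at this
  rw [cutLev]
  omega

theorem cutLev_succ_sub (K : ℕ) (f g : ℕ → ℕ) (i : ℕ) :
    cutLev K f g (i + 1) (i - K) = min (i + 1) (K + 1) := by
  rcases le_or_gt i K with h | h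
  · rw [Nat.sub_eq_zero_of_le h]
    simp [cutLev, lev_nil_right]
  · rw [cutLev_of_le_left f g (by omega)]
    omega

theorem cutLev_length {K : ℕ} {f g : ℕ → ℕ} {x y : List ℕ} (hf : ∀ t < x.length, f t = x.getD t 0)
    (hg : ∀ t < y.length, g t = y.getD t 0) :
    cutLev K f g x.length y.length = min (lev x y) (K + 1) := by
  have aux : ∀ {f : ℕ → ℕ} {x : List ℕ}, (∀ t < x.length, f t = x.getD t 0) →
      (List.range x.length).map f = x := by
    intro f x h
    refine List.ext_getElem (by simp) fun t h₁ h₂ => ?_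
    simp [h t h₂, h₂]
  rw [cutLev, aux hf, aux hg, lev_reverse]

theorem Runs.cons_bump {E : Env} (hE : E.Fits) {v : State} {T : ℕ} {Q : State → Prop}
    {l : List Prog} {x y z : ℕ} (hx : x < 50) (hy : y < 50) (hz : z < 50)
    (hz' : v.reg z + 1 < 2 ^ E.wordSize) (hw : 1 < 2 ^ E.wordSize) (hT : 10 ≤ T)
    (h : Runs E (seqs l) (v.set z (v.reg z + if v.reg x = v.reg y then 0 else 1)) (T - 10) Q) :
    Runs E (seqs (.ite (.eq x y) .skip (WordRAM.asg z (.add (.var z) (.lit 1))) :: l)) v T Q := by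
  refine Runs.cons (T₀ := 10)
    (Q₀ := fun v' => v' = v.set z (v.reg z + if v.reg x = v.reg y then 0 else 1)) ?_ hT
    (fun _ hv => hv ▸ h)
  refine Runs.ite ⟨hx, hy⟩ (fun hb => ?_) (fun hb => ?_) (by omega)
  · simp only [Test.holds] at hb
    refine Runs.skip ?_
    rw [if_pos hb, add_zero, State.set_self]
  · simp only [Test.holds] at hb
    refine Runs.asg hE hz ⟨Ex.var_ok hz, hw, hz'⟩ (by simp [Ex.cost]) ?_
    simp only [if_neg hb, Ex.eval]

/-- The row of the dynamic program in the working memory. -/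
def Inst.HasRow (I : Inst) (v : State) (r : ℕ → ℕ) : Prop :=
  ∀ t < 2 * I.d + 3, v.mem (3 * I.d + 5 + 2 * I.ℓ + t) = r t

/-- The working memory below the row of the dynamic program is unchanged. -/
def KeepsBelow (I : Inst) (v v' : State) : Prop :=
  ∀ a < 3 * I.d + 5 + 2 * I.ℓ, v'.mem a = v.mem a

theorem runs_editInit {I : Inst} {E : Env} (hI : I.Holds E) {v : State} (hC : I.Ctx v) :
    Runs E editInit v (100 * (I.d + 2)) (fun v' => Keeps [3, 19] v v' ∧ KeepsBelow I v v' ∧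
      I.HasRow v' (fun t => min t (I.K + 1))) := by
  have hs := hI.scratch
  have hw := hI.address_lt
  have hE := hI.fits
  simp only [Inst.scratch] at hs hw
  have hlit : ∀ c < 50, ∀ v', (Ex.lit c).Ok E v' := fun c hc v' => by simp only [Ex.Ok]; omega
  unfold editInit
  refine Runs.cons_asg hE (by decide) (hlit _ (by decide) _) (by norm_num [Ex.cost]; omega) ?_
  refine Runs.cons (Runs.loop_of_le (c := 30) (T := 31 * (2 * I.d + 3) + 1) (by simp [Test.Ok])
    (fun v' => Keeps [3, 19] v v' ∧ KeepsBelow I v v' ∧ v'.reg 3 ≤ 2 * I.d + 3 ∧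
      ∀ t < v'.reg 3, v'.mem (3 * I.d + 5 + 2 * I.ℓ + t) = min t (I.K + 1))
    (fun v' => 2 * I.d + 3 - v'.reg 3) ?_ ?_ ?_) ?_ ?_
  · rintro v' ⟨hf, hb, hle, hm⟩ ht
    have hC' := hf.ctx hC (by decide)
    simp only [Test.holds, hC'.r39] at ht
    refine Runs.cons_asg hE (by decide) (Ex.var_ok (by decide)) (by decide) ?_
    refine Runs.cons_setMin hE (by decide) (by decide) (by decide) ?_
    simp only [Ex.eval, State.set_reg, Nat.reduceEqDiff, if_true, if_false, hC'.r40, State.set_set]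
    refine Runs.cons_sto hE ⟨Ex.var_ok (by decide), Ex.var_ok (by decide), ?_⟩
      (Ex.var_ok (by decide)) ?_ (by decide) ?_
    · simp only [Ex.eval, State.set_reg, Nat.reduceEqDiff, if_false, hC'.r35]; omega
    · simp only [Ex.eval, State.set_reg, Nat.reduceEqDiff, if_false, hC'.r35]; omega
    simp only [Ex.eval, State.set_reg, Nat.reduceEqDiff, if_true, if_false, hC'.r35]
    refine Runs.cons_asg hE (by decide) ⟨Ex.var_ok (by decide), hlit _ (by decide) _, ?_⟩
      (by decide) ?_
    · simp only [Ex.eval, State.set_reg, State.put_reg, Nat.reduceEqDiff, if_false]; omega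
    simp only [Ex.eval, State.set_reg, State.put_reg, Nat.reduceEqDiff, if_false]
    refine Runs.nil ⟨⟨((hf.set (by decide) _).put _ _).set (by decide) _, ?_, ?_, ?_⟩, ?_⟩
    · intro a ha
      simp only [State.set_mem, State.put_mem]
      rw [if_neg (by omega), hb a ha]
    · simp only [State.set_reg, if_true]; omega
    · intro t ht'
      simp only [State.set_reg, if_true] at ht'
      simp only [State.set_mem, State.put_mem]
      split_ifs with h
      · rw [show t = v'.reg 3 by omega]
      · exact hm t (by omega)
    · simp only [State.set_reg, if_true]; omega
  · refine ⟨(Keeps.refl _ v).set (by decide) _, fun _ _ => rfl, ?_, ?_⟩ <;>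
      simp [State.set_reg, Ex.eval]
  · simp [State.set_reg, Ex.eval]
  · norm_num [Ex.cost]; omega
  · rintro v' ⟨⟨hf, hb, hle, hm⟩, ht⟩
    have hC' := hf.ctx hC (by decide)
    simp only [Test.holds, hC'.r39] at ht
    exact Runs.nil ⟨hf, hb, fun t h => hm t (by omega)⟩

theorem runs_editCell {I : Inst} {E : Env} (hI : I.Holds E) {v : State} (hC : I.Ctx v)
    {i j dg lf up a b : ℕ} (h15 : v.reg 15 = i) (h16 : v.reg 16 = j) (h17 : v.reg 17 = dg)
    (h18 : v.reg 18 = lf) (hdg : dg ≤ I.K + 1) (hlf : lf ≤ I.K + 1) (hup : up ≤ I.K + 1)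
    (hj : j < 2 * I.d)
    (ha : v.mem i = a) (hb : v.mem (I.d + 2 + j) = b)
    (hu : v.mem (3 * I.d + 5 + 2 * I.ℓ + (j + 1)) = up) :
    Runs E editCell v 150 (fun v' => Keeps [5, 6, 8, 16, 17, 18, 19] v v' ∧ v'.reg 16 = j + 1 ∧
      v'.reg 17 = up ∧
      v'.reg 18 = min (min (min (dg + if a = b then 0 else 1) (up + 1)) (lf + 1)) (I.K + 1) ∧
      ∀ t, v'.mem t = if t = 3 * I.d + 5 + 2 * I.ℓ + (j + 1) then v'.reg 18 else v.mem t) := by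
  have hs := hI.scratch
  have hw := hI.address_lt
  have hE := hI.fits
  have hK := hI.K_le
  simp only [Inst.scratch] at hs hw
  have hlit : ∀ c < 50, ∀ v', (Ex.lit c).Ok E v' := fun c hc v' => by simp only [Ex.Ok]; omega
  unfold editCell
  refine Runs.cons_asg hE (by decide) ⟨Ex.var_ok (by decide), ⟨Ex.var_ok (by decide),
    hlit _ (by decide) _, ?_⟩, ?_⟩ (by decide) ?_
  · simp only [Ex.eval]; omega
  · simp only [Ex.eval, hC.r35]; omega
  simp only [Ex.eval, hC.r35, h16, hu]
  refine Runs.cons_asg hE (by decide) (Ex.load_var_ok (by decide)) (by decide) ?_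
  simp only [Ex.eval, State.set_reg, State.set_mem, Nat.reduceEqDiff, if_false, h15, ha]
  refine Runs.cons_asg hE (by decide) ⟨Ex.var_ok (by decide), Ex.var_ok (by decide), ?_⟩
    (by decide) ?_
  · simp only [Ex.eval, State.set_reg, Nat.reduceEqDiff, if_false, hC.r32, h16]; omega
  simp only [Ex.eval, State.set_reg, State.set_mem, Nat.reduceEqDiff, if_false, hC.r32, h16, hb]
  refine Runs.cons_asg hE (by decide) (Ex.var_ok (by decide)) (by decide) ?_
  simp only [Ex.eval, State.set_reg, Nat.reduceEqDiff, if_false, h17]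
  refine Runs.cons_bump hE (by decide) (by decide) (by decide) ?_ (by omega) (by decide) ?_
  · simp only [State.set_reg, if_true]; omega
  simp only [State.set_reg, Nat.reduceEqDiff, if_true, if_false, State.set_set]
  refine Runs.cons_asg hE (by decide) (Ex.var_ok (by decide)) (by decide) ?_
  simp only [Ex.eval, State.set_reg, Nat.reduceEqDiff, if_true, if_false]
  refine Runs.cons_asg hE (by decide) ⟨Ex.var_ok (by decide), hlit _ (by decide) _, ?_⟩
    (by decide) ?_
  · simp only [Ex.eval, State.set_reg, Nat.reduceEqDiff, if_true, if_false]; omega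
  simp only [Ex.eval, State.set_reg, Nat.reduceEqDiff, if_true, if_false]
  refine Runs.cons_setMin hE (by decide) (by decide) (by decide) ?_
  simp only [State.set_reg, Nat.reduceEqDiff, if_true, if_false]
  refine Runs.cons_asg hE (by decide) ⟨Ex.var_ok (by decide), hlit _ (by decide) _, ?_⟩
    (by decide) ?_
  · simp only [Ex.eval, State.set_reg, Nat.reduceEqDiff, if_false, h18]; omega
  simp only [Ex.eval, State.set_reg, Nat.reduceEqDiff, if_false, h18]
  refine Runs.cons_setMin hE (by decide) (by decide) (by decide) ?_
  simp only [State.set_reg, Nat.reduceEqDiff, if_true, if_false]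
  refine Runs.cons_setMin hE (by decide) (by decide) (by decide) ?_
  simp only [State.set_reg, Nat.reduceEqDiff, if_true, if_false, State.set_set, hC.r40]
  refine Runs.cons_asg hE (by decide) (Ex.var_ok (by decide)) (by decide) ?_
  simp only [Ex.eval, State.set_reg, if_true]
  refine Runs.cons_sto hE ⟨Ex.var_ok (by decide), ⟨Ex.var_ok (by decide),
    hlit _ (by decide) _, ?_⟩, ?_⟩ (Ex.var_ok (by decide)) ?_ (by decide) ?_
  · simp only [Ex.eval, State.set_reg, Nat.reduceEqDiff, if_false, h16]; omega
  · simp only [Ex.eval, State.set_reg, Nat.reduceEqDiff, if_false, h16, hC.r35]; omega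
  · simp only [Ex.eval, State.set_reg, Nat.reduceEqDiff, if_false, h16, hC.r35]; omega
  simp only [Ex.eval, State.set_reg, Nat.reduceEqDiff, if_true, if_false, h16, hC.r35]
  refine Runs.cons_asg hE (by decide) ⟨Ex.var_ok (by decide), hlit _ (by decide) _, ?_⟩
    (by decide) ?_
  · simp only [Ex.eval, State.set_reg, State.put_reg, Nat.reduceEqDiff, if_false, h16]; omega
  simp only [Ex.eval, State.set_reg, State.put_reg, Nat.reduceEqDiff, if_false, h16]
  refine Runs.nil ⟨?_, ?_, ?_, ?_, ?_⟩
  · intro t ht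
    simp only [List.mem_cons, List.not_mem_nil, or_false, not_or] at ht
    simp only [State.set_reg, State.put_reg, ht, if_false]
  · simp only [State.set_reg, if_true]
  · simp only [State.set_reg, State.put_reg, Nat.reduceEqDiff, if_true, if_false]
  · simp only [State.set_reg, State.put_reg, Nat.reduceEqDiff, if_true, if_false]
  · intro t
    simp only [State.set_reg, State.set_mem, State.put_reg, State.put_mem, Nat.reduceEqDiff,
      if_true, if_false]

/-- During the sweep the row holds new values up to the current column and old ones after it. Cells
outside the band need no update: there both the old and the new value are `K + 1`. -/
theorem runs_editRow {I : Inst} {E : Env} (hI : I.Holds E) {v : State} (hC : I.Ctx v)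
    {f g : ℕ → ℕ} {i : ℕ} (h15 : v.reg 15 = i) (hi : i < I.d)
    (hf : ∀ t < I.d, v.mem t = f t) (hg : ∀ t < 2 * I.d, v.mem (I.d + 2 + t) = g t)
    (hrow : I.HasRow v (cutLev I.K f g i)) :
    Runs E editRow v (500 * (I.K + 1)) (fun v' => Keeps [5, 6, 7, 8, 15, 16, 17, 18, 19] v v' ∧
      KeepsBelow I v v' ∧ v'.reg 15 = i + 1 ∧ I.HasRow v' (cutLev I.K f g (i + 1))) := by
  have hs := hI.scratch
  have hw := hI.address_lt
  have hE := hI.fits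
  have hK := hI.K_le
  simp only [Inst.scratch] at hs hw
  have hlit : ∀ c < 50, ∀ v', (Ex.lit c).Ok E v' := fun c hc v' => by simp only [Ex.Ok]; omega
  have hcut : ∀ i j, cutLev I.K f g i j ≤ I.K + 1 := fun i j => min_le_right _ _
  unfold editRow
  refine Runs.cons_asg hE (by decide) ⟨Ex.var_ok (by decide), Ex.var_ok (by decide)⟩
    (by norm_num [Ex.cost]; omega) ?_
  simp only [Ex.eval, h15, hC.r26]
  refine Runs.cons_asg hE (by decide) ⟨Ex.var_ok (by decide), Ex.var_ok (by decide), ?_⟩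
    (by norm_num [Ex.cost]; omega) ?_
  · simp only [Ex.eval, State.set_reg, Nat.reduceEqDiff, if_true, if_false, hC.r35]; omega
  simp only [Ex.eval, State.set_reg, State.set_mem, Nat.reduceEqDiff, if_true, if_false, hC.r35,
    hrow (i - I.K) (by omega)]
  refine Runs.cons_asg hE (by decide) ⟨Ex.var_ok (by decide), hlit _ (by decide) _, ?_⟩
    (by norm_num [Ex.cost]; omega) ?_
  · simp only [Ex.eval, State.set_reg, Nat.reduceEqDiff, if_false, h15]; omega
  simp only [Ex.eval, State.set_reg, Nat.reduceEqDiff, if_false, h15]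
  refine Runs.cons_setMin hE (by decide) (by decide) (by norm_num [Ex.cost]; omega) ?_
  simp only [State.set_reg, Nat.reduceEqDiff, if_true, if_false, State.set_set, hC.r40]
  refine Runs.cons_sto hE ⟨Ex.var_ok (by decide), Ex.var_ok (by decide), ?_⟩
    (Ex.var_ok (by decide)) ?_ (by norm_num [Ex.cost]; omega) ?_
  · simp only [Ex.eval, State.set_reg, Nat.reduceEqDiff, if_true, if_false, hC.r35]; omega
  · simp only [Ex.eval, State.set_reg, Nat.reduceEqDiff, if_true, if_false, hC.r35]; omega
  simp only [Ex.eval, State.set_reg, Nat.reduceEqDiff, if_true, if_false, hC.r35]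
  refine Runs.cons_asg hE (by decide) ⟨Ex.var_ok (by decide), Ex.var_ok (by decide), ?_⟩
    (by norm_num [Ex.cost]; omega) ?_
  · simp only [Ex.eval, State.set_reg, State.put_reg, Nat.reduceEqDiff, if_false, h15, hC.r40]
    omega
  simp only [Ex.eval, State.set_reg, State.put_reg, Nat.reduceEqDiff, if_false, h15, hC.r40]
  refine Runs.cons (Runs.loop_of_le (c := 150) (T := 151 * (2 * I.K + 1) + 1) (by simp [Test.Ok])
    (fun v' => Keeps [5, 6, 7, 8, 16, 17, 18, 19] v v' ∧ KeepsBelow I v v' ∧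
      v'.reg 7 = i + (I.K + 1) ∧ i - I.K ≤ v'.reg 16 ∧ v'.reg 16 ≤ i + (I.K + 1) ∧
      v'.reg 17 = cutLev I.K f g i (v'.reg 16) ∧ v'.reg 18 = cutLev I.K f g (i + 1) (v'.reg 16) ∧
      I.HasRow v' (fun t => if t ≤ v'.reg 16 then cutLev I.K f g (i + 1) t
        else cutLev I.K f g i t))
    (fun v' => i + (I.K + 1) - v'.reg 16) ?_ ?_ ?_) ?_ ?_
  · rintro v' ⟨hF, hb, r7, hlo, hhi, r17, r18, hr⟩ ht
    have hC' := hF.ctx hC (by decide)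
    simp only [Test.holds, r7] at ht
    obtain ⟨j, hj⟩ : ∃ j, v'.reg 16 = j := ⟨_, rfl⟩
    rw [hj] at hlo hhi r17 r18 ht hr
    have hu := hr (j + 1) (by omega)
    simp only [if_neg (show ¬ j + 1 ≤ j by omega)] at hu
    have hfi : v'.mem i = f i := by rw [hb i (by omega), hf i hi]
    have hgj : v'.mem (I.d + 2 + j) = g j := by rw [hb _ (by omega), hg j (by omega)]
    refine (runs_editCell hI hC' (by rw [hF 15 (by decide), h15]) hj r17 r18 (hcut _ _) (hcut _ _)
      (hcut _ _) (by omega) hfi hgj hu).mono le_rfl ?_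
    rintro v₂ ⟨hF₂, s16, s17, s18, sm⟩
    rw [← cutLev_succ_succ] at s18
    refine ⟨⟨(hF.trans hF₂).mono (by decide), ?_, ?_, ?_, ?_, ?_, ?_, ?_⟩, ?_⟩
    · intro a ha
      rw [sm, if_neg (by omega), hb a ha]
    · rw [hF₂ 7 (by decide), r7]
    · omega
    · omega
    · rw [s17, s16]
    · rw [s18, s16]
    · intro t ht
      rw [sm, s18, s16]
      have hrt := hr t ht
      beta_reduce at hrt ⊢
      split_ifs with h₁ h₂ h₂
      · rw [show t = j + 1 by omega]
      · omega
      · rw [hrt, if_pos (by omega)]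
      · rw [hrt, if_neg (by omega)]
    · omega
  · refine ⟨?_, ?_, ?_, ?_, ?_, ?_, ?_, ?_⟩
    · intro t ht
      simp only [List.mem_cons, List.not_mem_nil, or_false, not_or] at ht
      simp only [State.set_reg, State.put_reg, ht, if_false]
    · intro a ha
      simp only [State.set_mem, State.put_mem]
      rw [if_neg (by omega)]
    · simp only [State.set_reg, if_true]
    · simp only [State.set_reg, State.put_reg, Nat.reduceEqDiff, if_true, if_false, le_refl]
    · simp only [State.set_reg, State.put_reg, Nat.reduceEqDiff, if_true, if_false]; omega
    · simp only [State.set_reg, State.put_reg, Nat.reduceEqDiff, if_true, if_false]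
    · simp only [State.set_reg, State.put_reg, Nat.reduceEqDiff, if_true, if_false, cutLev_succ_sub]
    · intro t ht
      simp only [State.set_reg, State.set_mem, State.put_reg, State.put_mem, Nat.reduceEqDiff,
        if_true, if_false]
      split_ifs with h₁ h₂ h₂
      · rw [show t = i - I.K by omega, cutLev_succ_sub]
      · omega
      · rw [hrow t ht, cutLev_of_le_left f g (by omega), cutLev_of_le_left f g (by omega)]
      · exact hrow t ht
  · simp only [State.set_reg, State.put_reg, Nat.reduceEqDiff, if_true, if_false]
    have : i + (I.K + 1) - (i - I.K) ≤ 2 * I.K + 1 := by omega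
    omega
  · norm_num [Ex.cost]; omega
  · rintro v' ⟨⟨hF, hb, r7, hlo, hhi, r17, r18, hr⟩, ht⟩
    simp only [Test.holds, r7] at ht
    have r16 : v'.reg 16 = i + (I.K + 1) := by omega
    have s15 : v'.reg 15 = i := by rw [hF 15 (by decide), h15]
    refine Runs.cons_asg hE (by decide) ⟨Ex.var_ok (by decide), hlit _ (by decide) _, ?_⟩
      (by norm_num [Ex.cost]; omega) ?_
    · simp only [Ex.eval, s15]; omega
    refine Runs.nil ⟨(hF.mono (by decide)).set (by decide) _, hb, ?_, ?_⟩
    · simp only [State.set_reg, if_true, Ex.eval, s15]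
    · intro t ht'
      have h := hr t ht'
      simp only [State.set_mem]
      rw [h, r16]
      beta_reduce
      split_ifs with h'
      · rfl
      · rw [cutLev_of_le_right f g (by omega), cutLev_of_le_right f g (by omega)]

theorem runs_editDistance {I : Inst} {E : Env} (hI : I.Holds E) {v : State} (hC : I.Ctx v)
    {y : List ℕ} (h1 : v.reg 1 = I.q.length) (h14 : v.reg 14 = y.length) (hy : y.length ≤ I.d)
    (hq : v.HasString I 0 I.q) (hyv : v.HasString I (I.d + 2) y) :
    Runs E editDistance v (700 * (I.d + 2) * (I.K + 1))
      (fun v' => Keeps [3, 5, 6, 7, 8, 12, 15, 16, 17, 18, 19] v v' ∧ KeepsBelow I v v' ∧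
        v'.reg 12 = min (lev I.q y) (I.K + 1)) := by
  have hs := hI.scratch
  have hw := hI.address_lt
  have hE := hI.fits
  have hK := hI.K_le
  have hlen := hI.length_q
  simp only [Inst.scratch] at hs hw
  have hlit : ∀ c < 50, ∀ v', (Ex.lit c).Ok E v' := fun c hc v' => by simp only [Ex.Ok]; omega
  -- The band may read cells beyond the end of either string. Taking `f` and `g` to be the memory
  -- itself makes the invariant hold whatever lies there; that the prefixes are the two strings
  -- matters only for the one entry read at the end.
  set f : ℕ → ℕ := fun t => v.mem t with hf
  set g : ℕ → ℕ := fun t => v.mem (I.d + 2 + t) with hg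
  have hT : 700 * (I.d + 2) * (I.K + 1) = 501 * (I.d * (I.K + 1)) + 199 * (I.d * (I.K + 1)) +
      1400 * (I.K + 1) := by ring
  have hT₁ : I.q.length * (I.K + 1) ≤ I.d * (I.K + 1) := Nat.mul_le_mul_right _ hlen
  have hT₂ : (500 * (I.K + 1) + 1) * I.q.length ≤ 501 * (I.q.length * (I.K + 1)) := by
    have : (500 * (I.K + 1) + 1) * I.q.length = 500 * (I.q.length * (I.K + 1)) + I.q.length := by
      ring
    have : I.q.length ≤ I.q.length * (I.K + 1) := Nat.le_mul_of_pos_right _ (by omega)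
    omega
  have hT₃ : I.d ≤ I.d * (I.K + 1) := Nat.le_mul_of_pos_right _ (by omega)
  unfold editDistance
  refine Runs.cons (runs_editInit hI hC) (by omega) ?_
  rintro v₁ ⟨hF₁, hb₁, hr₁⟩
  refine Runs.cons_asg hE (by decide) (hlit _ (by decide) _) (by norm_num [Ex.cost]; omega) ?_
  simp only [Ex.eval]
  refine Runs.cons (Runs.loop_of_le (c := 500 * (I.K + 1))
    (T := (500 * (I.K + 1) + 1) * I.q.length + 1) (by simp [Test.Ok])
    (fun v' => Keeps [3, 5, 6, 7, 8, 12, 15, 16, 17, 18, 19] v v' ∧ KeepsBelow I v v' ∧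
      v'.reg 15 ≤ I.q.length ∧ I.HasRow v' (cutLev I.K f g (v'.reg 15)))
    (fun v' => I.q.length - v'.reg 15) ?_ ?_ ?_) ?_ ?_
  · rintro v' ⟨hF, hb, hle, hr⟩ ht
    have q1 : v'.reg 1 = I.q.length := by rw [hF 1 (by decide), h1]
    simp only [Test.holds, q1] at ht
    refine (runs_editRow hI (hF.ctx hC (by decide)) rfl (by omega)
      (fun t ht => by rw [hb t (by omega)]) (fun t ht => by rw [hb _ (by omega)]) hr).mono le_rfl ?_
    rintro v₂ ⟨hF₂, hb₂, s15, hr₂⟩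
    refine ⟨⟨(hF.trans hF₂).mono (by decide), ?_, by omega, ?_⟩, by omega⟩
    · intro a ha
      rw [hb₂ a ha, hb a ha]
    · rw [s15]; exact hr₂
  · refine ⟨(hF₁.mono (by decide)).set (by decide) _, hb₁, ?_, ?_⟩
    · simp only [State.set_reg, if_true]; omega
    · simp only [State.set_reg, if_true]
      intro t ht
      rw [State.set_mem, hr₁ t ht, cutLev_zero_left]
  · simp only [State.set_reg, if_true, Nat.sub_zero]; omega
  · norm_num [Ex.cost]; omega
  · rintro v' ⟨⟨hF, hb, hle, hr⟩, ht⟩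
    have q1 : v'.reg 1 = I.q.length := by rw [hF 1 (by decide), h1]
    have q14 : v'.reg 14 = y.length := by rw [hF 14 (by decide), h14]
    have C' := hF.ctx hC (by decide)
    simp only [Test.holds, q1] at ht
    have e : v'.reg 15 = I.q.length := by omega
    rw [e] at hr
    refine Runs.cons_asg hE (by decide) ⟨Ex.var_ok (by decide), Ex.var_ok (by decide), ?_⟩
      (by norm_num [Ex.cost]; omega) ?_
    · simp only [Ex.eval, C'.r35, q14]; omega
    simp only [Ex.eval, C'.r35, q14]
    refine Runs.nil ⟨hF.set (by decide) _, hb, ?_⟩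
    simp only [State.set_reg, if_true]
    rw [hr _ (by omega), cutLev_length]
    · intro t ht
      simp only [hf]
      have := hq t (by omega)
      rw [zero_add] at this
      rw [this, Inst.buf, List.getD_append _ _ _ _ ht]
    · intro t ht
      simp only [hg]
      rw [hyv t (by omega), Inst.buf, List.getD_append _ _ _ _ ht]

end WordRAM

/-! ### Search of a bucket and the loop over the hash functions -/

namespace WordRAM

open Inst

/-- The string `y` collides with the query under the `j`-th hash function and is close to it. -/
def Inst.Hit (I : Inst) (j : ℕ) (y : List ℕ) : Prop :=
  I.lexKey j y = I.lexKey j I.q ∧ lev I.q y ≤ I.K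

open Classical in
/-- Indicator of the strings that collide with the query without being close to it. -/
noncomputable def Inst.farInd (I : Inst) (j : ℕ) (y : List ℕ) : ℕ :=
  if I.lexKey j y = I.lexKey j I.q ∧ I.K < lev I.q y then 1 else 0

/-- Number of far strings that collide with the query under the `j`-th hash function. -/
noncomputable def Inst.far (I : Inst) (j : ℕ) : ℕ :=
  ∑ m ∈ Finset.range I.n, I.farInd j (I.S (I.perm j m))

/-- The stored query and its hash are unchanged. -/
def KeepsQuery (I : Inst) (v v' : State) : Prop :=
  ∀ a < 3 * I.d + 5 + I.ℓ, ¬ (I.d + 2 ≤ a ∧ a < 2 * I.d + 4) → v'.mem a = v.mem a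

theorem KeepsQuery.trans {I : Inst} {v v' v'' : State} (h : KeepsQuery I v v')
    (h' : KeepsQuery I v' v'') : KeepsQuery I v v'' := fun a ha hb => by rw [h' a ha hb, h a ha hb]

theorem KeepsMem.keepsQuery {I : Inst} {v v' : State} (h : KeepsMem I v v') : KeepsQuery I v v' :=
  fun a ha hb => h a hb (by omega)

theorem KeepsBelow.keepsQuery {I : Inst} {v v' : State} (h : KeepsBelow I v v') :
    KeepsQuery I v v' :=
  fun a ha _ => h a (by omega)

theorem KeepsQuery.hasHash {I : Inst} {v v' : State} {j : ℕ} (h : KeepsQuery I v v')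
    (hv : I.HasHash v j) : I.HasHash v' j := fun t ht => by
  rw [h _ (by omega) (by omega), hv t ht]

theorem KeepsQuery.hasString {I : Inst} {v v' : State} (h : KeepsQuery I v v') {x : List ℕ}
    (hx : x.length ≤ I.d) (hv : v.HasString I 0 x) : v'.HasString I 0 x := fun t ht => by
  rw [h _ (by omega) (by omega), hv t ht]

/-- Time bound for one string of a bucket. -/
def Inst.candidateTime (I : Inst) : ℕ :=
  400 * (I.d + I.ℓ + 3) + 700 * (I.d + 2) * (I.K + 1) + 60

/-- In the sorted order the strings that collide with the query form an interval starting at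
register `9`. The search stops at the first hit or at the first larger key, so every round except
possibly the last is paid for by a far colliding string. -/
theorem runs_searchBucket {I : Inst} {E : Env} (hI : I.Holds E) (hS : I.Sorted) {v : State}
    (hC : I.Ctx v) {j : ℕ} (hj : v.reg 2 = j) (hjR : j < I.R) (hh : I.HasHash v j)
    (h0 : v.reg 0 = 0) (h1 : v.reg 1 = I.q.length) (hq : v.HasString I 0 I.q)
    (h9 : v.reg 9 ≤ I.n)
    (hlo : ∀ m < v.reg 9, I.lexKey j (I.S (I.perm j m)) < I.lexKey j I.q)
    (hhi : ∀ m, v.reg 9 ≤ m → m < I.n → I.lexKey j I.q ≤ I.lexKey j (I.S (I.perm j m))) :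
    Runs E searchBucket v ((I.far j + 1) * (I.candidateTime + 1) + 10) (fun v' =>
      Keeps [0, 3, 4, 5, 6, 7, 8, 11, 12, 13, 14, 15, 16, 17, 18, 19] v v' ∧ KeepsQuery I v v' ∧
      (v'.reg 0 = 0 ∧ (∀ m < I.n, ¬ I.Hit j (I.S (I.perm j m))) ∨
        ∃ i < I.n, I.Hit j (I.S i) ∧ v'.reg 0 = i + 1)) := by
  have hs := hI.scratch
  have hw := hI.address_lt
  have hE := hI.fits
  have hnR : I.n ≤ I.R * I.n := Nat.le_mul_of_pos_left _ (by omega)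
  have hlit : ∀ c < 50, ∀ v', (Ex.lit c).Ok E v' := fun c hc v' => by simp only [Ex.Ok]; omega
  unfold searchBucket
  refine Runs.cons_asg hE (by decide) (Ex.var_ok (by decide)) (by simp only [Ex.cost]; omega) ?_
  simp only [Ex.eval]
  set W := [0, 3, 4, 5, 6, 7, 8, 11, 12, 13, 14, 15, 16, 17, 18, 19] with hW
  set U := I.candidateTime with hU
  -- Potential: the far colliding strings still ahead, plus one for the final round. Moving the
  -- position to `n` ends the loop and releases all of it.
  let Φ : State → ℕ := fun v' => if v'.reg 11 < I.n then
    (∑ m ∈ Finset.Ico (v'.reg 11) I.n, I.farInd j (I.S (I.perm j m)) + 1) * (U + 1) else 0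
  have hloop := Runs.loop (E := E) (b := .lt 11 20) (P := seqs [compareAt,
      .ite (.eq 12 42) (seqs [editDistance,
        .ite (.lt 12 40) (seqs [asg 0 (.add (.var 13) (.lit 1)), asg 11 (.var 20)])
          (asg 11 (.add (.var 11) (.lit 1)))]) (asg 11 (.var 20))]) (by simp [Test.Ok])
    (fun v' => Keeps W v v' ∧ KeepsQuery I v v' ∧ v.reg 9 ≤ v'.reg 11 ∧ v'.reg 11 ≤ I.n ∧
      (v'.reg 0 = 0 ∧ (∀ m < v'.reg 11, ¬ I.Hit j (I.S (I.perm j m))) ∨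
        v'.reg 11 = I.n ∧ ∃ i < I.n, I.Hit j (I.S i) ∧ v'.reg 0 = i + 1)) Φ ?_
    (v := v.set 11 (v.reg 9)) ?_
  · refine Runs.cons hloop ?_ ?_
    · have hΦ : Φ (v.set 11 (v.reg 9)) ≤ (I.far j + 1) * (U + 1) := by
        simp only [Φ, State.set_reg, if_true]
        split_ifs
        · refine Nat.mul_le_mul_right _ (Nat.add_le_add_right ?_ 1)
          rw [Inst.far, Finset.range_eq_Ico]
          exact Finset.sum_le_sum_of_subset (Finset.Ico_subset_Ico_left (Nat.zero_le _))
        · exact Nat.zero_le _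
      simp only [Ex.cost]
      omega
    · rintro v' ⟨⟨hF, hQ, _, hn, hcase⟩, hb⟩
      have C' := hF.ctx hC (by decide)
      simp only [Test.holds, C'.r20] at hb
      refine Runs.nil ⟨hF, hQ, ?_⟩
      rcases hcase with h | h
      · exact .inl ⟨h.1, fun m hm => h.2 m (by omega)⟩
      · exact .inr h.2
  · rintro v' ⟨hF, hQ, h9', hn, hcase⟩ hb
    have C' := hF.ctx hC (by decide)
    simp only [Test.holds, C'.r20] at hb
    obtain ⟨r0, hmiss⟩ : v'.reg 0 = 0 ∧ ∀ m < v'.reg 11, ¬ I.Hit j (I.S (I.perm j m)) := by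
      rcases hcase with h | h
      · exact h
      · omega
    obtain ⟨m, hm⟩ : ∃ m, v'.reg 11 = m := ⟨_, rfl⟩
    have hΦ : Φ v' = (∑ m ∈ Finset.Ico m I.n, I.farInd j (I.S (I.perm j m)) + 1) * (U + 1) := by
      simp only [Φ, hm]
      rw [if_pos (by omega)]
    rw [hm] at hmiss hb h9'
    have hUΦ : U + 1 ≤ Φ v' := by
      rw [hΦ]
      exact Nat.le_mul_of_pos_left _ (by omega)
    refine ⟨U, ?_⟩
    refine Runs.cons (runs_compareAt hI C' (by rw [hF 2 (by decide), hj]) hjR hm hb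
      (hQ.hasHash hh)) (by simp only [hU, Inst.candidateTime]; omega) ?_
    rintro v₁ ⟨F₁, s13, s14, hstr, K₁, hcmp⟩
    have G₁ : Keeps W v v₁ := (hF.trans F₁).mono (by decide)
    have C₁ := G₁.ctx hC (by decide)
    have Q₁ : KeepsQuery I v v₁ := hQ.trans K₁.keepsQuery
    have s0 : v₁.reg 0 = 0 := by rw [F₁ 0 (by decide), r0]
    have s11 : v₁.reg 11 = m := by rw [F₁ 11 (by decide), hm]
    have hp := hI.perm_lt j hjR m hb
    refine Runs.cons (T₀ := 700 * (I.d + 2) * (I.K + 1) + 50) ?_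
      (by simp only [hU, Inst.candidateTime]; omega) fun v' h => Runs.nil h
    refine Runs.ite (by simp [Test.Ok]) (fun h => ?_) (fun h => ?_) (by omega)
    · simp only [Test.holds, C₁.r42] at h
      have heq : I.lexKey j (I.S (I.perm j m)) = I.lexKey j I.q := by
        rcases hcmp with h' | h' | h'
        · omega
        · exact h'.2
        · omega
      refine Runs.cons (runs_editDistance hI C₁ (by rw [G₁ 1 (by decide), h1]) s14
        (hI.length_S _ hp) (Q₁.hasString hI.length_q hq) hstr) (by omega) ?_
      rintro v₂ ⟨F₂, B₂, t12⟩
      have G₂ : Keeps W v v₂ := (G₁.trans F₂).mono (by decide)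
      have C₂ := G₂.ctx hC (by decide)
      have Q₂ : KeepsQuery I v v₂ := Q₁.trans B₂.keepsQuery
      have t13 : v₂.reg 13 = I.perm j m := by rw [F₂ 13 (by decide), s13]
      have t11 : v₂.reg 11 = m := by rw [F₂ 11 (by decide), s11]
      have t0 : v₂.reg 0 = 0 := by rw [F₂ 0 (by decide), s0]
      refine Runs.cons (T₀ := 40) ?_ (by omega) fun v' h => Runs.nil h
      refine Runs.ite (by simp [Test.Ok]) (fun h' => ?_) (fun h' => ?_) (by omega)
      · simp only [Test.holds, C₂.r40, t12] at h'
        refine Runs.cons_asg hE (by decide) ⟨Ex.var_ok (by decide), hlit _ (by decide) _, ?_⟩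
          (by decide) ?_
        · simp only [Ex.eval, t13]; omega
        simp only [Ex.eval, t13]
        refine Runs.cons_asg hE (by decide) (Ex.var_ok (by decide)) (by decide) ?_
        simp only [Ex.eval, State.set_reg, Nat.reduceEqDiff, if_false, C₂.r20]
        refine Runs.nil ⟨⟨(G₂.set (by decide) _).set (by decide) _, Q₂, ?_, ?_, .inr ⟨?_,
          I.perm j m, hp, ⟨heq, by omega⟩, ?_⟩⟩, ?_⟩
        · simpa [State.set_reg] using h9
        · simp [State.set_reg]
        · simp [State.set_reg]
        · simp [State.set_reg]
        · simp only [Φ, State.set_reg, if_true, lt_irrefl, if_false]; omega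
      · simp only [Test.holds, C₂.r40, t12] at h'
        have hfar : I.farInd j (I.S (I.perm j m)) = 1 := by
          rw [Inst.farInd, if_pos ⟨heq, by omega⟩]
        refine Runs.asg hE (by decide) ⟨Ex.var_ok (by decide), hlit _ (by decide) _, ?_⟩
          (by decide) ?_
        · simp only [Ex.eval, t11]; omega
        simp only [Ex.eval, t11]
        refine ⟨⟨G₂.set (by decide) _, Q₂, ?_, ?_, .inl ⟨?_, ?_⟩⟩, ?_⟩
        · simp only [State.set_reg, if_true]; omega
        · simp only [State.set_reg, if_true]; omega
        · simpa [State.set_reg] using t0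
        · intro m' hm'
          simp only [State.set_reg, if_true] at hm'
          rcases (show m' < m ∨ m' = m by omega) with h'' | rfl
          · exact hmiss m' h''
          · rintro ⟨_, h''⟩
            omega
        · rw [hΦ, Finset.sum_eq_sum_Ico_succ_bot hb, hfar]
          simp only [Φ, State.set_reg, if_true]
          set s := ∑ k ∈ Finset.Ico (m + 1) I.n, I.farInd j (I.S (I.perm j k))
          have : (1 + s + 1) * (U + 1) = (s + 1) * (U + 1) + (U + 1) := by ring
          split_ifs <;> omega
    · simp only [Test.holds, C₁.r42] at h
      -- A smaller key is impossible from register `9` on, so a key different from that of the query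
      -- is larger, and so are all later ones.
      have hgt : I.lexKey j I.q < I.lexKey j (I.S (I.perm j m)) := by
        rcases hcmp with h' | h' | h'
        · exact absurd h'.2 (not_lt.2 (hhi m h9' hb))
        · omega
        · exact h'.2
      refine Runs.asg hE (by decide) (Ex.var_ok (by decide)) (by simp only [Ex.cost]; omega) ?_
      simp only [Ex.eval, C₁.r20]
      refine ⟨⟨G₁.set (by decide) _, Q₁, ?_, ?_, .inl ⟨?_, ?_⟩⟩, ?_⟩
      · simpa [State.set_reg] using h9
      · simp [State.set_reg]
      · simpa [State.set_reg] using s0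
      · intro m' hm' hit
        simp only [State.set_reg, if_true] at hm'
        rcases lt_or_ge m' m with h' | h'
        · exact hmiss m' h' hit
        · exact absurd hit.1 (hgt.trans_le (hS j hjR m m' h' hm')).ne'
      · simp only [Φ, State.set_reg, if_true, lt_irrefl, if_false]; omega
  · refine ⟨(Keeps.refl _ v).set (by decide) _, fun _ _ _ => rfl, ?_, ?_, .inl ⟨?_, ?_⟩⟩
    · simp [State.set_reg]
    · simpa [State.set_reg] using h9
    · simpa [State.set_reg] using h0
    · intro m hm hit
      simp only [State.set_reg, if_true] at hm
      exact absurd hit.1 (hlo m hm).ne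

/-- Time bound for one hash function. -/
noncomputable def Inst.copyTime (I : Inst) (j : ℕ) : ℕ :=
  300 * (I.ℓ + 1) + 500 * (I.d + I.ℓ + 3) * (I.n.size + 1) +
    ((I.far j + 1) * (I.candidateTime + 1) + 10) + 20

theorem Inst.Ctx.of_header {I : Inst} {E : Env} (hI : I.Holds E) {v : State}
    (h : ∀ k < 24, v.reg (20 + k) = E.data.getD k 0) : I.Ctx v := by
  have e : ∀ k < 24, v.reg (20 + k) = I.header.getD k 0 := fun k hk => by
    rw [h k hk, hI.header k hk]
  exact ⟨e 0 (by decide), e 1 (by decide), e 2 (by decide), e 3 (by decide), e 4 (by decide),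
    e 5 (by decide), e 6 (by decide), e 7 (by decide), e 8 (by decide), e 9 (by decide),
    e 10 (by decide), e 11 (by decide), e 12 (by decide), e 13 (by decide), e 14 (by decide),
    e 15 (by decide), e 16 (by decide), e 17 (by decide), e 18 (by decide), e 19 (by decide),
    e 20 (by decide), e 21 (by decide), e 22 (by decide)⟩

/-- Surjectivity `hp` turns the absence of hits among the positions of the sorted order into the
absence of hits among the strings. After a hit the counter is set to `R`, which ends the loop. -/
theorem runs_query {I : Inst} {E : Env} (hI : I.Holds E) (hS : I.Sorted)
    (hp : ∀ j < I.R, ∀ i < I.n, ∃ m < I.n, I.perm j m = i) {v : State}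
    (h0 : v.reg 0 = I.q.length) :
    Runs E query v (100 * (I.d + 2) + ∑ j ∈ Finset.range I.R, (I.copyTime j + 1)) (fun v' =>
      v'.reg 0 = 0 ∧ (∀ j < I.R, ∀ i < I.n, ¬ I.Hit j (I.S i)) ∨
        ∃ j < I.R, ∃ i < I.n, I.Hit j (I.S i) ∧ v'.reg 0 = i + 1) := by
  have hw := hI.address_lt
  have hE := hI.fits
  have hlit : ∀ c < 50, ∀ v', (Ex.lit c).Ok E v' := fun c hc v' => by simp only [Ex.Ok]; omega
  have hRn : I.R ≤ I.R * I.n := Nat.le_mul_of_pos_right _ hI.n_pos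
  unfold query
  refine Runs.cons (runs_loadHeader hE 24 (by decide) (by omega) v) (by omega) ?_
  rintro v₁ ⟨_, hr₁, hf₁⟩
  have C₁ := Inst.Ctx.of_header hI hr₁
  refine Runs.cons (runs_copyQuery hI C₁ (by rw [hf₁ 0 (by decide), h0])) (by omega) ?_
  rintro v₂ ⟨C₂, r0, r1, hq⟩
  refine Runs.cons_asg hE (by decide) (hlit _ (by decide) _) (by simp only [Ex.cost]; omega) ?_
  simp only [Ex.eval]
  let Φ : State → ℕ := fun v' => ∑ j ∈ Finset.Ico (v'.reg 2) I.R, (I.copyTime j + 1)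
  have hloop := Runs.loop (E := E) (b := .lt 2 21) (P := seqs [hash 41 33, binarySearch,
      searchBucket, .ite (.eq 0 41) (asg 2 (.add (.var 2) (.lit 1))) (asg 2 (.var 21))])
    (by simp [Test.Ok])
    (fun v' => I.Ctx v' ∧ v'.reg 1 = I.q.length ∧ v'.HasString I 0 I.q ∧ v'.reg 2 ≤ I.R ∧
      (v'.reg 0 = 0 ∧ (∀ j < v'.reg 2, ∀ i < I.n, ¬ I.Hit j (I.S i)) ∨
        v'.reg 2 = I.R ∧ ∃ j < I.R, ∃ i < I.n, I.Hit j (I.S i) ∧ v'.reg 0 = i + 1)) Φ ?_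
    (v := v₂.set 2 0) ?_
  · refine Runs.cons hloop ?_ ?_
    · simp only [Φ, State.set_reg, if_true, Ex.cost, Finset.range_eq_Ico]
      omega
    · rintro v' ⟨⟨C', _, _, hle, hcase⟩, hb⟩
      simp only [Test.holds, C'.r21] at hb
      refine Runs.nil ?_
      rcases hcase with h | h
      · exact .inl ⟨h.1, fun j hj => h.2 j (by omega)⟩
      · exact .inr h.2
  · rintro v' ⟨C', s1, hq', hle, hcase⟩ hb
    simp only [Test.holds, C'.r21] at hb
    obtain ⟨s0, hmiss⟩ : v'.reg 0 = 0 ∧ ∀ j < v'.reg 2, ∀ i < I.n, ¬ I.Hit j (I.S i) := by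
      rcases hcase with h | h
      · exact h
      · omega
    obtain ⟨j, hj⟩ : ∃ j, v'.reg 2 = j := ⟨_, rfl⟩
    rw [hj] at hmiss hb
    have hΦ : Φ v' = I.copyTime j + 1 + ∑ i ∈ Finset.Ico (j + 1) I.R, (I.copyTime i + 1) := by
      simp only [Φ, hj]
      rw [Finset.sum_eq_sum_Ico_succ_bot hb]
    refine ⟨I.copyTime j, ?_⟩
    refine Runs.cons (runs_hash hI C' (src := 41) (dst := 33) (by decide) (by decide) (by decide)
      (by decide) C'.r41 C'.r33 hj hb hI.length_q hI.mem_q hq' (by omega)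
      (by simp only [Inst.scratch]; omega)) (by simp only [Inst.copyTime]; omega) ?_
    rintro w₁ ⟨F₁, hk₁, hm₁⟩
    have D₁ := F₁.ctx C' (by decide)
    have hq₁ : w₁.HasString I 0 I.q := fun t ht => by
      have := hI.length_q
      rw [hm₁ _ (by omega), hq' t ht]
    have e2 : w₁.reg 2 = j := by rw [F₁ 2 (by decide), hj]
    refine Runs.cons (runs_binarySearch hI hS D₁ e2 hb hk₁)
      (by simp only [Inst.copyTime]; omega) ?_
    rintro w₂ ⟨F₂, K₂, h9, hlo, hhi⟩
    have D₂ := F₂.ctx D₁ (by decide)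
    refine Runs.cons (runs_searchBucket hI hS D₂ (by rw [F₂ 2 (by decide), e2]) hb
      (K₂.hasHash hk₁) (by rw [F₂ 0 (by decide), F₁ 0 (by decide), s0])
      (by rw [F₂ 1 (by decide), F₁ 1 (by decide), s1]) (K₂.keepsQuery.hasString hI.length_q hq₁) h9
      hlo hhi) (by simp only [Inst.copyTime]; omega) ?_
    rintro w₃ ⟨F₃, Q₃, hres⟩
    have D₃ := F₃.ctx D₂ (by decide)
    have hq₃ := Q₃.hasString hI.length_q (K₂.keepsQuery.hasString hI.length_q hq₁)
    have g1 : w₃.reg 1 = I.q.length := by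
      rw [F₃ 1 (by decide), F₂ 1 (by decide), F₁ 1 (by decide), s1]
    have g2 : w₃.reg 2 = j := by rw [F₃ 2 (by decide), F₂ 2 (by decide), e2]
    refine Runs.cons (T₀ := 20) ?_ (by simp only [Inst.copyTime]; omega) fun v' h => Runs.nil h
    have ctx_set : ∀ w, I.Ctx (w₃.set 2 w) := fun w =>
      (((Keeps.refl [2] w₃).set (by decide) w)).ctx D₃ (by decide)
    refine Runs.ite (by simp [Test.Ok]) (fun h => ?_) (fun h => ?_) (by omega)
    · simp only [Test.holds, D₃.r41] at h
      have hnone : ∀ m < I.n, ¬ I.Hit j (I.S (I.perm j m)) := by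
        rcases hres with h' | ⟨i, _, _, h'⟩
        · exact h'.2
        · omega
      refine Runs.asg hE (by decide) ⟨Ex.var_ok (by decide), hlit _ (by decide) _, ?_⟩
        (by decide) ?_
      · simp only [Ex.eval, g2]; omega
      simp only [Ex.eval, g2]
      refine ⟨⟨ctx_set _, ?_, hq₃, ?_, .inl ⟨?_, ?_⟩⟩, ?_⟩
      · simpa [State.set_reg] using g1
      · simp only [State.set_reg, if_true]; omega
      · simpa [State.set_reg] using h
      · intro j' hj' i hi hit
        simp only [State.set_reg, if_true] at hj'
        rcases (show j' < j ∨ j' = j by omega) with h' | rfl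
        · exact hmiss j' h' i hi hit
        · obtain ⟨m, hm, rfl⟩ := hp j' hb i hi
          exact hnone m hm hit
      · rw [hΦ]
        simp only [Φ, State.set_reg, if_true]
        omega
    · simp only [Test.holds, D₃.r41] at h
      obtain ⟨i, hi, hit, ei⟩ : ∃ i < I.n, I.Hit j (I.S i) ∧ w₃.reg 0 = i + 1 := by
        rcases hres with h' | h'
        · exact absurd h'.1 h
        · exact h'
      refine Runs.asg hE (by decide) (Ex.var_ok (by decide)) (by decide) ?_
      simp only [Ex.eval, D₃.r21]
      refine ⟨⟨ctx_set _, ?_, hq₃, ?_, .inr ⟨?_, j, hb, i, hi, hit, ?_⟩⟩, ?_⟩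
      · simpa [State.set_reg] using g1
      · simp [State.set_reg]
      · simp [State.set_reg]
      · simpa [State.set_reg] using ei
      · rw [hΦ]
        simp only [Φ, State.set_reg, if_true, Finset.Ico_self, Finset.sum_empty]
        omega
  · refine ⟨((Keeps.refl [2] v₂).set (by decide) 0).ctx C₂ (by decide), ?_, hq, ?_, .inl ⟨?_, ?_⟩⟩
    · simpa [State.set_reg] using r1
    · simp [State.set_reg]
    · simpa [State.set_reg] using r0
    · intro j hj
      simp [State.set_reg] at hj

/-- Correctness and running time of the query program. -/
theorem exec_query {I : Inst} {E : Env} (hI : I.Holds E) (hS : I.Sorted)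
    (hp : ∀ j < I.R, ∀ i < I.n, ∃ m < I.n, I.perm j m = i) :
    ∃ t s', Exec E query E.init t s' ∧
      t ≤ 3000 * ((I.d + I.ℓ + 3) * (I.K + 1)) *
        (1 + ∑ j ∈ Finset.range I.R, (I.n.size + 1 + I.far j)) ∧
      (s'.reg 0 = 0 ∧ (∀ j < I.R, ∀ i < I.n, ¬ I.Hit j (I.S i)) ∨
        ∃ j < I.R, ∃ i < I.n, I.Hit j (I.S i) ∧ s'.reg 0 = i + 1) := by
  have hw := hI.address_lt
  have hs := hI.scratch
  have hlen := hI.length_q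
  have h0 : E.init.reg 0 = I.q.length := by
    simp only [Env.init, Function.update_self, hI.input]
    refine Nat.mod_eq_of_lt ?_
    simp only [Inst.scratch] at hw
    omega
  have hreg : ∀ i < 50, E.init.reg i < 2 ^ E.wordSize := by
    intro i _
    simp only [Env.init, Function.update_apply]
    split_ifs
    · exact Nat.mod_lt _ (Nat.two_pow_pos _)
    · exact Nat.two_pow_pos _
  obtain ⟨t, s', v', he, ht, hv, hres⟩ := runs_query hI hS hp h0 E.init
    ⟨fun _ _ => rfl, rfl, hreg, fun _ => Nat.two_pow_pos _⟩
  refine ⟨t, s', he, ht.trans ?_, ?_⟩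
  · set B := (I.d + I.ℓ + 3) * (I.K + 1) with hB
    have hB₁ : I.d + I.ℓ + 3 ≤ B := Nat.le_mul_of_pos_right _ (by omega)
    have hB₂ : (I.d + 2) * (I.K + 1) ≤ B := Nat.mul_le_mul_right _ (by omega)
    have hU : I.candidateTime + 1 ≤ 1200 * B := by
      rw [Inst.candidateTime, mul_assoc 700]; omega
    have hj : ∀ j, I.copyTime j + 1 ≤ 3000 * B * (I.n.size + 1 + I.far j) := fun j => by
      have h₁ := Nat.mul_le_mul_left (I.far j + 1) hU
      have h₂ := Nat.mul_le_mul_right (I.n.size + 1) hB₁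
      have h₃ : (I.far j + 1) * (1200 * B) = 1200 * (I.far j * B) + 1200 * B := by ring
      have h₄ : 3000 * B * (I.n.size + 1 + I.far j) =
        3000 * (B * (I.n.size + 1)) + 3000 * (I.far j * B) := by ring
      have h₅ : B ≤ B * (I.n.size + 1) := Nat.le_mul_of_pos_right _ (by omega)
      rw [Inst.copyTime, mul_assoc 500]
      omega
    rw [mul_add (3000 * B), Finset.mul_sum]
    refine add_le_add (by omega) (Finset.sum_le_sum fun j _ => hj j)
  · rw [hv.reg 0 (by decide)]
    exact hres

end WordRAM

/-! ## Collision probabilities -/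

section Collision

variable {X χ : Type} [Fintype X] [DecidableEq χ]

/-- The scan driven by a list of random choices: `none` stays and writes `⊥`, `some false` moves on
and writes `⊥`, `some true` moves on and writes the current character. -/
def scanBy (act : X → χ → Option Bool) : List X → List χ → List (Option χ)
  | [], _ => []
  | _ :: _, [] => []
  | z :: l, a :: x =>
    match act z a with
    | none => none :: scanBy act l (a :: x)
    | some false => none :: scanBy act l x
    | some true => some a :: scanBy act l x

/-- Average over the lists of length `m`. -/
noncomputable def avg (m : ℕ) (F : List X → ℝ) : ℝ :=
  (∑ f : Fin m → X, F (List.ofFn f)) / (Fintype.card X : ℝ) ^ m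

theorem avg_zero (F : List X → ℝ) : avg 0 F = F [] := by
  simp [avg]

/-- Conditioning on the first choice; this turns collision probabilities into a recursion. -/
theorem avg_succ (m : ℕ) (F : List X → ℝ) :
    avg (m + 1) F = (∑ z, avg m (fun l => F (z :: l))) / Fintype.card X := by
  simp only [avg]
  rw [← Finset.sum_div, div_div, ← pow_succ, ← Fintype.sum_prod_type']
  congr 1
  refine (Fintype.sum_equiv (Fin.consEquiv fun _ => X) _ _ fun p => ?_).symm
  simp [Fin.consEquiv]

/-- Probability that the scans of two strings agree. -/
noncomputable def collide (act : X → χ → Option Bool) (m : ℕ) (x y : List χ) : ℝ :=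
  avg m fun l => if scanBy act l x = scanBy act l y then 1 else 0

/-- The choices at a character have distribution `w` and are independent for two different
characters. -/
structure PairwiseLaw (act : X → χ → Option Bool) (w : Option Bool → ℝ) : Prop where
  card_pos : 0 < Fintype.card X
  nonneg : ∀ u, 0 ≤ w u
  sum_eq : ∑ u, w u = 1
  single : ∀ a, ∀ F : Option Bool → ℝ, ∑ z, F (act z a) = Fintype.card X * ∑ u, w u * F u
  pair : ∀ a b, a ≠ b → ∀ F : Option Bool → Option Bool → ℝ,
    ∑ z, F (act z a) (act z b) = Fintype.card X * ∑ u, w u * ∑ v, w v * F u v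

variable {act : X → χ → Option Bool} {w : Option Bool → ℝ}

omit [Fintype X] [DecidableEq χ] in
theorem cases_act (act : X → χ → Option Bool) (z : X) (a : χ) :
    act z a = none ∨ act z a = some false ∨ act z a = some true := by
  rcases act z a with _ | _ | _ <;> simp

theorem collide_zero (x y : List χ) : collide act 0 x y = 1 := by
  simp [collide, avg_zero, scanBy]

theorem collide_nonneg (m : ℕ) (x y : List χ) : 0 ≤ collide act m x y :=
  div_nonneg (Finset.sum_nonneg fun _ _ => by beta_reduce; split_ifs <;> norm_num) (by positivity)

theorem avg_const (h : 0 < Fintype.card X) (m : ℕ) (c : ℝ) : avg (X := X) m (fun _ => c) = c := by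
  have : (Fintype.card X : ℝ) ≠ 0 := by positivity
  simp [avg, this]

theorem collide_self (h : 0 < Fintype.card X) (m : ℕ) (x : List χ) : collide act m x x = 1 := by
  simp [collide, avg_const h]

/-- A finished scan writes nothing more, an unfinished one writes at least one further character. -/
theorem collide_nil_cons (m : ℕ) (b : χ) (y : List χ) :
    collide act (m + 1) [] (b :: y) = 0 := by
  rw [collide, avg_succ]
  have : ∀ (z : X) (l : List X), ¬ scanBy act (z :: l) [] = scanBy act (z :: l) (b :: y) := by
    intro z l
    rw [scanBy, scanBy]
    split <;> simp
  simp [this, avg]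

theorem collide_comm (m : ℕ) (x y : List χ) : collide act m x y = collide act m y x := by
  simp only [collide, eq_comm]

/-- Both scans look up the same random value, so they stay together or advance together and write
the same. -/
theorem collide_same (h : PairwiseLaw act w) (m : ℕ) (a : χ) (x y : List χ) :
    collide act (m + 1) (a :: x) (a :: y) =
      w none * collide act m (a :: x) (a :: y) + (1 - w none) * collide act m x y := by
  have hc : (Fintype.card X : ℝ) ≠ 0 := by have := h.card_pos; positivity
  obtain ⟨F, hF⟩ : ∃ F : Option Bool → ℝ, F = fun u => if u = none then
    collide act m (a :: x) (a :: y) else collide act m x y := ⟨_, rfl⟩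
  have key : ∀ z, avg m (fun l => if scanBy act (z :: l) (a :: x) = scanBy act (z :: l) (a :: y)
      then (1 : ℝ) else 0) = F (act z a) := by
    intro z
    rcases cases_act act z a with hz | hz | hz <;> simp [collide, scanBy, hz, hF]
  have hsum := h.sum_eq
  simp only [Fintype.sum_option, Fintype.sum_bool] at hsum
  rw [collide, avg_succ, Finset.sum_congr rfl fun z _ => key z, h.single a F, mul_div_cancel_left₀ _ hc]
  simp only [Fintype.sum_option, Fintype.sum_bool]
  simp only [hF, if_true, reduceCtorEq, if_false]
  rw [← hsum]
  ring

/-- If either scan writes its character, the outputs differ at this position; of the nine joint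
outcomes only the four without `some true` survive. -/
theorem collide_ne (h : PairwiseLaw act w) (m : ℕ) {a b : χ} (hab : a ≠ b) (x y : List χ) :
    collide act (m + 1) (a :: x) (b :: y) =
      w none ^ 2 * collide act m (a :: x) (b :: y) +
      w none * w (some false) * collide act m (a :: x) y +
      w none * w (some false) * collide act m x (b :: y) +
      w (some false) ^ 2 * collide act m x y := by
  have hc : (Fintype.card X : ℝ) ≠ 0 := by have := h.card_pos; positivity
  obtain ⟨F, hF⟩ : ∃ F : Option Bool → Option Bool → ℝ, F = fun u v => match u, v with
    | none, none => collide act m (a :: x) (b :: y)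
    | none, some false => collide act m (a :: x) y
    | some false, none => collide act m x (b :: y)
    | some false, some false => collide act m x y
    | _, _ => 0 := ⟨_, rfl⟩
  have key : ∀ z, avg m (fun l => if scanBy act (z :: l) (a :: x) = scanBy act (z :: l) (b :: y)
      then (1 : ℝ) else 0) = F (act z a) (act z b) := by
    intro z
    rcases cases_act act z a with hz | hz | hz <;>
      rcases cases_act act z b with hz' | hz' | hz' <;>
      simp [collide, scanBy, hz, hz', hab, avg, hF]
  rw [collide, avg_succ, Finset.sum_congr rfl fun z _ => key z, h.pair a b hab F,
    mul_div_cancel_left₀ _ hc]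
  simp only [Fintype.sum_option, Fintype.sum_bool, hF]
  ring

/-- A string with its end marker. -/
def marked {α : Type} (x : List α) : List (Option α) := x.map some ++ [none]

theorem marked_cons {α : Type} (a : α) (x : List α) : marked (a :: x) = some a :: marked x := rfl

theorem marked_nil {α : Type} : marked ([] : List α) = [none] := rfl

end Collision

/-! ### Bounds for the collision probability in terms of the edit distance -/

section Bounds

variable {X α : Type} [Fintype X] [DecidableEq α] {act : X → Option α → Option Bool}
  {w : Option Bool → ℝ}

/-- Among the three moves of `collide_ne` that advance, one lowers the distance by one, and already
this move alone makes `s ^ lev` a subsolution of the recursion. The cut-off does no harm: empty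
outputs collide, and `s ^ lev ≤ 1`. -/
theorem pow_lev_le_collide (h : PairwiseLaw act w) {s : ℝ} (hs : 0 ≤ s)
    (h₁ : s * (1 - w none ^ 2) ≤ w none * w (some false))
    (h₂ : s * (1 - w none ^ 2) ≤ w (some false) ^ 2) (m : ℕ) (x y : List α) (hs1 : s ≤ 1) :
    s ^ lev x y ≤ collide act m (marked x) (marked y) := by
  have hw := h.nonneg
  induction m generalizing x y with
  | zero => rw [collide_zero]; exact pow_le_one₀ hs hs1
  | succ m ih =>
    -- `c` stands for the collision probability after both scans stay, `c'` for that after the move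
    -- of weight `q` that lowers the distance.
    have key : ∀ D : ℕ, ∀ q c c' : ℝ, s * (1 - w none ^ 2) ≤ q → s ^ (D + 1) ≤ c → s ^ D ≤ c' →
        s ^ (D + 1) ≤ w none ^ 2 * c + q * c' := by
      intro D q c c' hq hc hc'
      have hD : 0 ≤ s ^ D := pow_nonneg hs D
      have hq0 : 0 ≤ w none ^ 2 := sq_nonneg _
      have e₁ := mul_le_mul_of_nonneg_left hc hq0
      have e₂ := mul_le_mul_of_nonneg_right hq hD
      have hw1 : w none ^ 2 ≤ 1 := by
        have hsum := h.sum_eq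
        simp only [Fintype.sum_option, Fintype.sum_bool] at hsum
        have := hw (some true); have := hw (some false)
        exact pow_le_one₀ (hw none) (by linarith)
      have hq' : 0 ≤ q := le_trans (mul_nonneg hs (by linarith)) hq
      have e₃ := mul_le_mul_of_nonneg_left hc' hq'
      have : s ^ (D + 1) = w none ^ 2 * s ^ (D + 1) + s * (1 - w none ^ 2) * s ^ D := by ring
      linarith
    have hq12 : 0 ≤ w none * w (some false) := mul_nonneg (hw _) (hw _)
    have hq22 : 0 ≤ w (some false) ^ 2 := sq_nonneg _
    have hc := fun x y => collide_nonneg (act := act) m x y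
    have m₁ := fun x y => mul_nonneg hq12 (hc x y)
    have m₂ := fun x y => mul_nonneg hq22 (hc x y)
    cases x with
    | nil =>
      cases y with
      | nil => rw [collide_self h.card_pos, lev_self, pow_zero]
      | cons b y =>
        have ih₁ := ih [] (b :: y)
        have ih₂ := ih [] y
        rw [lev_nil_left, List.length_cons] at ih₁ ⊢
        rw [lev_nil_left] at ih₂
        rw [marked_nil, marked_cons] at *
        rw [collide_ne h m (by simp)]
        have := key _ _ _ _ h₁ ih₁ ih₂
        have := m₁ [] (some b :: marked y)
        have := m₂ [] (marked y)
        linarith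
    | cons a x =>
      cases y with
      | nil =>
        have ih₁ := ih (a :: x) []
        have ih₂ := ih x []
        rw [lev_nil_right, List.length_cons] at ih₁ ⊢
        rw [lev_nil_right] at ih₂
        rw [marked_nil, marked_cons] at *
        rw [collide_ne h m (by simp)]
        have := key _ _ _ _ h₁ ih₁ ih₂
        have := m₁ (some a :: marked x) []
        have := m₂ (marked x) []
        linarith
      | cons b y =>
        by_cases hab : a = b
        · subst hab
          have ih₁ := ih (a :: x) (a :: y)
          have ih₂ := ih x y
          rw [lev_cons_same] at ih₁ ⊢
          rw [marked_cons, marked_cons] at *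
          rw [collide_same h]
          have hsum := h.sum_eq
          simp only [Fintype.sum_option, Fintype.sum_bool] at hsum
          have h3 := hw (some true); have h4 := hw (some false)
          have := mul_le_mul_of_nonneg_left ih₁ (hw none)
          have := mul_le_mul_of_nonneg_left ih₂ (show 0 ≤ 1 - w none by linarith)
          linarith
        · have ih₀ := ih (a :: x) (b :: y)
          have ih₁ := ih (a :: x) y
          have ih₂ := ih x (b :: y)
          have ih₃ := ih x y
          rw [lev_cons_ne hab] at ih₀ ⊢
          rw [marked_cons, marked_cons] at ih₀ ⊢
          rw [marked_cons] at ih₁ ih₂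
          rw [collide_ne h m (by simpa using hab)]
          have n₁ := m₁ (some a :: marked x) (marked y)
          have n₂ := m₁ (marked x) (some b :: marked y)
          have n₃ := m₂ (marked x) (marked y)
          rcases min_choice (lev x y) (min (lev x (b :: y)) (lev (a :: x) y)) with e | e <;>
            rw [e] at ih₀ ⊢
          · have := key _ _ _ _ h₂ ih₀ ih₃
            linarith
          · rcases min_choice (lev x (b :: y)) (lev (a :: x) y) with e | e <;>
              rw [e] at ih₀ ⊢
            · have := key _ _ _ _ h₁ ih₀ ih₂
              linarith
            · have := key _ _ _ _ h₁ ih₀ ih₁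
              linarith

/-- No move lowers the distance by more than one and the three that advance weigh at most `t (1 - w
none ^ 2)`, so `t ^ lev` is a supersolution of the recursion apart from the cut-off. For the latter,
weigh a state by `3` to the number of unread characters of `x` and its marker: a step multiplies
this weight on average by `l`, and it is at least `1` when the output is cut off. -/
theorem collide_le (h : PairwiseLaw act w) {t l : ℝ} (ht : 0 ≤ t) (ht1 : t ≤ 1)
    (h₁ : 2 * (w none * w (some false)) + w (some false) ^ 2 ≤ t * (1 - w none ^ 2))
    (hl : w none + (1 - w none) / 3 = l) (m : ℕ) (x y : List α) :
    collide act m (marked x) (marked y) ≤ t ^ lev x y + 3 ^ (x.length + 1) * l ^ m := by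
  have hw := h.nonneg
  have hsum := h.sum_eq
  simp only [Fintype.sum_option, Fintype.sum_bool] at hsum
  have w1 := hw none; have w2 := hw (some false); have w3 := hw (some true)
  have hl0 : 0 ≤ l := by rw [← hl]; linarith
  induction m generalizing x y with
  | zero =>
    rw [collide_zero, pow_zero, mul_one]
    have : (1 : ℝ) ≤ 3 ^ (x.length + 1) := one_le_pow₀ (by norm_num)
    have := pow_nonneg ht (lev x y)
    linarith
  | succ m ih =>
    have hG : ∀ j : ℕ, w none * (3 ^ (j + 1) * l ^ m) + (1 - w none) * (3 ^ j * l ^ m) =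
        3 ^ (j + 1) * l ^ (m + 1) := by
      intro j
      have e : w none * (3 ^ (j + 1) * l ^ m) + (1 - w none) * (3 ^ j * l ^ m) =
        3 ^ (j + 1) * l ^ m * (w none + (1 - w none) / 3) := by ring
      rw [e, hl]; ring
    have hG0 : ∀ j : ℕ, 0 ≤ 3 ^ j * l ^ m := fun j => by positivity
    have key : ∀ (D j : ℕ) (c₀ c₁ c₂ c₃ : ℝ), c₀ ≤ t ^ (D + 1) + 3 ^ (j + 1) * l ^ m →
        c₁ ≤ t ^ D + 3 ^ (j + 1) * l ^ m → c₂ ≤ t ^ D + 3 ^ j * l ^ m →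
        c₃ ≤ t ^ D + 3 ^ j * l ^ m →
        w none ^ 2 * c₀ + w none * w (some false) * c₁ + w none * w (some false) * c₂ +
          w (some false) ^ 2 * c₃ ≤ t ^ (D + 1) + 3 ^ (j + 1) * l ^ (m + 1) := by
      intro D j c₀ c₁ c₂ c₃ e₀ e₁ e₂ e₃
      have hq12 : 0 ≤ w none * w (some false) := mul_nonneg w1 w2
      have f₀ := mul_le_mul_of_nonneg_left e₀ (sq_nonneg (w none))
      have f₁ := mul_le_mul_of_nonneg_left e₁ hq12
      have f₂ := mul_le_mul_of_nonneg_left e₂ hq12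
      have f₃ := mul_le_mul_of_nonneg_left e₃ (sq_nonneg (w (some false)))
      have hD := mul_le_mul_of_nonneg_right h₁ (pow_nonneg ht D)
      -- The error terms are grouped by what the scan of `x` does: it stays with total weight at
      -- most `w none` and advances with total weight at most `1 - w none`.
      have a₁ : w none ^ 2 + w none * w (some false) ≤ w none := by nlinarith
      have a₂ : w none * w (some false) + w (some false) ^ 2 ≤ 1 - w none := by nlinarith
      have b₁ := mul_le_mul_of_nonneg_right a₁ (hG0 (j + 1))
      have b₂ := mul_le_mul_of_nonneg_right a₂ (hG0 j)
      have e : t ^ (D + 1) = w none ^ 2 * t ^ (D + 1) + t * (1 - w none ^ 2) * t ^ D := by ring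
      rw [← hG j]
      linarith
    -- Covers the states in which one marker has been read, which are not of the form `marked x`:
    -- the scans collide only if no further output is allowed.
    have hnil : ∀ (D j : ℕ) (z : List (Option α)), z ≠ [] →
        collide act m [] z ≤ t ^ D + 3 ^ j * l ^ m := by
      intro D j z hz
      have hD := pow_nonneg ht D
      cases m with
      | zero =>
        rw [collide_zero, pow_zero, mul_one]
        have : (1 : ℝ) ≤ 3 ^ j := one_le_pow₀ (by norm_num)
        linarith
      | succ m =>
        obtain ⟨b, z, rfl⟩ := List.exists_cons_of_ne_nil hz
        rw [collide_nil_cons]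
        have := hG0 j
        linarith
    have hle : ∀ {D D' : ℕ}, D ≤ D' → t ^ D' ≤ t ^ D := fun hD => pow_le_pow_of_le_one ht ht1 hD
    cases x with
    | nil =>
      cases y with
      | nil =>
        rw [collide_self h.card_pos, lev_self, pow_zero]
        have : 0 ≤ (3 : ℝ) ^ (([] : List α).length + 1) * l ^ (m + 1) := by positivity
        linarith
      | cons b y =>
        have ih₁ := ih [] (b :: y)
        have ih₂ := ih [] y
        rw [lev_nil_left, List.length_cons] at ih₁ ⊢
        rw [lev_nil_left] at ih₂
        have hne : marked y ≠ [] := by simp [marked]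
        rw [marked_nil, marked_cons] at *
        rw [collide_ne h m (by simp)]
        exact key _ _ _ _ _ _ ih₁ ih₂ (hnil _ _ _ (by simp)) (hnil _ _ _ hne)
    | cons a x =>
      cases y with
      | nil =>
        have ih₁ := ih (a :: x) []
        have ih₂ := ih x []
        rw [lev_nil_right, List.length_cons] at ih₁ ⊢
        rw [lev_nil_right] at ih₂
        have hne : marked x ≠ [] := by simp [marked]
        rw [marked_nil, marked_cons] at *
        rw [collide_ne h m (by simp)]
        refine key _ _ _ _ _ _ ih₁ ?_ ih₂ ?_
        · rw [collide_comm]; exact hnil _ _ _ (by simp)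
        · rw [collide_comm]; exact hnil _ _ _ hne
      | cons b y =>
        by_cases hab : a = b
        · subst hab
          have ih₁ := ih (a :: x) (a :: y)
          have ih₂ := ih x y
          rw [lev_cons_same] at ih₁ ⊢
          rw [marked_cons, marked_cons] at *
          rw [collide_same h]
          have := mul_le_mul_of_nonneg_left ih₁ (hw none)
          have := mul_le_mul_of_nonneg_left ih₂ (show 0 ≤ 1 - w none by linarith)
          have := hG (x.length + 1)
          simp only [List.length_cons] at *
          linarith
        · have ih₀ := ih (a :: x) (b :: y)
          have ih₁ := ih (a :: x) y
          have ih₂ := ih x (b :: y)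
          have ih₃ := ih x y
          rw [lev_cons_ne hab] at ih₀ ⊢
          set D := min (lev x y) (min (lev x (b :: y)) (lev (a :: x) y)) with hD
          rw [marked_cons, marked_cons] at ih₀ ⊢
          rw [marked_cons] at ih₁ ih₂
          rw [collide_ne h m (by simpa using hab)]
          have d₁ : t ^ lev (a :: x) y ≤ t ^ D := hle (by omega)
          have d₂ : t ^ lev x (b :: y) ≤ t ^ D := hle (by omega)
          have d₃ : t ^ lev x y ≤ t ^ D := hle (by omega)
          rw [List.length_cons] at *
          refine key D _ _ _ _ _ ih₀ ?_ ?_ ?_ <;> linarith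

end Bounds

/-! ## Affine hash values -/

section Affine

variable {P : ℕ} [Fact P.Prime]

/-- The choices at one position: two affine functions over `ZMod P`. -/
abbrev Slot (P : ℕ) : Type := (ZMod P × ZMod P) × (ZMod P × ZMod P)

/-- The value at `c` of an affine function. -/
def affineEval (l : ZMod P × ZMod P) (c : ZMod P) : ZMod P := l.1 + l.2 * c

/-- The pair of values at `c`. -/
def slotValue (z : Slot P) (c : ZMod P) : ZMod P × ZMod P := (affineEval z.1 c, affineEval z.2 c)

/-- Over a field an affine function is determined by its values at two points; a uniform one
therefore has independent uniform values there. -/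
theorem affine_pair_bijective {a b : ZMod P} (hab : a ≠ b) :
    Function.Bijective fun l : ZMod P × ZMod P => (affineEval l a, affineEval l b) := by
  rw [← Finite.injective_iff_bijective]
  rintro ⟨u, v⟩ ⟨u', v'⟩ h
  simp only [affineEval, Prod.mk.injEq] at h
  have hv : (v - v') * (a - b) = 0 := by linear_combination h.1 - h.2
  rcases mul_eq_zero.mp hv with h0 | h0
  · have hv' : v = v' := sub_eq_zero.mp h0
    subst hv'
    exact Prod.ext (add_right_cancel h.1) rfl
  · exact absurd (sub_eq_zero.mp h0) hab

theorem slotValue_pair_bijective {a b : ZMod P} (hab : a ≠ b) :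
    Function.Bijective fun z : Slot P => (slotValue z a, slotValue z b) := by
  rw [← Finite.injective_iff_bijective]
  intro z z' h
  simp only [slotValue, Prod.mk.injEq] at h
  have hinj := (affine_pair_bijective hab).injective
  exact Prod.ext (hinj (Prod.ext h.1.1 h.2.1)) (hinj (Prod.ext h.1.2 h.2.2))

/-- The choice made from a pair of values with the thresholds `ta` and `tr`. -/
def choose (ta tr : ℕ) (v : ZMod P × ZMod P) : Option Bool :=
  if v.1.val < ta then none else if v.2.val < tr then some false else some true

/-- The distribution of the choice. -/
noncomputable def choiceLaw (P ta tr : ℕ) : Option Bool → ℝ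
  | none => ta / P
  | some false => (1 - ta / P) * (tr / P)
  | some true => (1 - ta / P) * (1 - tr / P)

theorem sum_ite_val_lt {t : ℕ} (ht : t ≤ P) (u v : ℝ) :
    ∑ x : ZMod P, (if x.val < t then u else v) = t * u + (P - t) * v := by
  have hP : P ≠ 0 := (Fact.out : P.Prime).ne_zero
  obtain ⟨k, rfl⟩ := Nat.exists_eq_succ_of_ne_zero hP
  change ∑ x : Fin (k + 1), (if (x : ℕ) < t then u else v) = _
  rw [Fin.sum_univ_eq_sum_range (fun i => if i < t then u else v) (k + 1), Finset.sum_ite,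
    Finset.sum_const, Finset.sum_const]
  have h₁ : (Finset.range (k + 1)).filter (· < t) = Finset.range t := by
    ext i; simp; omega
  have h₂ : (Finset.range (k + 1)).filter (¬ · < t) = Finset.Ico t (k + 1) := by
    ext i; simp; omega
  rw [h₁, h₂, Finset.card_range, Nat.card_Ico, nsmul_eq_mul, nsmul_eq_mul, Nat.cast_sub ht]

theorem sum_choose {ta tr : ℕ} (ha : ta ≤ P) (hr : tr ≤ P) (F : Option Bool → ℝ) :
    ∑ v : ZMod P × ZMod P, F (choose ta tr v) =
      (P : ℝ) ^ 2 * ∑ u, choiceLaw P ta tr u * F u := by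
  have hP : (P : ℝ) ≠ 0 := by exact_mod_cast (Fact.out : P.Prime).ne_zero
  rw [Fintype.sum_prod_type]
  have : ∀ x y : ZMod P, F (choose ta tr (x, y)) = if x.val < ta then F none else
      if y.val < tr then F (some false) else F (some true) := by
    intro x y
    simp only [choose]
    split_ifs <;> rfl
  have hsum : ∀ x : ZMod P, ∑ y : ZMod P, F (choose ta tr (x, y)) =
      if x.val < ta then (P : ℝ) * F none else tr * F (some false) + (P - tr) * F (some true) := by
    intro x
    rw [Finset.sum_congr rfl fun y _ => this x y]
    split_ifs
    · simp [ZMod.card]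
    · exact sum_ite_val_lt hr _ _
  rw [Finset.sum_congr rfl fun x _ => hsum x, sum_ite_val_lt ha]
  simp only [Fintype.sum_option, Fintype.sum_bool, choiceLaw]
  field_simp
  ring

theorem card_slot : Fintype.card (Slot P) = P ^ 4 := by
  simp [ZMod.card]; ring

theorem pairwiseLaw_choose {χ : Type} {code : χ → ZMod P} (hcode : Function.Injective code)
    {ta tr : ℕ} (ha : ta ≤ P) (hr : tr ≤ P) :
    PairwiseLaw (fun (z : Slot P) a => choose ta tr (slotValue z (code a)))
      (choiceLaw P ta tr) := by
  have hP : (0 : ℝ) < P := by exact_mod_cast (Fact.out : P.Prime).pos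
  have hta : (ta : ℝ) / P ≤ 1 := by rw [div_le_one hP]; exact_mod_cast ha
  have htr : (tr : ℝ) / P ≤ 1 := by rw [div_le_one hP]; exact_mod_cast hr
  have hta0 : 0 ≤ (ta : ℝ) / P := by positivity
  have htr0 : 0 ≤ (tr : ℝ) / P := by positivity
  have hsum : ∑ u, choiceLaw P ta tr u = 1 := by
    simp only [Fintype.sum_option, Fintype.sum_bool, choiceLaw]; ring
  have hpair : ∀ a b : ZMod P, a ≠ b → ∀ F : Option Bool → Option Bool → ℝ,
      ∑ z : Slot P, F (choose ta tr (slotValue z a)) (choose ta tr (slotValue z b)) =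
        Fintype.card (Slot P) * ∑ u, choiceLaw P ta tr u * ∑ v, choiceLaw P ta tr v * F u v := by
    intro a b hab F
    rw [(slotValue_pair_bijective hab).sum_comp fun v => F (choose ta tr v.1) (choose ta tr v.2),
      Fintype.sum_prod_type]
    simp only [sum_choose ha hr]
    rw [sum_choose ha hr fun u => (P : ℝ) ^ 2 * ∑ v, choiceLaw P ta tr v * F u v, card_slot,
      Finset.mul_sum, Finset.mul_sum]
    refine Finset.sum_congr rfl fun u _ => ?_
    push_cast
    ring
  refine ⟨?_, ?_, hsum, ?_, ?_⟩
  · rw [card_slot]; exact pow_pos (Fact.out : P.Prime).pos 4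
  · rintro (_ | _ | _) <;> simp only [choiceLaw]
    · exact hta0
    · exact mul_nonneg (by linarith) htr0
    · exact mul_nonneg (by linarith) (by linarith)
  · intro a F
    -- The law at one character is a marginal of the law at two points; `code a + 1` serves as the
    -- second and need not code a character.
    have hne : code a ≠ code a + 1 := by simp
    rw [hpair _ _ hne fun u _ => F u]
    simp only [← Finset.sum_mul, hsum, one_mul]
  · intro a b hab F
    exact hpair _ _ (hcode.ne hab) F

end Affine

/-! ## Uniform probability -/

section Prob

variable {Ω Ω' : Type} [Fintype Ω] [Fintype Ω']

open Classical in
theorem prob_eq_sum (E : Ω → Prop) :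
    prob E = (∑ ω, if E ω then (1 : ℝ) else 0) / Fintype.card Ω := by
  rw [prob, Nat.card_eq_fintype_card, Fintype.card_subtype, Finset.sum_boole]

theorem prob_comp_equiv (e : Ω ≃ Ω') (E : Ω' → Prop) : prob (fun ω => E (e ω)) = prob E := by
  rw [prob, prob, Fintype.card_congr e]
  congr 2
  exact Nat.card_congr (e.subtypeEquiv fun _ => Iff.rfl)

theorem collide_eq_prob {X χ : Type} [Fintype X] [DecidableEq χ] (act : X → χ → Option Bool)
    (m : ℕ) (x y : List χ) : collide act m x y =
      prob fun f : Fin m → X => scanBy act (List.ofFn f) x = scanBy act (List.ofFn f) y := by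
  classical
  rw [collide, avg, prob_eq_sum]
  simp only [Fintype.card_fun, Fintype.card_fin, Nat.cast_pow]
  congr!

end Prob

/-! ### The scan in terms of random choices and of machine words -/

section Scan

theorem hashScan_eq_scanBy {X : Type} {σ : ℕ} {pa pr : ℝ} {ρ : Option (Fin σ) → ℕ → ℝ × ℝ}
    {act : X → Option (Fin σ) → Option Bool} (l : List X) (k : ℕ)
    (h₁ : ∀ i (hi : i < l.length) a, act l[i] a = none ↔ (ρ a (k + i)).1 ≤ pa)
    (h₂ : ∀ i (hi : i < l.length) a, act l[i] a = some false →  (ρ a (k + i)).2 ≤ pr)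
    (h₃ : ∀ i (hi : i < l.length) a, act l[i] a = some true →  ¬ (ρ a (k + i)).2 ≤ pr)
    (x : List (Option (Fin σ))) :
    hashScan pa pr ρ l.length k x = scanBy act l x := by
  induction l generalizing k x with
  | nil => cases x <;> simp [hashScan, scanBy]
  | cons z l ih =>
    cases x with
    | nil => simp [hashScan, scanBy]
    | cons a x =>
      have hs : ∀ i, k + 1 + i = k + (i + 1) := fun i => by omega
      have ih' := ih (k + 1) (fun i hi b => by
        rw [hs]; exact h₁ (i + 1) (Nat.succ_lt_succ hi) b)
        (fun i hi b => by
        rw [hs]; exact h₂ (i + 1) (Nat.succ_lt_succ hi) b)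
        (fun i hi b => by
        rw [hs]; exact h₃ (i + 1) (Nat.succ_lt_succ hi) b)
      have g₁ := h₁ 0 (by simp) a
      have g₂ := h₂ 0 (by simp) a
      have g₃ := h₃ 0 (by simp) a
      simp only [List.getElem_cons_zero, Nat.add_zero] at g₁ g₂ g₃
      rw [List.length_cons, hashScan, ih', ih']
      rcases cases_act act z a with hz | hz | hz
      · rw [if_pos (g₁.mp hz)]; simp [scanBy, hz]
      · rw [if_neg (by rw [← g₁, hz]; simp), if_pos (g₂ hz)]; simp [scanBy, hz]
      · rw [if_neg (by rw [← g₁, hz]; simp), if_neg (g₃ hz)]; simp [scanBy, hz]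

namespace WordRAM

open Inst

/-- Code of an output character. -/
def outCode {χ : Type} (code : χ → ℕ) : Option χ → ℕ
  | none => 1
  | some a => code a + 2

theorem outCode_injective {χ : Type} {code : χ → ℕ} (h : Function.Injective code) :
    Function.Injective (outCode code) := by
  rintro (_ | a) (_ | b) hab <;> simp only [outCode] at hab
  · rfl
  · omega
  · omega
  · rw [h (by omega : code a = code b)]

theorem outCode_ne_zero {χ : Type} {code : χ → ℕ} (a : Option χ) : outCode code a ≠ 0 := by
  cases a <;> simp [outCode]

/-- The machine pads the hash to length `ℓ` with `0`, which codes no output character. Removing the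
zeros recovers the hash, so keys collide exactly when hashes do. -/
theorem Inst.scan_eq_scanBy {X χ : Type} (I : Inst) (j : ℕ) {code : χ → ℕ}
    {act : X → χ → Option Bool} (l : List X) (k : ℕ)
    (h : ∀ i (hi : i < l.length) a, act l[i] a =
      if I.value j (4 * (k + i)) (code a) < I.ta then none
      else if I.value j (4 * (k + i) + 2) (code a) < I.tr then some false else some true)
    (x : List χ) :
    I.scan j l.length k (x.map code) = (scanBy act l x).map (outCode code) ++
      List.replicate (l.length - (scanBy act l x).length) 0 := by
  induction l generalizing k x with
  | nil => cases x <;> simp [Inst.scan, scanBy]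
  | cons z l ih =>
    have hs : ∀ i, k + 1 + i = k + (i + 1) := fun i => by omega
    have ih' := ih (k + 1) (fun i hi b => by
        rw [hs]; exact h (i + 1) (Nat.succ_lt_succ hi) b)
    cases x with
    | nil =>
      have := ih' []
      have hnil : scanBy act l ([] : List χ) = [] := by cases l <;> rfl
      rw [hnil] at this
      simp only [List.map_nil, List.length_nil, List.nil_append, Nat.sub_zero] at this
      simp [Inst.scan, scanBy, this, List.replicate_succ]
    | cons a x =>
      have g := h 0 (by simp) a
      simp only [List.getElem_cons_zero, Nat.add_zero] at g
      have ih₁ := ih' (a :: x)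
      have ih₂ := ih' x
      rw [List.map_cons] at ih₁
      rw [List.map_cons, List.length_cons, Inst.scan, Inst.step]
      split_ifs at g ⊢ <;> simp_all [scanBy, outCode]

theorem Inst.scan_eq_scan_iff {X χ : Type} (I : Inst) (j : ℕ) {code : χ → ℕ}
    (hcode : Function.Injective code) {act : X → χ → Option Bool} (l : List X)
    (h : ∀ i (hi : i < l.length) a, act l[i] a =
      if I.value j (4 * i) (code a) < I.ta then none
      else if I.value j (4 * i + 2) (code a) < I.tr then some false else some true)
    (x y : List χ) :
    I.scan j l.length 0 (x.map code) = I.scan j l.length 0 (y.map code) ↔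
      scanBy act l x = scanBy act l y := by
  have h' := I.scan_eq_scanBy j (code := code) (act := act) l 0 (by simpa using h)
  have hf : ∀ x, (I.scan j l.length 0 (x.map code)).filter (· ≠ 0) =
      (scanBy act l x).map (outCode code) := by
    intro x
    rw [h', List.filter_append, List.filter_eq_self.mpr, List.filter_eq_nil_iff.mpr,
      List.append_nil]
    · intro a ha; simp [List.eq_of_mem_replicate ha]
    · intro a ha
      obtain ⟨b, _, rfl⟩ := List.mem_map.mp ha
      simp [outCode_ne_zero]
  constructor
  · intro e
    refine (outCode_injective hcode).list_map ?_
    rw [← hf, ← hf, e]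
  · intro e
    rw [h', h', e]

theorem Inst.lexKey_eq_iff (I : Inst) (j : ℕ) (x y : List ℕ) :
    I.lexKey j x = I.lexKey j y ↔ I.key j x = I.key j y := by
  refine ⟨fun h => ?_, fun h => by rw [Inst.lexKey, Inst.lexKey, h]⟩
  refine List.ext_getElem (by rw [I.length_key, I.length_key]) fun i h₁ h₂ => ?_
  rw [I.length_key] at h₁
  have := congrFun (toLex.injective h) ⟨i, h₁⟩
  simpa [List.getD_eq_getElem, I.length_key, h₁] using this

end WordRAM

end Scan

/-! ## The parameters of the hash -/

section Parameters

theorem hashPa_sq {p : ℝ} (hp : 0 < p) : hashPa p ^ 2 = p / (1 + p) :=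
  Real.sq_sqrt (by positivity)

theorem hashPa_nonneg (p : ℝ) : 0 ≤ hashPa p := Real.sqrt_nonneg _

theorem hashPa_le_half {p : ℝ} (hp : 0 < p) (hp3 : p ≤ 1 / 3) : hashPa p ≤ 1 / 2 := by
  refine abs_le_of_sq_le_sq' ?_ (by norm_num) |>.2
  rw [hashPa_sq hp, div_le_iff₀ (by linarith)]
  linarith

theorem le_hashPa {p : ℝ} (hp : 0 < p) (hp3 : p ≤ 1 / 3) : p ≤ hashPa p := by
  refine Real.le_sqrt_of_sq_le ?_
  rw [le_div_iff₀ (by linarith)]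
  nlinarith [mul_pos hp hp]

/-- Staying and skipping have the same probability. Together with `hashPa_sq`, which gives `p_a² /
(1 - p_a²) = p`, this is the reason for the choice of `p_a` and `p_r`. -/
theorem one_sub_hashPa_mul_hashPr {p : ℝ} (hp : 0 < p) :
    (1 - hashPa p) * hashPr p = hashPa p := by
  have h : √p < √(1 + p) := Real.sqrt_lt_sqrt hp.le (by linarith)
  have h0 : 0 ≤ √p := Real.sqrt_nonneg p
  have h₁ : √(1 + p) ≠ 0 := by linarith
  have h₂ : √(1 + p) - √p ≠ 0 := by linarith
  rw [hashPa, hashPr, Real.sqrt_div hp.le]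
  field_simp

theorem hashPr_nonneg (p : ℝ) : 0 ≤ hashPr p :=
  div_nonneg (Real.sqrt_nonneg _)
    (sub_nonneg.mpr (Real.sqrt_le_sqrt (by linarith)))

theorem hashPr_le {p : ℝ} (hp : 0 < p) (hp3 : p ≤ 1 / 3) : hashPr p ≤ 2 * hashPa p := by
  have h := one_sub_hashPa_mul_hashPr hp
  have h' := hashPa_le_half hp hp3
  have := mul_le_mul_of_nonneg_right (show 1 / 2 ≤ 1 - hashPa p by linarith) (hashPr_nonneg p)
  linarith

section

variable {n r : ℕ} {c : ℝ}

theorem one_le_ncr (hn : 1 ≤ n) (hr : 1 ≤ r) (hc : 1 ≤ c) : 1 ≤ (n : ℝ) * c * r := by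
  have h₁ : (1 : ℝ) ≤ n := by exact_mod_cast hn
  have h₂ : (1 : ℝ) ≤ r := by exact_mod_cast hr
  exact one_le_mul_of_one_le_of_one_le (one_le_mul_of_one_le_of_one_le h₁ hc) h₂

theorem one_le_cr (hr : 1 ≤ r) (hc : 1 ≤ c) : 1 ≤ c * r :=
  one_le_mul_of_one_le_of_one_le hc (by exact_mod_cast hr)

theorem hashP_pos (hn : 1 ≤ n) (hr : 1 ≤ r) (hc : 1 ≤ c) : 0 < hashP n r c := by
  have := one_le_ncr hn hr hc
  unfold hashP
  positivity

theorem hashP_le (hn : 1 ≤ n) (hr : 1 ≤ r) (hc : 1 ≤ c) : hashP n r c ≤ 1 / 3 := by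
  have h := one_le_cr hr hc
  have := Real.one_le_rpow (one_le_ncr hn hr hc) (z := 1 / (c * r)) (by positivity)
  unfold hashP
  exact one_div_le_one_div_of_le (by norm_num) (by linarith)

/-- Here `n ^ (1/(cr)) ≤ n`, and `(cr) ^ (1/(cr)) ≤ e ≤ 3` since `log (cr) ≤ cr`. The bound shows
that a grid of size `O(dn + σ)` resolves `p`. -/
theorem le_hashP (hn : 1 ≤ n) (hr : 1 ≤ r) (hc : 1 ≤ c) : 1 / (9 * n : ℝ) ≤ hashP n r c := by
  have h := one_le_cr hr hc
  have hn' : (1 : ℝ) ≤ n := by exact_mod_cast hn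
  have h₁ : ((n : ℝ) * c * r) ^ (1 / (c * r)) ≤ 3 * n := by
    rw [mul_assoc, Real.mul_rpow (by positivity) (by positivity), mul_comm (3 : ℝ)]
    refine mul_le_mul ?_ ?_ (by positivity) (by positivity)
    · refine (Real.rpow_le_rpow_of_exponent_le hn' ?_).trans_eq (Real.rpow_one _)
      rw [div_le_one (by positivity)]; exact h
    · rw [Real.rpow_def_of_pos (by positivity)]
      refine (Real.exp_le_exp.mpr ?_).trans (Real.exp_one_lt_d9.le.trans (by norm_num))
      rw [mul_one_div, div_le_one (by positivity)]
      exact (Real.log_le_sub_one_of_pos (by positivity)).trans (by linarith)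
  unfold hashP
  have := Real.rpow_pos_of_pos (by linarith [one_le_ncr hn hr hc] : 0 < (n : ℝ) * c * r)
    (1 / (c * r))
  exact one_div_le_one_div_of_le (by positivity) (by linarith)

theorem three_mul_hashP_rpow (hn : 1 ≤ n) (hr : 1 ≤ r) (hc : 1 ≤ c) :
    (3 * hashP n r c) ^ (c * r : ℝ) = 1 / (n * c * r) := by
  have h := one_le_cr hr hc
  have h₁ := one_le_ncr hn hr hc
  have e : 3 * hashP n r c = (((n : ℝ) * c * r) ^ (1 / (c * r)))⁻¹ := by
    unfold hashP; field_simp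
  rw [e, Real.inv_rpow (by positivity), ← Real.rpow_mul (by positivity),
    one_div_mul_cancel (by positivity), Real.rpow_one, one_div]

theorem hashP_pow (hn : 1 ≤ n) (hr : 1 ≤ r) (hc : 1 ≤ c) :
    hashP n r c ^ r = 1 / (3 ^ r * ((n : ℝ) * c * r) ^ (1 / c)) := by
  have h₁ := one_le_ncr hn hr hc
  have hr' : (1 : ℝ) ≤ r := by exact_mod_cast hr
  rw [hashP, div_pow, one_pow, mul_pow, ← Real.rpow_natCast (_ ^ (1 / (c * (r : ℝ)))),
    ← Real.rpow_mul (by positivity), show 1 / (c * r) * r = 1 / c by field_simp]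

end

/-- Bounds on the law of the choices when the thresholds are rounded to a grid. -/
structure NearLaw (p : ℝ) (P : ℕ) (q₁ q₂ : ℝ) : Prop where
  pos : 0 < p
  le_third : p ≤ 1 / 3
  le_q₁ : hashPa p ≤ q₁
  q₁_le : q₁ ≤ hashPa p + 1 / P
  le_q₂ : hashPa p * (1 - 2 / P) ≤ q₂
  q₂_le : q₂ ≤ hashPa p + 1 / P
  add_le : q₁ + q₂ ≤ 1

namespace NearLaw

variable {p : ℝ} {P : ℕ} {q₁ q₂ : ℝ} (h : NearLaw p P q₁ q₂)
include h

/-- Without rounding both products equal `p_a² = p (1 - p_a²)`. With it, `q₁` and `q₂` are at least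
`p_a (1 - 2/P)`, and `(1 - 2/P)² ≥ 1 - 4/P`. -/
theorem lower (hP : 4 ≤ P) : p * (1 - 4 / P) * (1 - q₁ ^ 2) ≤ q₁ * q₂ ∧
    p * (1 - 4 / P) * (1 - q₁ ^ 2) ≤ q₂ ^ 2 := by
  have hp := h.pos
  have hP' : (4 : ℝ) ≤ P := by exact_mod_cast hP
  have h4 : (4 : ℝ) / P ≤ 1 := by rw [div_le_one (by linarith)]; exact hP'
  obtain ⟨e, he⟩ : ∃ e : ℝ, e = 1 / P := ⟨_, rfl⟩
  have e4 : (4 : ℝ) / P = 4 * e := by rw [he]; ring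
  have e2 : (2 : ℝ) / P = 2 * e := by rw [he]; ring
  have he0 : 0 ≤ e := by rw [he]; positivity
  have l₂ := h.le_q₂
  rw [e4] at h4 ⊢
  rw [e2] at l₂
  have ha := hashPa_nonneg p
  have l₁ := h.le_q₁
  have l₁' : hashPa p * (1 - 2 * e) ≤ q₁ := by nlinarith
  have ha' : 0 ≤ hashPa p * (1 - 2 * e) := mul_nonneg ha (by linarith)
  have key : p * (1 - 4 * e) * (1 - q₁ ^ 2) ≤ (hashPa p * (1 - 2 * e)) ^ 2 := by
    have s₁ : hashPa p ^ 2 ≤ q₁ ^ 2 := pow_le_pow_left₀ ha l₁ 2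
    have s₂ : 1 - hashPa p ^ 2 = 1 / (1 + p) := by rw [hashPa_sq hp]; field_simp; ring
    have s₃ : p * (1 - 4 * e) * (1 - q₁ ^ 2) ≤ p * (1 - 4 * e) * (1 / (1 + p)) :=
      mul_le_mul_of_nonneg_left (by linarith) (mul_nonneg hp.le (by linarith))
    have s₄ : p * (1 - 4 * e) * (1 / (1 + p)) = hashPa p ^ 2 * (1 - 4 * e) := by
      rw [hashPa_sq hp]; ring
    rw [s₄] at s₃
    have := mul_nonneg (sq_nonneg (hashPa p)) (sq_nonneg e)
    nlinarith
  constructor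
  · exact key.trans (by rw [sq]; exact mul_le_mul l₁' l₂ ha' (ha'.trans l₁'))
  · exact key.trans (pow_le_pow_left₀ ha' l₂ 2)

/-- Without rounding the left side is `3 p_a² = 3p (1 - p_a²)`. The minimum with `1` provides the
hypothesis `t ≤ 1` of `collide_le`; that half is `(q₁ + q₂)² ≤ 1`. -/
theorem upper (hq₁ : 0 ≤ q₁) (hq₂ : 0 ≤ q₂) {k : ℝ} (hk : 0 < k) (hP : 0 < P) (hk1 : k ≤ 1)
    (hkP : 5 ≤ k * (P * hashPa p)) :
    2 * (q₁ * q₂) + q₂ ^ 2 ≤ min 1 (3 * p * (1 + k)) * (1 - q₁ ^ 2) := by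
  have hp := h.pos
  have hp3 := h.le_third
  have hP' : (0 : ℝ) < P := by exact_mod_cast hP
  have h1 : 2 * (q₁ * q₂) + q₂ ^ 2 ≤ 1 - q₁ ^ 2 := by
    have := h.add_le
    nlinarith
  rcases min_choice 1 (3 * p * (1 + k)) with hm | hm <;> rw [hm]
  · linarith
  have ha : 0 < hashPa p := hp.trans_le (le_hashPa hp hp3)
  -- By `hkP` the rounding error `1/P` is at most a fraction `k/5` of `p_a`, so `m` bounds both
  -- probabilities.
  obtain ⟨m, hm⟩ : ∃ m : ℝ, m = hashPa p * (1 + k / 5) := ⟨_, rfl⟩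
  have hPm : hashPa p + 1 / P ≤ m := by
    have : 1 / (P : ℝ) ≤ hashPa p * (k / 5) := by
      rw [div_le_iff₀ hP']; linarith
    rw [hm]; linarith
  have m₁ : q₁ ≤ m := h.q₁_le.trans hPm
  have m₂ : q₂ ≤ m := h.q₂_le.trans hPm
  have b₁ : 2 * (q₁ * q₂) + q₂ ^ 2 ≤ 3 * m ^ 2 := by nlinarith [mul_le_mul m₁ m₂ hq₂ (hq₁.trans m₁)]
  have b₂ : q₁ ^ 2 ≤ m ^ 2 := pow_le_pow_left₀ hq₁ m₁ 2
  have b₃ : 3 * m ^ 2 ≤ 3 * p * (1 + k) * (1 - m ^ 2) := by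
    rw [hm, mul_pow, hashPa_sq hp]
    have hp1 : 0 < 1 + p := by linarith
    have : (1 + k / 5) ^ 2 ≤ (1 + k) * (1 + p - p * (1 + k / 5) ^ 2) := by
      have g : p * ((1 + k / 5) ^ 2 - 1) ≤ 1 / 3 * ((1 + k / 5) ^ 2 - 1) :=
        mul_le_mul_of_nonneg_right hp3 (by nlinarith)
      nlinarith [mul_le_mul_of_nonneg_left g (show 0 ≤ 1 + k by linarith), mul_pos hk hk,
        mul_nonneg (mul_pos hk hk).le (sub_nonneg.mpr hk1)]
    have e₁ : 3 * (p / (1 + p) * (1 + k / 5) ^ 2) = 3 * p * (1 + k / 5) ^ 2 / (1 + p) := by ring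
    have e₂ : 3 * p * (1 + k) * (1 - p / (1 + p) * (1 + k / 5) ^ 2) =
        3 * p * ((1 + k) * (1 + p - p * (1 + k / 5) ^ 2)) / (1 + p) := by field_simp
    rw [e₁, e₂]
    gcongr
  have b₄ := mul_le_mul_of_nonneg_left b₂ (show 0 ≤ 3 * p * (1 + k) by positivity)
  linarith

end NearLaw

/-- Threshold for the first value. -/
noncomputable def floorPa (p : ℝ) (P : ℕ) : ℕ := ⌊hashPa p * P⌋₊ + 1

/-- Threshold for the second value. -/
noncomputable def floorPr (p : ℝ) (P : ℕ) : ℕ := min (⌊hashPr p * P⌋₊ + 1) P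

variable {p : ℝ} {P : ℕ}

/-- On grid points the integer test of the machine agrees exactly with the real one; the `+ 1`
reflects that the real test is not strict. -/
theorem lt_floorPa_iff (hP : 0 < P) (j : ℕ) : j < floorPa p P ↔ (j : ℝ) / P ≤ hashPa p := by
  have hP' : (0 : ℝ) < P := by exact_mod_cast hP
  rw [floorPa, Nat.lt_succ_iff, Nat.le_floor_iff (mul_nonneg (hashPa_nonneg p) hP'.le),
    div_le_iff₀ hP']

/-- For `p = 1/3` one has `p_r = 1`, and `⌊p_r P⌋ + 1` would exceed `P`. Capping the threshold at
`P` does not affect indices below `P`. -/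
theorem lt_floorPr_iff {j : ℕ} (hj : j < P) :
    j < floorPr p P ↔ (j : ℝ) / P ≤ hashPr p := by
  have hP' : (0 : ℝ) < P := by exact_mod_cast (Nat.zero_le j).trans_lt hj
  rw [floorPr, lt_min_iff, Nat.lt_succ_iff,
    Nat.le_floor_iff (mul_nonneg (hashPr_nonneg p) hP'.le), div_le_iff₀ hP']
  simp [hj]

theorem floorPr_le : floorPr p P ≤ P := min_le_right _ _

theorem floorPa_le (hp : 0 < p) (hp3 : p ≤ 1 / 3) (hP : 2 ≤ P) : floorPa p P ≤ P := by
  have h := hashPa_le_half hp hp3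
  have hP' : (2 : ℝ) ≤ P := by exact_mod_cast hP
  have : ⌊hashPa p * P⌋₊ < P := by
    rw [Nat.floor_lt (mul_nonneg (hashPa_nonneg p) (by linarith))]
    nlinarith
  rw [floorPa]
  omega

/-- The first threshold only rounds up, by at most `1/P`; the second, capped at `P`, still has ratio
between `p_r` and `p_r + 1/P`. Rounding the first up lowers the probability of skipping by at most
`p_r / P ≤ 2 p_a / P`. -/
theorem nearLaw_choiceLaw (hp : 0 < p) (hp3 : p ≤ 1 / 3) (hP : 2 ≤ P) :
    NearLaw p P (choiceLaw P (floorPa p P) (floorPr p P) none)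
      (choiceLaw P (floorPa p P) (floorPr p P) (some false)) := by
  have hP' : (2 : ℝ) ≤ P := by exact_mod_cast hP
  have hP0 : (0 : ℝ) < P := by linarith
  have ha0 := hashPa_nonneg p
  have hr0 := hashPr_nonneg p
  have ha := hashPa_le_half hp hp3
  have har := one_sub_hashPa_mul_hashPr hp
  have hr := hashPr_le hp hp3
  have a₁ : hashPa p ≤ (floorPa p P : ℝ) / P := by
    rw [le_div_iff₀ hP0, floorPa]; push_cast; exact (Nat.lt_floor_add_one _).le
  have a₂ : (floorPa p P : ℝ) / P ≤ hashPa p + 1 / P := by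
    rw [div_le_iff₀ hP0, floorPa, add_mul, one_div_mul_cancel hP0.ne']
    push_cast
    have := Nat.floor_le (mul_nonneg ha0 hP0.le)
    linarith
  have a₃ : (floorPa p P : ℝ) / P ≤ 1 := by
    rw [div_le_one hP0]; exact_mod_cast floorPa_le hp hp3 hP
  have r₁ : hashPr p ≤ (floorPr p P : ℝ) / P := by
    rw [le_div_iff₀ hP0, floorPr]; push_cast
    refine le_min (Nat.lt_floor_add_one _).le ?_
    nlinarith
  have r₂ : (floorPr p P : ℝ) / P ≤ hashPr p + 1 / P := by
    rw [div_le_iff₀ hP0, floorPr, add_mul, one_div_mul_cancel hP0.ne']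
    push_cast
    have := Nat.floor_le (mul_nonneg hr0 hP0.le)
    exact (min_le_left _ _).trans (by linarith)
  have r₃ : (floorPr p P : ℝ) / P ≤ 1 := by
    rw [div_le_one hP0]; exact_mod_cast floorPr_le
  have e : (2 : ℝ) / P = 2 * (1 / P) := by ring
  have hP1 : 0 < 1 / (P : ℝ) := by positivity
  refine ⟨hp, hp3, a₁, a₂, ?_, ?_, ?_⟩ <;> simp only [choiceLaw]
  · have := mul_le_mul_of_nonneg_left r₁ (sub_nonneg.mpr a₃)
    have := mul_le_mul_of_nonneg_right a₂ hr0
    have := mul_le_mul_of_nonneg_right hr hP1.le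
    rw [e]
    linarith
  · have := mul_le_mul_of_nonneg_left r₂ (sub_nonneg.mpr a₃)
    have := mul_le_mul_of_nonneg_right a₁ (show 0 ≤ hashPr p + 1 / P by positivity)
    have := mul_nonneg ha0 hP1.le
    linarith
  · have := mul_le_mul_of_nonneg_left r₃ (sub_nonneg.mpr a₃)
    linarith

end Parameters

/-! ## The hash family -/

section Family

variable {P : ℕ} [Fact P.Prime] {σ n d r : ℕ} {p c : ℝ}

/-- Code of an input character. -/
def charCode (σ : ℕ) (a : Option (Fin σ)) : ℕ := a.elim σ Fin.val

theorem charCode_le (a : Option (Fin σ)) : charCode σ a ≤ σ := by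
  cases a with
  | none => exact le_rfl
  | some a => exact a.isLt.le

theorem charCode_injective : Function.Injective (charCode σ) := by
  rintro (_ | a) (_ | b) h <;> simp only [charCode, Option.elim] at h
  · rfl
  · exact absurd h.symm b.isLt.ne
  · exact absurd h a.isLt.ne
  · rw [Fin.ext h]

theorem cast_charCode_injective (h : σ < P) :
    Function.Injective fun a : Option (Fin σ) => (charCode σ a : ZMod P) := by
  intro a b hab
  refine charCode_injective ?_
  have := (ZMod.natCast_eq_natCast_iff' _ _ _).mp hab
  rwa [Nat.mod_eq_of_lt ((charCode_le a).trans_lt h),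
    Nat.mod_eq_of_lt ((charCode_le b).trans_lt h)] at this

/-- The pair of grid indices at a character. -/
def slotIndex (z : Slot P) (a : Option (Fin σ)) : Fin P × Fin P :=
  (⟨(slotValue z (charCode σ a)).1.val, ZMod.val_lt _⟩,
    ⟨(slotValue z (charCode σ a)).2.val, ZMod.val_lt _⟩)

/-- The underlying function determined by the choices at the first `ℓ` positions. -/
def slotRnd {ℓ : ℕ} (f : Fin ℓ → Slot P) (a : Option (Fin σ)) (k : ℕ) : Fin P × Fin P :=
  if h : k < ℓ then slotIndex (f ⟨k, h⟩) a
  else (⟨0, (Fact.out : P.Prime).pos⟩, ⟨0, (Fact.out : P.Prime).pos⟩)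

theorem slotIndex_pair_bijective (h : σ < P) {a b : Option (Fin σ)} (hab : a ≠ b) :
    Function.Bijective fun z : Slot P => (slotIndex z a, slotIndex z b) := by
  rw [Fintype.bijective_iff_injective_and_card]
  refine ⟨fun z z' e => ?_, by simp [ZMod.card]⟩
  refine (slotValue_pair_bijective ((cast_charCode_injective h).ne hab)).injective ?_
  simp only [slotIndex, Prod.mk.injEq, Fin.mk.injEq] at e
  have hv := ZMod.val_injective P
  exact Prod.ext (Prod.ext (hv e.1.1) (hv e.1.2)) (Prod.ext (hv e.2.1) (hv e.2.2))

/-- At every position the two prescribed pairs determine the four coefficients, so exactly one of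
the `P ^ (4ℓ)` functions satisfies the event. -/
theorem prob_slotRnd_eq {ℓ : ℕ} (h : σ < P) (a b : ℕ → Option (Fin σ)) (hab : ∀ k, a k ≠ b k)
    (u v : ℕ → Fin P × Fin P) :
    prob (fun f : Fin ℓ → Slot P => ∀ k < ℓ, slotRnd f (a k) k = u k ∧ slotRnd f (b k) k = v k) =
      (1 / (P : ℝ)) ^ (4 * ℓ) := by
  have hex : ∀ k : Fin ℓ, ∃ z : Slot P, slotIndex z (a k) = u k ∧ slotIndex z (b k) = v k := by
    intro k
    obtain ⟨z, hz⟩ := (slotIndex_pair_bijective h (hab k)).surjective (u k, v k)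
    exact ⟨z, (Prod.mk.inj hz).1, (Prod.mk.inj hz).2⟩
  choose z hz using hex
  have hu : ∀ f : Fin ℓ → Slot P,
      (∀ k < ℓ, slotRnd f (a k) k = u k ∧ slotRnd f (b k) k = v k) ↔ f = z := by
    intro f
    constructor
    · intro hf
      funext k
      refine (slotIndex_pair_bijective h (hab k)).injective ?_
      have := hf k k.isLt
      simp only [slotRnd, k.isLt, dif_pos] at this
      exact Prod.ext (this.1.trans (hz k).1.symm) (this.2.trans (hz k).2.symm)
    · rintro rfl k hk
      simp only [slotRnd, hk, dif_pos]
      exact hz ⟨k, hk⟩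
  simp only [prob, hu, Nat.card_unique, Nat.cast_one, Fintype.card_fun, Fintype.card_fin,
    card_slot]
  rw [← pow_mul]
  push_cast
  rw [one_div, one_div, inv_pow]

/-- The choice of the scan at a character. -/
noncomputable def slotAct (p : ℝ) (z : Slot P) (a : Option (Fin σ)) : Option Bool :=
  choose (floorPa p P) (floorPr p P) (slotValue z (charCode σ a))

/-- The pair of values in `[0,1)` of the underlying function. -/
noncomputable def slotRho {ℓ : ℕ} (f : Fin ℓ → Slot P) (a : Option (Fin σ)) (k : ℕ) : ℝ × ℝ :=
  (((slotRnd f a k).1 : ℕ) / P, ((slotRnd f a k).2 : ℕ) / P)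

theorem hashScan_slotRho {ℓ : ℕ} (f : Fin ℓ → Slot P)
    (x : List (Option (Fin σ))) :
    hashScan (hashPa p) (hashPr p) (slotRho f) ℓ 0 x = scanBy (slotAct p) (List.ofFn f) x := by
  have hP : 0 < P := (Fact.out : P.Prime).pos
  have key : ∀ i (hi : i < ℓ) (a : Option (Fin σ)), slotAct p (f ⟨i, hi⟩) a =
      if (slotRho f a i).1 ≤ hashPa p then none
      else if (slotRho f a i).2 ≤ hashPr p then some false else some true := by
    intro i hi a
    simp only [slotAct, choose, slotRho, slotRnd, hi, dif_pos, slotIndex, ← lt_floorPa_iff hP,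
      ← lt_floorPr_iff (ZMod.val_lt _)]
  have := hashScan_eq_scanBy (pa := hashPa p) (pr := hashPr p) (ρ := slotRho f)
    (act := slotAct p) (List.ofFn f) 0 ?_ ?_ ?_ x
  · rwa [List.length_ofFn] at this
  all_goals
    intro i hi a
    rw [List.length_ofFn] at hi
    rw [List.getElem_ofFn, key i hi a, Nat.zero_add]
    split_ifs <;> simp_all

theorem prob_editHash_eq (x y : List (Fin σ)) :
    prob (fun f : Fin (hashLen n d p) → Slot P =>
      editHash n d p (slotRho f) x = editHash n d p (slotRho f) y) =
    collide (slotAct (P := P) p) (hashLen n d p) (marked x) (marked y) := by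
  simp only [collide_eq_prob, editHash, hashScan_slotRho, marked]

/-- The loss by rounding is `(1 - 4/P) ^ lev` with `lev ≤ d` and `4/P ≤ 1/(2d)`, which is at least
`1/2` by Bernoulli's inequality. -/
theorem half_pow_le_prob (hp : 0 < p) (hp3 : p ≤ 1 / 3) (hσ : σ < P) (hP : 8 * d ≤ P)
    (hd : 1 ≤ d) {x y : List (Fin σ)} (hx : x.length ≤ d) (hy : y.length ≤ d)
    (hxy : lev x y ≤ r) :
    p ^ r / 2 ≤ prob (fun f : Fin (hashLen n d p) → Slot P =>
      editHash n d p (slotRho f) x = editHash n d p (slotRho f) y) := by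
  have hN := nearLaw_choiceLaw (P := P) hp hp3 (by omega)
  have hL := pairwiseLaw_choose (cast_charCode_injective (σ := σ) hσ)
    (floorPa_le hp hp3 (by omega)) (floorPr_le (p := p) (P := P))
  obtain ⟨h₁, h₂⟩ := hN.lower (by omega)
  have hP' : 8 * (d : ℝ) ≤ P := by exact_mod_cast hP
  have hd' : (1 : ℝ) ≤ d := by exact_mod_cast hd
  have h4 : 4 / (P : ℝ) ≤ 1 / (2 * d) := by
    rw [div_le_div_iff₀ (by linarith) (by linarith)]; linarith
  have h40 : 0 ≤ 4 / (P : ℝ) := by positivity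
  have hd2 : 1 / (2 * (d : ℝ)) ≤ 1 := by rw [div_le_one (by linarith)]; linarith
  have hl : (lev x y : ℝ) ≤ d := by
    have := lev_le_max x y
    exact_mod_cast this.trans (max_le hx hy)
  rw [prob_editHash_eq]
  refine le_trans ?_ (pow_lev_le_collide hL (mul_nonneg hp.le (by linarith)) h₁ h₂ _ x y
    (mul_le_one₀ (by linarith) (by linarith) (by linarith)))
  rw [mul_pow, div_eq_mul_one_div]
  refine mul_le_mul (pow_le_pow_of_le_one hp.le (by linarith) hxy) ?_ (by norm_num)
    (pow_nonneg hp.le _)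
  have hb := one_add_mul_le_pow (a := -(4 / (P : ℝ))) (by linarith) (lev x y)
  rw [← sub_eq_add_neg] at hb
  refine le_trans ?_ hb
  have h5 : (lev x y : ℝ) * (4 / P) ≤ d * (1 / (2 * d)) := mul_le_mul hl h4 h40 (by linarith)
  have h6 : (d : ℝ) * (1 / (2 * d)) = 1 / 2 := by field_simp
  linarith

/-- Rounding costs `(1 + 1/d) ^ d ≤ e ≤ 3`. The length of the hash is chosen so that the cut-off
term is at most `3 e^{2d} · e^{-5d} / n`, hence at most `3 / (nd)`. -/
theorem prob_le (hp : 0 < p) (hp3 : p ≤ 1 / 3) (hn : 1 ≤ n) (hσ : σ < P) (hP : 40 * d ≤ P)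
    (hd : 1 ≤ d) (hPp : 5 * d ≤ P * p) {x y : List (Fin σ)} (hx : x.length ≤ d)
    (hy : y.length ≤ d) :
    prob (fun f : Fin (hashLen n d p) → Slot P =>
      editHash n d p (slotRho f) x = editHash n d p (slotRho f) y) ≤
    3 * (3 * p) ^ lev x y + 3 / (n * d) := by
  have hN := nearLaw_choiceLaw (P := P) hp hp3 (by omega)
  have hL := pairwiseLaw_choose (cast_charCode_injective (σ := σ) hσ)
    (floorPa_le hp hp3 (by omega)) (floorPr_le (p := p) (P := P))
  have hP40 : 40 * (d : ℝ) ≤ P := by exact_mod_cast hP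
  have hd' : (1 : ℝ) ≤ d := by exact_mod_cast hd
  have hn' : (1 : ℝ) ≤ n := by exact_mod_cast hn
  have hP0 : (0 : ℝ) < P := by linarith
  have ha := le_hashPa hp hp3
  have ha2 := hashPa_le_half hp hp3
  have hl : (lev x y : ℝ) ≤ d := by
    have := lev_le_max x y
    exact_mod_cast this.trans (max_le hx hy)
  have hu := hN.upper (hL.nonneg _) (hL.nonneg _) (k := 1 / d) (by positivity) (by omega)
    (by rw [div_le_one (by linarith)]; exact hd') (by
      rw [one_div_mul_eq_div, le_div_iff₀ (by linarith)]
      exact hPp.trans (mul_le_mul_of_nonneg_left ha hP0.le))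
  set q := choiceLaw P (floorPa p P) (floorPr p P) none with hq
  have hq1 := hN.q₁_le
  have hq0 : 0 ≤ q := hL.nonneg _
  rw [prob_editHash_eq]
  have ht0 : (0 : ℝ) ≤ 3 * p * (1 + 1 / d) := by positivity
  refine (collide_le hL (le_min zero_le_one ht0) (min_le_left _ _) hu rfl _ x y).trans ?_
  refine add_le_add ?_ ?_
  · refine (pow_le_pow_left₀ (le_min zero_le_one ht0) (min_le_right _ _) _).trans ?_
    rw [mul_pow, mul_comm]
    refine mul_le_mul_of_nonneg_right ?_ (by positivity)
    calc (1 + 1 / (d : ℝ)) ^ lev x y ≤ Real.exp (1 / d) ^ lev x y :=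
          pow_le_pow_left₀ (by positivity) (by linarith [Real.add_one_le_exp (1 / (d : ℝ))]) _
      _ = Real.exp (lev x y * (1 / d)) := (Real.exp_nat_mul _ _).symm
      _ ≤ Real.exp 1 := by
          refine Real.exp_le_exp.mpr ?_
          rw [mul_one_div, div_le_one (by linarith)]; exact hl
      _ ≤ 3 := Real.exp_one_lt_d9.le.trans (by norm_num)
  · have hlen : 8 * (d : ℝ) / (1 - hashPa p) + 6 * Real.log n ≤ hashLen n d p := Nat.le_ceil _
    set ℓ := hashLen n d p
    have hlog : 0 ≤ Real.log n := Real.log_nonneg hn'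
    have hPi : 1 / (P : ℝ) ≤ 1 / 40 := one_div_le_one_div_of_le (by norm_num) (by linarith)
    have hq' : 19 / 20 * (1 - hashPa p) ≤ 1 - q := by linarith
    have h₁ : 8 * (d : ℝ) + 3 * Real.log n ≤ (1 - hashPa p) * ℓ := by
      have e : (1 - hashPa p) * (8 * (d : ℝ) / (1 - hashPa p) + 6 * Real.log n) =
          8 * d + 6 * (1 - hashPa p) * Real.log n := by
        have : 1 - hashPa p ≠ 0 := by linarith
        field_simp
      have := mul_le_mul_of_nonneg_left hlen (show 0 ≤ 1 - hashPa p by linarith)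
      rw [e] at this
      have := mul_nonneg (show 0 ≤ 1 - 2 * hashPa p by linarith) hlog
      linarith
    -- The base of the cut-off term is `q + (1 - q)/3 = 1 - (2/3)(1 - q) ≤ exp (-(2/3)(1 - q))`.
    have h₂ : 5 * (d : ℝ) + Real.log n ≤ ℓ * (2 / 3 * (1 - q)) := by
      have := mul_le_mul_of_nonneg_right hq' (Nat.cast_nonneg (α := ℝ) ℓ)
      linarith
    have h₃ : (q + (1 - q) / 3) ^ ℓ ≤ Real.exp (-(5 * d + Real.log n)) := by
      calc (q + (1 - q) / 3) ^ ℓ ≤ Real.exp (-(2 / 3 * (1 - q))) ^ ℓ := by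
            refine pow_le_pow_left₀ (by linarith) ?_ _
            have := Real.add_one_le_exp (-(2 / 3 * (1 - q)))
            linarith
        _ = Real.exp (ℓ * -(2 / 3 * (1 - q))) := (Real.exp_nat_mul _ _).symm
        _ ≤ _ := Real.exp_le_exp.mpr (by linarith)
    have h₄ : (3 : ℝ) ^ (x.length + 1) ≤ 3 * Real.exp (2 * d) := by
      have : (3 : ℝ) ^ x.length ≤ Real.exp (2 * d) := by
        calc (3 : ℝ) ^ x.length ≤ 3 ^ d := pow_le_pow_right₀ (by norm_num) hx
          _ ≤ Real.exp 2 ^ d := pow_le_pow_left₀ (by norm_num)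
              (by linarith [Real.add_one_le_exp (2 : ℝ)]) _
          _ = Real.exp (2 * d) := by rw [← Real.exp_nat_mul, mul_comm]
      rw [pow_succ]
      linarith
    refine (mul_le_mul h₄ h₃ (pow_nonneg (by linarith) _) (by positivity)).trans ?_
    rw [mul_assoc, ← Real.exp_add, div_eq_mul_one_div (3 : ℝ)]
    refine mul_le_mul_of_nonneg_left ?_ (by norm_num)
    have e : Real.exp (2 * d + -(5 * d + Real.log n)) = 1 / (n * Real.exp (3 * d)) := by
      rw [show 2 * (d : ℝ) + -(5 * d + Real.log n) = -(Real.log n + 3 * d) by ring, Real.exp_neg,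
        Real.exp_add, Real.exp_log (by linarith), one_div]
    rw [e]
    refine one_div_le_one_div_of_le (by positivity) (mul_le_mul_of_nonneg_left ?_ (by linarith))
    linarith [Real.add_one_le_exp (3 * (d : ℝ))]

/-- The main term is at most `3 (3p)^{cr} = 3/(ncr)`. The cut-off term is of the same order because
`cr ≤ lev ≤ d`. The factor `45` is what `p ≥ 1/(9n)` needs for `P p ≥ 5d`. -/
theorem prob_le_of_far (hn : 1 ≤ n) (hr : 1 ≤ r) (hc : 1 ≤ c) (hσ : σ < P) (hP : 45 * d * n ≤ P)
    (hd : 1 ≤ d) {x y : List (Fin σ)} (hx : x.length ≤ d) (hy : y.length ≤ d)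
    (hxy : c * r ≤ lev x y) :
    prob (fun f : Fin (hashLen n d (hashP n r c)) → Slot P =>
      editHash n d (hashP n r c) (slotRho f) x = editHash n d (hashP n r c) (slotRho f) y) ≤
    6 / (n * c * r) := by
  have hp := hashP_pos hn hr hc
  have hp3 := hashP_le hn hr hc
  have hp9 := le_hashP hn hr hc
  have hcr := one_le_cr hr hc
  have hd' : (1 : ℝ) ≤ d := by exact_mod_cast hd
  have hn' : (1 : ℝ) ≤ n := by exact_mod_cast hn
  have hP' : 45 * (d : ℝ) * n ≤ P := by exact_mod_cast hP
  have hl : (lev x y : ℝ) ≤ d := by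
    have := lev_le_max x y
    exact_mod_cast this.trans (max_le hx hy)
  refine (prob_le hp hp3 hn hσ (by nlinarith) hd ?_ hx hy).trans ?_
  · refine le_trans (le_of_eq ?_) (mul_le_mul hP' hp9 (by positivity) (by positivity))
    field_simp
    norm_num
  · have h₁ : (3 * hashP n r c) ^ lev x y ≤ 1 / (n * c * r) := by
      rw [← three_mul_hashP_rpow hn hr hc, ← Real.rpow_natCast]
      exact Real.rpow_le_rpow_of_exponent_ge (by linarith) (by linarith) hxy
    have h₂ : 3 / ((n : ℝ) * d) ≤ 3 / (n * c * r) := by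
      rw [mul_assoc]
      exact div_le_div_of_nonneg_left (by norm_num) (by positivity)
        (mul_le_mul_of_nonneg_left (hxy.trans hl) (by linarith))
    have e : 6 / ((n : ℝ) * c * r) = 3 * (1 / (n * c * r)) + 3 / (n * c * r) := by ring
    linarith

end Family

/-! ## The stored data structure -/

namespace WordRAM

open Inst

namespace Inst

/-- The word stored at an address. -/
def word (I : Inst) (k : ℕ) : ℕ :=
  if k < 24 then I.header.getD k 0
  else if k < I.seedBase then
    if (k - 24) % (I.d + 3) = 0 then (I.S ((k - 24) / (I.d + 3))).length
    else I.buf (I.S ((k - 24) / (I.d + 3))) ((k - 24) % (I.d + 3) - 1)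
  else if k < I.permBase then
    I.seed ((k - I.seedBase) / (4 * I.ℓ)) ((k - I.seedBase) % (4 * I.ℓ))
  else I.perm ((k - I.permBase) / I.n) ((k - I.permBase) % I.n)

/-- All stored words. -/
def words (I : Inst) : List ℕ := (List.range (I.permBase + I.R * I.n)).map I.word

theorem length_words (I : Inst) : I.words.length = I.permBase + I.R * I.n := by
  simp [words]

theorem getD_words (I : Inst) {k : ℕ} (h : k < I.permBase + I.R * I.n) :
    I.words.getD k 0 = I.word k := by
  simp [words, List.getD_eq_getElem?_getD, h]

theorem buf_cases (I : Inst) (x : List ℕ) (t : ℕ) :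
    I.buf x t ∈ x ∨ I.buf x t = I.σ ∨ I.buf x t = I.σ + 1 ∨ I.buf x t = 0 := by
  rw [buf, List.getD_eq_getElem?_getD]
  rcases lt_or_ge t (x ++ [I.σ, I.σ + 1]).length with h | h
  · rw [List.getElem?_eq_getElem h, Option.getD_some]
    have := List.getElem_mem h
    simp only [List.mem_append, List.mem_cons, List.not_mem_nil, or_false] at this
    tauto
  · rw [List.getElem?_eq_none h]; simp

/-- What an instance has to satisfy in order that its words describe it. -/
structure Valid (I : Inst) (w : ℕ) : Prop where
  n_pos : 0 < I.n
  R_pos : 0 < I.R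
  length_q : I.q.length ≤ I.d
  length_S : ∀ i < I.n, (I.S i).length ≤ I.d
  mem_q : ∀ c ∈ I.q, c < I.σ
  mem_S : ∀ i < I.n, ∀ c ∈ I.S i, c < I.σ
  K_le : I.K ≤ I.d
  ta_le : I.ta ≤ I.P
  tr_le : I.tr ≤ I.P
  perm_lt : ∀ j < I.R, ∀ m < I.n, I.perm j m < I.n
  seed_lt : ∀ j < I.R, ∀ t < 4 * I.ℓ, I.seed j t < I.P
  address_lt : I.permBase + I.R * I.n + I.scratch + I.σ + 100 < 2 ^ w
  value_lt : I.P * (I.σ + 3) < 2 ^ w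

theorem Valid.word_lt {I : Inst} {w : ℕ} (h : I.Valid w) {k : ℕ}
    (hk : k < I.permBase + I.R * I.n) : I.word k < 2 ^ w := by
  have hw := h.address_lt
  have hv := h.value_lt
  have hP : I.P ≤ I.P * (I.σ + 3) := Nat.le_mul_of_pos_right _ (by omega)
  simp only [scratch] at hw
  rw [word]
  split_ifs with h₁ h₂ h₃ h₄
  · have ha := h.ta_le
    have hr := h.tr_le
    have hK := h.K_le
    have hR : 4 * I.ℓ ≤ I.R * (4 * I.ℓ) := Nat.le_mul_of_pos_left _ h.R_pos
    have hn : I.n ≤ I.n * (I.d + 3) := Nat.le_mul_of_pos_right _ (by omega)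
    have hRn : I.R ≤ I.R * I.n := Nat.le_mul_of_pos_right _ h.n_pos
    simp only [permBase, seedBase] at hw
    have hh : ∀ v ∈ I.header, v < 2 ^ w := by
      simp only [header, List.mem_cons, List.not_mem_nil, or_false, permBase, seedBase]
      intro v hv
      omega
    rw [List.getD_eq_getElem _ _ (by simpa [header] using h₁)]
    exact hh _ (List.getElem_mem _)
  · have hi : (k - 24) / (I.d + 3) < I.n := by
      rw [Nat.div_lt_iff_lt_mul (by omega)]; simp only [seedBase] at h₂; omega
    have := h.length_S _ hi
    omega
  · have hi : (k - 24) / (I.d + 3) < I.n := by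
      rw [Nat.div_lt_iff_lt_mul (by omega)]; simp only [seedBase] at h₂; omega
    rcases I.buf_cases (I.S ((k - 24) / (I.d + 3))) ((k - 24) % (I.d + 3) - 1) with e | e | e | e
    · have := h.mem_S _ hi _ e; omega
    all_goals omega
  · have hpos : 0 < 4 * I.ℓ := by
      rcases Nat.eq_zero_or_pos (4 * I.ℓ) with e | e
      · simp only [permBase, e, Nat.mul_zero] at h₄; omega
      · exact e
    have hj : (k - I.seedBase) / (4 * I.ℓ) < I.R := by
      rw [Nat.div_lt_iff_lt_mul hpos]; simp only [permBase] at h₄; omega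
    have := h.seed_lt _ hj _ (Nat.mod_lt (k - I.seedBase) hpos)
    omega
  · have hj : (k - I.permBase) / I.n < I.R := by
      rw [Nat.div_lt_iff_lt_mul h.n_pos]; omega
    have := h.perm_lt _ hj _ (Nat.mod_lt (k - I.permBase) h.n_pos)
    have hn : I.n ≤ I.n * (I.d + 3) := Nat.le_mul_of_pos_right _ (by omega)
    simp only [permBase, seedBase] at hw
    omega

theorem Valid.holds {I : Inst} {w : ℕ} (h : I.Valid w) :
    I.Holds ⟨w, I.q, I.words, I.scratch⟩ := by
  have hw := h.address_lt
  have hw' : ∀ k, I.words.getD k 0 < 2 ^ w := by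
    intro k
    rcases lt_or_ge k (I.permBase + I.R * I.n) with hk | hk
    · rw [I.getD_words hk]; exact h.word_lt hk
    · rw [List.getD_eq_default _ _ (by rwa [length_words])]; omega
  have hq : ∀ k, I.q.getD k 0 < 2 ^ w := by
    intro k
    rcases lt_or_ge k I.q.length with hk | hk
    · rw [List.getD_eq_getElem _ _ hk]
      have := h.mem_q _ (List.getElem_mem hk)
      omega
    · rw [List.getD_eq_default _ _ hk]; omega
  have hp : I.permBase = 24 + I.n * (I.d + 3) + I.R * (4 * I.ℓ) := rfl
  have hs : I.seedBase = 24 + I.n * (I.d + 3) := rfl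
  refine ⟨⟨hq, hw'⟩, h.n_pos, rfl, h.length_q, h.length_S, h.mem_q, h.mem_S, h.K_le, ?_, ?_, ?_, ?_,
    ?_, h.perm_lt, h.seed_lt, le_rfl, hw, h.value_lt⟩
  · intro k hk
    rw [I.getD_words (by omega), word, if_pos hk]
  · intro i hi
    have hrow := mul_add_lt_mul hi (show 0 < I.d + 3 by omega)
    rw [I.getD_words (by omega), word, if_neg (by omega), if_pos (by omega)]
    simp
  · intro i hi t ht
    have hrow := mul_add_lt_mul hi (show t + 1 < I.d + 3 by omega)
    have e : 24 + i * (I.d + 3) + (t + 1) - 24 = (t + 1) + (I.d + 3) * i := by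
      rw [Nat.mul_comm]; omega
    rw [I.getD_words (by omega), word, if_neg (by omega), if_pos (by omega), e,
      Nat.add_mul_mod_self_left, Nat.add_mul_div_left _ _ (by omega),
      Nat.mod_eq_of_lt (by omega), Nat.div_eq_of_lt (by omega), if_neg (by omega)]
    simp
  · intro j hj t ht
    have hrow := mul_add_lt_mul hj ht
    have e : I.seedBase + j * (4 * I.ℓ) + t - I.seedBase = t + (4 * I.ℓ) * j := by
      rw [Nat.mul_comm _ j]; omega
    rw [I.getD_words (by omega), word, if_neg (by omega), if_neg (by omega), if_pos (by omega), e,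
      Nat.add_mul_mod_self_left, Nat.add_mul_div_left _ _ (by omega),
      Nat.mod_eq_of_lt ht, Nat.div_eq_of_lt ht, Nat.zero_add]
  · intro j hj m hm
    have hrow := mul_add_lt_mul hj hm
    have e : I.permBase + (j * I.n + m) - I.permBase = m + I.n * j := by
      rw [Nat.mul_comm _ j]; omega
    rw [I.getD_words (by omega), word, if_neg (by omega), if_neg (by omega), if_neg (by omega), e,
      Nat.add_mul_mod_self_left, Nat.add_mul_div_left _ _ h.n_pos,
      Nat.mod_eq_of_lt hm, Nat.div_eq_of_lt hm, Nat.zero_add]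

end Inst

/-! ### The instance of a database, of drawn hash functions and of a query -/

section Make

variable {P : ℕ} {n σ ℓ R : ℕ}

/-- The words that describe an affine function pair. -/
def slotWord (z : Slot P) : ℕ → ℕ
  | 0 => z.1.1.val
  | 1 => z.1.2.val
  | 2 => z.2.1.val
  | _ => z.2.2.val

/-- The instance of a database and of drawn hash functions, without the permutations and the
query. -/
noncomputable def preInst (d K : ℕ) (p : ℝ) (S : Fin n → List (Fin σ))
    (f : Fin R → Fin ℓ → Slot P) : Inst where
  n := n
  R := R
  ℓ := ℓ
  P := P
  ta := floorPa p P
  tr := floorPr p P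
  K := K
  σ := σ
  d := d
  q := []
  S i := if h : i < n then (S ⟨i, h⟩).map Fin.val else []
  seed j t := if h : j < R ∧ t / 4 < ℓ then slotWord (f ⟨j, h.1⟩ ⟨t / 4, h.2⟩) (t % 4) else 0
  perm _ _ := 0

/-- The permutation that sorts the database by the `j`-th hash. -/
noncomputable def sortPerm (d K : ℕ) (p : ℝ) (S : Fin n → List (Fin σ))
    (f : Fin R → Fin ℓ → Slot P) (j : ℕ) : Equiv.Perm (Fin n) :=
  Tuple.sort fun i : Fin n => (preInst d K p S f).lexKey j ((S i).map Fin.val)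

/-- The instance of a database, of drawn hash functions and of a query. -/
noncomputable def mkInst (d K : ℕ) (p : ℝ) (S : Fin n → List (Fin σ))
    (f : Fin R → Fin ℓ → Slot P) (q : List (Fin σ)) : Inst :=
  { preInst d K p S f with
    q := q.map Fin.val
    perm := fun j m => if h : m < n then sortPerm d K p S f j ⟨m, h⟩ else 0 }

variable {d K : ℕ} {p : ℝ} {S : Fin n → List (Fin σ)} {f : Fin R → Fin ℓ → Slot P}
  {q : List (Fin σ)}

theorem mkInst_S (i : Fin n) : (mkInst d K p S f q).S i = (S i).map Fin.val := by
  simp [mkInst, preInst]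

theorem mkInst_perm (j : ℕ) (m : Fin n) :
    (mkInst d K p S f q).perm j m = sortPerm d K p S f j m := by
  simp [mkInst]

/-- Keys depend neither on the permutations nor on the query. This is why the permutations may be
defined by sorting the keys of `preInst`. -/
theorem mkInst_scan (j m k : ℕ) (x : List ℕ) :
    (mkInst d K p S f q).scan j m k x = (preInst d K p S f).scan j m k x := by
  induction m generalizing k x with
  | zero => rfl
  | succ m ih =>
    cases x <;> simp only [Inst.scan, ih]
    rfl

theorem mkInst_lexKey (j : ℕ) (x : List ℕ) :
    (mkInst d K p S f q).lexKey j x = (preInst d K p S f).lexKey j x := by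
  simp only [Inst.lexKey, Inst.key, mkInst_scan]
  rfl

theorem mkInst_sorted : (mkInst d K p S f q).Sorted := by
  intro j hj m m' hm hm'
  have hm'n : m' < n := hm'
  have h := Tuple.monotone_sort (fun i : Fin n => (preInst d K p S f).lexKey j ((S i).map Fin.val))
  have := h (show (⟨m, hm.trans_lt hm'n⟩ : Fin n) ≤ ⟨m', hm'n⟩ from hm)
  have e₁ := mkInst_perm (d := d) (K := K) (p := p) (S := S) (f := f) (q := q) j
    ⟨m, hm.trans_lt hm'n⟩
  have e₂ := mkInst_perm (d := d) (K := K) (p := p) (S := S) (f := f) (q := q) j ⟨m', hm'n⟩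
  simp only at e₁ e₂
  rw [e₁, e₂, mkInst_S, mkInst_S, mkInst_lexKey, mkInst_lexKey]
  exact this

theorem mkInst_perm_surjective (j : ℕ) {i : ℕ} (hi : i < n) :
    ∃ m < n, (mkInst d K p S f q).perm j m = i := by
  refine ⟨(sortPerm d K p S f j).symm ⟨i, hi⟩, Fin.isLt _, ?_⟩
  rw [mkInst_perm, Equiv.apply_symm_apply]

theorem mkInst_valid [Fact P.Prime] {w : ℕ} (hn : 0 < n) (hR : 0 < R) (hp : 0 < p)
    (hp3 : p ≤ 1 / 3)
    (hS : ∀ i, (S i).length ≤ d) (hq : q.length ≤ d) (hK : K ≤ d)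
    (hw : 24 + n * (d + 3) + R * (4 * ℓ) + R * n + (5 * d + 2 * ℓ + 8) + σ + 100 < 2 ^ w)
    (hv : P * (σ + 3) < 2 ^ w) : (mkInst d K p S f q).Valid w := by
  refine ⟨hn, hR, (List.length_map _).trans_le hq, fun i (hi : i < n) => ?_, ?_,
    fun i (hi : i < n) => ?_, hK,
    floorPa_le hp hp3 (Fact.out : P.Prime).two_le, floorPr_le, fun j _ m (hm : m < n) => ?_,
    fun j (hj : j < R) t (ht : t < 4 * ℓ) => ?_, hw, hv⟩
  · have := mkInst_S (d := d) (K := K) (p := p) (S := S) (f := f) (q := q) ⟨i, hi⟩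
    simp only at this
    rw [this]
    exact (List.length_map _).trans_le (hS ⟨i, hi⟩)
  · intro c hc
    obtain ⟨a, _, rfl⟩ := List.mem_map.mp hc
    exact a.isLt
  · have := mkInst_S (d := d) (K := K) (p := p) (S := S) (f := f) (q := q) ⟨i, hi⟩
    simp only at this
    rw [this]
    intro c hc
    obtain ⟨a, _, rfl⟩ := List.mem_map.mp hc
    exact a.isLt
  · have := mkInst_perm (d := d) (K := K) (p := p) (S := S) (f := f) (q := q) j ⟨m, hm⟩
    simp only at this
    rw [this]
    exact Fin.isLt _
  · have h : j < R ∧ t / 4 < ℓ := ⟨hj, by omega⟩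
    simp only [mkInst, preInst, h, and_self, dif_pos]
    unfold slotWord
    split <;> exact ZMod.val_lt _

variable [Fact P.Prime]

theorem affineEval_val (l : ZMod P × ZMod P) (c : ℕ) :
    (affineEval l (c : ZMod P)).val = (l.1.val + l.2.val * c) % P := by
  rw [affineEval, ← ZMod.val_natCast]
  simp

theorem mkInst_value (j : Fin R) (i : Fin ℓ) (c : ℕ) :
    (mkInst d K p S f q).value j (4 * i) c = (slotValue (f j i) c).1.val ∧
    (mkInst d K p S f q).value j (4 * i + 2) c = (slotValue (f j i) c).2.val := by
  have h0 : (4 * (i : ℕ)) / 4 = i := by omega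
  have h1 : (4 * (i : ℕ) + 1) / 4 = i := by omega
  have h2 : (4 * (i : ℕ) + 2) / 4 = i := by omega
  have h3 : (4 * (i : ℕ) + 2 + 1) / 4 = i := by omega
  have m0 : (4 * (i : ℕ)) % 4 = 0 := by omega
  have m1 : (4 * (i : ℕ) + 1) % 4 = 1 := by omega
  have m2 : (4 * (i : ℕ) + 2) % 4 = 2 := by omega
  have m3 : (4 * (i : ℕ) + 2 + 1) % 4 = 3 := by omega
  constructor <;>
    simp [Inst.value, mkInst, preInst, slotValue, affineEval_val, h0, h1, h2, h3, m0, m1, m2, m3,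
      slotWord]

theorem mkInst_lexKey_eq_iff (hℓ : ℓ = hashLen n d p) (j : Fin R) (x y : List (Fin σ)) :
    (mkInst d K p S f q).lexKey j (x.map Fin.val) =
      (mkInst d K p S f q).lexKey j (y.map Fin.val) ↔
    editHash n d p (slotRho (f j)) x = editHash n d p (slotRho (f j)) y := by
  subst hℓ
  have hm : ∀ x : List (Fin σ), x.map Fin.val ++ [σ] = (marked x).map (charCode σ) := by
    intro x
    simp [marked, charCode, Function.comp_def]
  have key := (mkInst d K p S f q).scan_eq_scan_iff j (charCode_injective (σ := σ))
    (act := slotAct p) (List.ofFn (f j)) ?_ (marked x) (marked y)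
  · rw [List.length_ofFn] at key
    rw [Inst.lexKey_eq_iff, editHash, editHash, hashScan_slotRho, hashScan_slotRho]
    refine Iff.trans ?_ key
    rw [Inst.key, Inst.key, ← hm, ← hm]
    rfl
  · intro i hi a
    rw [List.length_ofFn] at hi
    obtain ⟨h₁, h₂⟩ := mkInst_value (d := d) (K := K) (p := p) (S := S) (f := f) (q := q) j ⟨i, hi⟩
      (charCode σ a)
    rw [List.getElem_ofFn]
    simp only at h₁ h₂
    rw [h₁, h₂]
    rfl

end Make

end WordRAM

/-! ## Expectation over independent copies -/

section Expect

variable {Ω X : Type} [Fintype Ω] [Fintype X]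

theorem prob_mono {E F : Ω → Prop} (h : ∀ ω, E ω → F ω) : prob E ≤ prob F := by
  classical
  rw [prob_eq_sum, prob_eq_sum]
  refine div_le_div_of_nonneg_right (Finset.sum_le_sum fun ω _ => ?_) (Nat.cast_nonneg _)
  by_cases hE : E ω
  · rw [if_pos hE, if_pos (h ω hE)]
  · rw [if_neg hE]; split_ifs <;> norm_num

theorem prob_add_prob_le [Nonempty Ω] (E F : Ω → Prop) :
    prob E + prob F ≤ 1 + prob fun ω => E ω ∧ F ω := by
  classical
  have hc : (0 : ℝ) < Fintype.card Ω := by exact_mod_cast Fintype.card_pos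
  rw [prob_eq_sum, prob_eq_sum, prob_eq_sum, ← add_div, div_le_iff₀ hc, add_mul,
    div_mul_cancel₀ _ hc.ne', ← Finset.sum_add_distrib]
  have : (1 : ℝ) * Fintype.card Ω = ∑ _ω : Ω, 1 := by simp
  rw [this, ← Finset.sum_add_distrib]
  refine Finset.sum_le_sum fun ω _ => ?_
  by_cases hE : E ω <;> by_cases hF : F ω <;> simp [hE, hF]

theorem prob_not [Nonempty Ω] (E : Ω → Prop) : prob (fun ω => ¬ E ω) = 1 - prob E := by
  classical
  have hc : (Fintype.card Ω : ℝ) ≠ 0 := by exact_mod_cast Fintype.card_ne_zero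
  rw [prob_eq_sum, prob_eq_sum, eq_sub_iff_add_eq, ← add_div, ← Finset.sum_add_distrib,
    div_eq_one_iff_eq hc, Finset.sum_congr rfl fun ω _ => ?_, Finset.sum_const, Finset.card_univ,
    nsmul_eq_mul, mul_one]
  by_cases h : E ω <;> simp [h]

/-- Markov's inequality for the complementary event. -/
theorem le_prob_le [Nonempty Ω] (T : Ω → ℕ) {a : ℝ} (ha : 0 < a) :
    1 - expect T / a ≤ prob fun ω => (T ω : ℝ) ≤ a := by
  classical
  have hc : (0 : ℝ) < Fintype.card Ω := by exact_mod_cast Fintype.card_pos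
  rw [prob_eq_sum, expect, le_div_iff₀ hc, sub_mul, div_right_comm, div_mul_cancel₀ _ hc.ne',
    one_mul, sub_le_iff_le_add, Finset.sum_div, ← Finset.sum_add_distrib]
  have : (Fintype.card Ω : ℝ) = ∑ _ω : Ω, 1 := by simp
  rw [this]
  refine Finset.sum_le_sum fun ω _ => ?_
  have h0 : 0 ≤ (T ω : ℝ) / a := by positivity
  split_ifs with h
  · linarith
  · rw [zero_add, le_div_iff₀ ha]; linarith

theorem prob_forall_apply (R : ℕ) (E : X → Prop) :
    prob (fun ω : Fin R → X => ∀ j, E (ω j)) = prob E ^ R := by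
  rw [prob, prob, Nat.card_congr (Equiv.subtypePiEquivPi (p := fun _ => E)), Nat.card_pi, div_pow]
  simp

/-- A single coordinate of a uniform tuple is uniform. -/
theorem sum_apply_div (R : ℕ) (j : Fin R) (G : X → ℝ) :
    (∑ ω : Fin R → X, G (ω j)) / Fintype.card (Fin R → X) = (∑ x, G x) / Fintype.card X := by
  have e := Equiv.funSplitAt j X
  have h : ∑ ω : Fin R → X, G (ω j) =
      Fintype.card ({i // i ≠ j} → X) * ∑ x, G x := by
    rw [Fintype.sum_equiv (Equiv.funSplitAt j X) _ (fun v => G v.1) (fun ω => by simp),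
      Fintype.sum_prod_type, Finset.mul_sum]
    simp
  rw [h, Fintype.card_congr e, Fintype.card_prod]
  push_cast
  rcases isEmpty_or_nonempty X with hX | hX
  · simp
  · have : (Fintype.card ({i // i ≠ j} → X) : ℝ) ≠ 0 := by exact_mod_cast Fintype.card_ne_zero
    rw [mul_comm, mul_div_mul_right _ _ this]

end Expect

/-! ## The index -/

section Index

open WordRAM

variable {P : ℕ} [Fact P.Prime]

/-- The choices determined by a seed. -/
noncomputable def drawn (ℓ P : ℕ) [Fact P.Prime] :
    Fin (Fintype.card (Fin ℓ → Slot P)) ≃ (Fin ℓ → Slot P) :=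
  (Fintype.equivFin _).symm

/-- The index of a database with `R` hash functions. -/
noncomputable def editIndex (n σ d r : ℕ) (c : ℝ) (P : ℕ) [Fact P.Prime] (R K w : ℕ) :
    HashIndex n σ where
  copies := R
  seeds := Fintype.card (Fin (hashLen n d (hashP n r c)) → Slot P)
  grid := P
  rnd s := slotRnd (drawn _ P s)
  wordSize := w
  scratch := 5 * d + 2 * hashLen n d (hashP n r c) + 8
  -- The stored words do not involve the query, so the empty one stands in for it.
  build S ω := (mkInst d K (hashP n r c) S (fun j => drawn _ P (ω j)) []).words

theorem prob_drawn {ℓ : ℕ} (E : (Fin ℓ → Slot P) → Prop) :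
    prob (fun s => E (drawn ℓ P s)) = prob E :=
  prob_comp_equiv _ E

variable {n σ d r : ℕ} {c : ℝ} {R K w : ℕ}

theorem editIndex_isUniform (hσ : σ < P) :
    (editIndex n σ d r c P R K w).IsUniform (hashLen n d (hashP n r c)) := by
  intro a b hab (u : ℕ → Fin P × Fin P) (v : ℕ → Fin P × Fin P)
  exact (prob_drawn fun f => ∀ k < hashLen n d (hashP n r c), slotRnd f (a k) k = u k ∧
    slotRnd f (b k) k = v k).trans (prob_slotRnd_eq hσ a b hab u v)

theorem prob_editIndex (x y : List (Fin σ)) :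
    prob (fun s : Fin (editIndex n σ d r c P R K w).seeds =>
      editHash n d (hashP n r c) ((editIndex n σ d r c P R K w).ρ s) x =
        editHash n d (hashP n r c) ((editIndex n σ d r c P R K w).ρ s) y) =
    prob fun f : Fin (hashLen n d (hashP n r c)) → Slot P =>
      editHash n d (hashP n r c) (slotRho f) x = editHash n d (hashP n r c) (slotRho f) y :=
  prob_drawn fun f => editHash n d (hashP n r c) (slotRho f) x =
    editHash n d (hashP n r c) (slotRho f) y

theorem editIndex_isSensitive (hn : 1 ≤ n) (hd : 1 ≤ d) (hr : 1 ≤ r) (hc : 1 ≤ c) (hσ : σ < P)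
    (hP : 45 * d * n ≤ P) :
    IsSensitive (fun s => editHash n d (hashP n r c) ((editIndex n σ d r c P R K w).ρ s)) d r
      (c * r) (hashP n r c ^ r / 2) (6 / (n * c * r)) := by
  intro x y hx hy
  rw [editDist_eq_lev, prob_editIndex]
  have hP8 : 8 * d ≤ P := le_trans (by nlinarith) hP
  exact ⟨fun h => half_pow_le_prob (hashP_pos hn hr hc) (hashP_le hn hr hc) hσ hP8 hd hx hy
    (by exact_mod_cast h), prob_le_of_far hn hr hc hσ hP hd hx hy⟩

/-- Far database strings that collide with the query. -/
noncomputable def farCount (n σ d r : ℕ) (c : ℝ) (S : Fin n → List (Fin σ)) (q : List (Fin σ))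
    (ρ : Option (Fin σ) → ℕ → ℝ × ℝ) : ℕ :=
  open Classical in
  ∑ i, if editHash n d (hashP n r c) ρ (S i) = editHash n d (hashP n r c) ρ q ∧
    c * r < lev q (S i) then 1 else 0

variable {S : Fin n → List (Fin σ)} {q : List (Fin σ)}

theorem exists_answer (hn : 1 ≤ n) (hr : 1 ≤ r) (hc : 1 ≤ c)
    (hS : ∀ i, (S i).length ≤ d) (hq : q.length ≤ d) (hK : K = min ⌊c * r⌋₊ d) (hR : 0 < R)
    (hw : 24 + n * (d + 3) + R * (4 * hashLen n d (hashP n r c)) + R * n +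
      (5 * d + 2 * hashLen n d (hashP n r c) + 8) + σ + 100 < 2 ^ w)
    (hv : P * (σ + 3) < 2 ^ w)
    (ω : Fin R → Fin (editIndex n σ d r c P R K w).seeds) :
    ∃ (t : ℕ) (out : Option (Fin n)),
      (Answers ((editIndex n σ d r c P R K w).env S ω q) query t out ∧
        (editIndex n σ d r c P R K w).IsSearchResult d (hashP n r c) (c * r) S ω q out) ∧
      t ≤ 3000 * ((d + hashLen n d (hashP n r c) + 3) * (K + 1)) *
        (1 + ∑ j, (n.size + 1 + farCount n σ d r c S q ((editIndex n σ d r c P R K w).ρ (ω j)))) := by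
  set p := hashP n r c with hp
  set ℓ := hashLen n d p with hℓ
  set f : Fin R → Fin ℓ → Slot P := fun j => drawn _ P (ω j) with hf
  set I := mkInst d K p S f q with hI
  have hI' := (mkInst_valid (S := S) (f := f) (q := q) hn hR (hashP_pos hn hr hc)
    (hashP_le hn hr hc) hS hq (hK.trans_le (min_le_right _ _)) hw hv).holds
  have hlev : ∀ i, lev q (S i) ≤ d := fun i => (lev_le_max _ _).trans (max_le hq (hS i))
  have hmap : ∀ i : Fin n, lev I.q (I.S i) = lev q (S i) := by
    intro i
    rw [hI, mkInst_S]
    exact lev_map_of_injective Fin.val_injective _ _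
  -- All distances are at most `d`, so the integer threshold may be capped there; the cap keeps the
  -- band inside the working memory.
  have hle : ∀ i : Fin n, lev I.q (I.S i) ≤ I.K ↔ (lev q (S i) : ℝ) ≤ c * r := by
    intro i
    have := one_le_cr hr hc
    rw [hmap, ← Nat.le_floor_iff (by linarith)]
    change _ ≤ K ↔ _
    rw [hK, le_min_iff]
    simp [hlev i]
  have hlex : ∀ (j : Fin R) (i : Fin n), I.lexKey j (I.S i) = I.lexKey j I.q ↔
      editHash n d p (slotRho (f j)) (S i) = editHash n d p (slotRho (f j)) q := by
    intro j i
    rw [hI, mkInst_S]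
    exact mkInst_lexKey_eq_iff hℓ j _ _
  obtain ⟨t, s', hex, ht, hout⟩ := exec_query hI' mkInst_sorted
    (fun j _ i hi => mkInst_perm_surjective j hi)
  have hfar : ∀ j : Fin R, I.far j =
      farCount n σ d r c S q ((editIndex n σ d r c P R K w).ρ (ω j)) := by
    intro j
    have e : I.far j = ∑ m : Fin n, I.farInd j (I.S (I.perm j m)) :=
      (Fin.sum_univ_eq_sum_range (fun m => I.farInd j (I.S (I.perm j m))) n).symm
    rw [e]
    simp only [hI, mkInst_perm]
    -- The machine counts along the sorted order, `farCount` along the database; the order is a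
    -- permutation.
    rw [Equiv.sum_comp (sortPerm d K p S f j) fun i : Fin n =>
      (mkInst d K p S f q).farInd j ((mkInst d K p S f q).S i), farCount]
    refine Finset.sum_congr rfl fun i _ => ?_
    rw [← hI, Inst.farInd]
    refine if_congr (and_congr (hlex j i) ?_) rfl rfl
    rw [← not_le, hle, not_le]
  have hsum : ∑ j ∈ Finset.range R, (n.size + 1 + I.far j) =
      ∑ j, (n.size + 1 + farCount n σ d r c S q ((editIndex n σ d r c P R K w).ρ (ω j))) := by
    rw [← Fin.sum_univ_eq_sum_range (fun j => n.size + 1 + I.far j) R]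
    exact Finset.sum_congr rfl fun j _ => by rw [hfar]
  have hhit : ∀ (j : Fin R) (i : Fin n), I.Hit j (I.S i) ↔
      (editDist q (S i) : ℝ) ≤ c * r ∧ editHash n d p ((editIndex n σ d r c P R K w).ρ (ω j)) q =
        editHash n d p ((editIndex n σ d r c P R K w).ρ (ω j)) (S i) := by
    intro j i
    rw [Inst.Hit, hlex, hle, editDist_eq_lev, and_comm, eq_comm]
    rfl
  rcases hout with ⟨h0, hno⟩ | ⟨j, hj, i, hi, hh, h0⟩
  · refine ⟨t, none, ⟨⟨s', hex, h0⟩, ?_⟩, ht.trans_eq (by rw [← hsum]; rfl)⟩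
    rintro i ⟨h₁, j, h₂⟩
    exact hno j j.isLt i i.isLt ((hhit j i).mpr ⟨h₁, h₂⟩)
  · refine ⟨t, some ⟨i, hi⟩, ⟨⟨s', hex, h0⟩, ?_⟩, ht.trans_eq (by rw [← hsum]; rfl)⟩
    obtain ⟨h₁, h₂⟩ := (hhit ⟨j, hj⟩ ⟨i, hi⟩).mp hh
    exact ⟨h₁, ⟨j, hj⟩, h₂⟩

/-- By linearity of expectation: `n` strings, each far one colliding with probability at most
`6/(ncr) ≤ 6/n`. -/
theorem sum_farCount_le (hn : 1 ≤ n) (hd : 1 ≤ d) (hr : 1 ≤ r) (hc : 1 ≤ c) (hσ : σ < P)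
    (hP : 45 * d * n ≤ P) (hS : ∀ i, (S i).length ≤ d) (hq : q.length ≤ d) :
    (∑ s, (farCount n σ d r c S q ((editIndex n σ d r c P R K w).ρ s) : ℝ)) /
      Fintype.card (Fin (editIndex n σ d r c P R K w).seeds) ≤ 6 := by
  classical
  simp only [farCount, Nat.cast_sum]
  rw [Finset.sum_comm, Finset.sum_div]
  have hn' : (1 : ℝ) ≤ n := by exact_mod_cast hn
  have hcr := one_le_cr hr hc
  have key : ∀ i ∈ Finset.univ, (∑ s, (((if editHash n d (hashP n r c)
      ((editIndex n σ d r c P R K w).ρ s) (S i) = editHash n d (hashP n r c)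
      ((editIndex n σ d r c P R K w).ρ s) q ∧ c * r < lev q (S i) then 1 else 0 : ℕ)) : ℝ)) /
      Fintype.card (Fin (editIndex n σ d r c P R K w).seeds) ≤ 6 / n := by
    intro i _
    by_cases h : c * r < lev q (S i)
    · have hs := (editIndex_isSensitive (R := R) (K := K) (w := w) hn hd hr hc hσ hP (S i) q
        (hS i) hq).2
        (by rw [editDist_eq_lev, lev_comm]; exact h.le)
      rw [prob_eq_sum] at hs
      simp only [h, and_true, Nat.cast_ite, Nat.cast_one, Nat.cast_zero]
      refine le_trans (le_of_eq ?_) (hs.trans ?_)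
      · congr!
      · rw [mul_assoc]
        exact div_le_div_of_nonneg_left (by norm_num) (by linarith)
          (le_mul_of_one_le_right (by linarith) hcr)
    · simp only [h, and_false, if_false, Nat.cast_zero, Finset.sum_const_zero, zero_div]
      positivity
  refine (Finset.sum_le_sum key).trans_eq ?_
  rw [Finset.sum_const, Finset.card_univ, Fintype.card_fin, nsmul_eq_mul]
  field_simp

theorem editIndex_seeds_pos : 0 < (editIndex n σ d r c P R K w).seeds :=
  Fintype.card_pos

/-- The `7` in `hM` is the `1` of the deterministic bound plus the `6` expected far collisions. A
collision with the close string fails with probability at most `(1 - p^r/2)^R ≤ 1/e ≤ 1/2`, the time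
limit `4M` with probability at most `1/4`. If neither fails, a hit exists, so the search must return
one. -/
theorem exists_search (hn : 1 ≤ n) (hd : 1 ≤ d) (hr : 1 ≤ r) (hc : 1 ≤ c) (hσ : σ < P)
    (hP : 45 * d * n ≤ P) (hS : ∀ i, (S i).length ≤ d) (hq : q.length ≤ d)
    (hK : K = min ⌊c * r⌋₊ d) (hR : 2 / hashP n r c ^ r ≤ R)
    (hw : 24 + n * (d + 3) + R * (4 * hashLen n d (hashP n r c)) + R * n +
      (5 * d + 2 * hashLen n d (hashP n r c) + 8) + σ + 100 < 2 ^ w)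
    (hv : P * (σ + 3) < 2 ^ w) {M : ℝ}
    (hM : 3000 * ((d + hashLen n d (hashP n r c) + 3 : ℝ) * (K + 1)) *
      (1 + R * (n.size + 7)) ≤ M) :
    ∃ (T : (Fin R → Fin (editIndex n σ d r c P R K w).seeds) → ℕ)
      (out : (Fin R → Fin (editIndex n σ d r c P R K w).seeds) → Option (Fin n)),
      (∀ ω, Answers ((editIndex n σ d r c P R K w).env S ω q) query (T ω) (out ω) ∧
        (editIndex n σ d r c P R K w).IsSearchResult d (hashP n r c) (c * r) S ω q (out ω)) ∧
      expect T ≤ M ∧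
      ((∃ i, editDist q (S i) ≤ r) → 1 / 10 < prob (fun ω => (T ω : ℝ) ≤ 4 * M ∧
        ∃ i, out ω = some i ∧ (editDist q (S i) : ℝ) ≤ c * r)) := by
  set D := editIndex n σ d r c P R K w with hD
  have hp := hashP_pos hn hr hc
  have hpr : 0 < hashP n r c ^ r := pow_pos hp r
  have hR0 : 0 < R := by
    have : (0 : ℝ) < R := lt_of_lt_of_le (by positivity) hR
    exact_mod_cast this
  have hseeds : 0 < D.seeds := editIndex_seeds_pos
  have : Nonempty (Fin D.seeds) := ⟨⟨0, hseeds⟩⟩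
  have hcard : (0 : ℝ) < Fintype.card (Fin R → Fin D.seeds) := by exact_mod_cast Fintype.card_pos
  choose T out hres hT using exists_answer (P := P) (w := w) hn hr hc hS hq hK hR0 hw hv
  have hexp : expect T ≤ M := by
    refine le_trans ?_ hM
    rw [expect, div_le_iff₀ hcard]
    set B : ℝ := 3000 * ((d + hashLen n d (hashP n r c) + 3 : ℝ) * (K + 1)) with hB
    have hB0 : 0 ≤ B := by positivity
    have h₁ : ∀ ω, (T ω : ℝ) ≤ B * (1 + ∑ j : Fin R, ((n.size + 1 : ℝ) +
        farCount n σ d r c S q (D.ρ (ω j)))) := by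
      intro ω
      have := hT ω
      have h : (T ω : ℝ) ≤ ((3000 * ((d + hashLen n d (hashP n r c) + 3) * (K + 1)) *
        (1 + ∑ j, (n.size + 1 + farCount n σ d r c S q (D.ρ (ω j)))) : ℕ) : ℝ) := by
        exact_mod_cast this
      push_cast at h
      exact h
    refine (Finset.sum_le_sum fun ω _ => h₁ ω).trans ?_
    rw [← Finset.mul_sum, mul_assoc B]
    refine mul_le_mul_of_nonneg_left ?_ hB0
    have h₂ : ∀ j : Fin R, ∑ ω : Fin R → Fin D.seeds,
        (farCount n σ d r c S q (D.ρ (ω j)) : ℝ) ≤ 6 * Fintype.card (Fin R → Fin D.seeds) := by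
      intro j
      rw [← div_le_iff₀ hcard,
        sum_apply_div R j fun s => (farCount n σ d r c S q (D.ρ s) : ℝ)]
      exact sum_farCount_le hn hd hr hc hσ hP hS hq
    rw [Finset.sum_add_distrib, Finset.sum_comm]
    simp only [Finset.sum_add_distrib, Finset.sum_const, Finset.card_univ, nsmul_eq_mul]
    have h₃ := Finset.sum_le_sum fun j (_ : j ∈ (Finset.univ : Finset (Fin R))) => h₂ j
    rw [Finset.sum_const, Finset.card_univ, nsmul_eq_mul, Fintype.card_fin] at h₃
    rw [Fintype.card_fin] at *
    linarith
  refine ⟨T, out, hres, hexp, ?_⟩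
  rintro ⟨i, hi⟩
  have hM0 : 0 < M := lt_of_lt_of_le (by positivity) hM
  set E : Fin D.seeds → Prop := fun s =>
    editHash n d (hashP n r c) (D.ρ s) q = editHash n d (hashP n r c) (D.ρ s) (S i) with hE
  have hE1 : hashP n r c ^ r / 2 ≤ prob E :=
    (editIndex_isSensitive (R := R) (K := K) (w := w) hn hd hr hc hσ hP q (S i) hq (hS i)).1
      (by exact_mod_cast hi)
  have hnone : prob (fun ω : Fin R → Fin D.seeds => ∀ j, ¬ E (ω j)) ≤ 1 / 2 := by
    have hE2 : prob E ≤ 1 := by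
      have h := prob_not E
      have : 0 ≤ prob fun s => ¬ E s := by unfold prob; positivity
      linarith
    rw [prob_forall_apply R fun s => ¬ E s, prob_not]
    calc (1 - prob E) ^ R ≤ Real.exp (-prob E) ^ R := by
          refine pow_le_pow_left₀ (by linarith) ?_ R
          have := Real.add_one_le_exp (-prob E)
          linarith
      _ = Real.exp (R * -prob E) := (Real.exp_nat_mul _ _).symm
      _ ≤ Real.exp (-1) := by
          refine Real.exp_le_exp.mpr ?_
          have h₁ := mul_le_mul hR hE1 (by positivity) (Nat.cast_nonneg R)
          have h₂ : 2 / hashP n r c ^ r * (hashP n r c ^ r / 2) = 1 := by field_simp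
          linarith
      _ ≤ 1 / 2 := by
          rw [Real.exp_neg, ← one_div]
          exact one_div_le_one_div_of_le (by norm_num)
            (by linarith [Real.add_one_le_exp (1 : ℝ)])
  have hsome : 1 / 2 ≤ prob fun ω : Fin R → Fin D.seeds => ¬ ∀ j, ¬ E (ω j) := by
    rw [prob_not]; linarith
  have hmarkov := le_prob_le T (a := 4 * M) (by positivity)
  have hquarter : expect T / (4 * M) ≤ 1 / 4 := by
    rw [div_le_iff₀ (by positivity)]; linarith
  have hboth := prob_add_prob_le (fun ω => (T ω : ℝ) ≤ 4 * M)
    (fun ω : Fin R → Fin D.seeds => ¬ ∀ j, ¬ E (ω j))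
  refine lt_of_lt_of_le (by linarith : (1 / 10 : ℝ) < _) (prob_mono (E := fun ω =>
    (T ω : ℝ) ≤ 4 * M ∧ ¬ ∀ j, ¬ E (ω j)) ?_)
  rintro ω ⟨h₁, h₂⟩
  refine ⟨h₁, ?_⟩
  push Not at h₂
  obtain ⟨j, hj⟩ := h₂
  have hcr : (editDist q (S i) : ℝ) ≤ c * r := by
    have h₃ : (editDist q (S i) : ℝ) ≤ r := by exact_mod_cast hi
    exact h₃.trans (le_mul_of_one_le_left (Nat.cast_nonneg r) hc)
  have hr' := (hres ω).2
  cases ho : out ω with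
  | none =>
    rw [ho] at hr'
    exact absurd ⟨hcr, j, hj⟩ (hr' i)
  | some i' =>
    rw [ho] at hr'
    exact ⟨i', rfl, hr'.1⟩

end Index

/-! ## Asymptotic bounds -/

section Asymptotics

theorem size_le_two_mul_log {n : ℕ} (hn : 1 ≤ n) : (n.size : ℝ) ≤ 2 * Real.log n + 1 := by
  obtain ⟨k, hk⟩ : ∃ k, n.size = k + 1 :=
    Nat.exists_eq_succ_of_ne_zero (Nat.size_pos.mpr hn).ne'
  have h : 2 ^ k ≤ n := Nat.lt_size.mp (by omega)
  have h' : (2 : ℝ) ^ k ≤ n := by exact_mod_cast h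
  have h₁ := Real.log_le_log (by positivity) h'
  rw [Real.log_pow] at h₁
  have h₂ := mul_le_mul_of_nonneg_left Real.log_two_gt_d9.le (Nat.cast_nonneg (α := ℝ) k)
  rw [hk]
  push_cast
  linarith [Nat.cast_nonneg (α := ℝ) k]

variable {n d r : ℕ} {c : ℝ}

theorem hashLen_le (hn : 1 ≤ n) {p : ℝ} (hp : 0 < p) (hp3 : p ≤ 1 / 3) :
    (hashLen n d p : ℝ) ≤ 16 * d + 6 * Real.log n + 1 := by
  have ha := hashPa_le_half hp hp3
  have hlog : 0 ≤ Real.log n := Real.log_nonneg (by exact_mod_cast hn)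
  have h : 8 * (d : ℝ) / (1 - hashPa p) ≤ 16 * d := by
    rw [div_le_iff₀ (by linarith)]
    nlinarith [Nat.cast_nonneg (α := ℝ) d]
  have h0 : 0 ≤ 8 * (d : ℝ) / (1 - hashPa p) := div_nonneg (by positivity) (by linarith)
  have := (Nat.ceil_lt_add_one (add_nonneg h0 (by linarith : 0 ≤ 6 * Real.log n))).le
  unfold hashLen
  linarith

/-- Here `p^{-r} = 3^r (ncr)^{1/c}`, and `(cr)^{1/c} ≤ cr`. -/
theorem two_div_hashP_pow_le (hn : 1 ≤ n) (hr : 1 ≤ r) (hc : 1 ≤ c) :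
    2 / hashP n r c ^ r ≤ 2 * (c * r * (3 ^ r * (n : ℝ) ^ (1 / c))) := by
  have hcr := one_le_cr hr hc
  have hn' : (1 : ℝ) ≤ n := by exact_mod_cast hn
  rw [hashP_pow hn hr hc, div_div_eq_mul_div, div_one, mul_assoc (n : ℝ),
    Real.mul_rpow (by positivity) (by positivity)]
  have h : (c * r) ^ (1 / c) ≤ c * r := by
    refine (Real.rpow_le_rpow_of_exponent_le hcr ?_).trans_eq (Real.rpow_one _)
    rw [div_le_one (by linarith)]; exact hc
  have := mul_le_mul_of_nonneg_left h (show 0 ≤ 3 ^ r * (n : ℝ) ^ (1 / c) by positivity)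
  linarith

theorem ceil_two_div_le (hn : 1 ≤ n) (hr : 1 ≤ r) (hc : 1 ≤ c) :
    (⌈2 / hashP n r c ^ r⌉₊ : ℝ) ≤ 2 * (2 / hashP n r c ^ r) := by
  have hp := hashP_pos hn hr hc
  have h1 : hashP n r c ^ r ≤ 1 := pow_le_one₀ hp.le (by linarith [hashP_le hn hr hc])
  have h2 : 1 ≤ 2 / hashP n r c ^ r := by
    rw [one_le_div (pow_pos hp r)]; linarith
  have := (Nat.ceil_lt_add_one (by linarith : 0 ≤ 2 / hashP n r c ^ r)).le
  linarith

/-- Makes every factor `r` logarithmic in the target bound. -/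
theorem le_log_of_three_pow_le {g : ℝ} (h : 3 ^ r ≤ g) :
    (r : ℝ) ≤ Real.log g := by
  have h3 : 1 ≤ Real.log 3 := by
    rw [Real.le_log_iff_exp_le (by norm_num)]
    exact Real.exp_one_lt_d9.le.trans (by norm_num)
  have := Real.log_le_log (by positivity) h
  rw [Real.log_pow] at this
  nlinarith [Nat.cast_nonneg (α := ℝ) r]

/-- In the application `N = 3^r n^{1/c}`, `L = log (dN)`, `m = log n`, `l` is the length of the hash
and `z` the binary length of `n`. The hash length, the band, the factor `r` in `R` and the binary
search contribute one factor `L` each. -/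
theorem time_le {d l K c r N z R L m : ℝ} (hd : 1 ≤ d) (hc : 1 ≤ c) (hr : 1 ≤ r) (hN : 1 ≤ N)
    (hL : r ≤ L) (hm : m ≤ c * L) (hl0 : 0 ≤ l) (hl : l ≤ 16 * d + 6 * m + 1) (hK0 : 0 ≤ K)
    (hK : K ≤ c * r) (hz0 : 0 ≤ z) (hz : z ≤ 2 * m + 1) (hR : R ≤ 4 * (c * r * N)) :
    3000 * ((d + l + 3) * (K + 1)) * (1 + R * (z + 7)) ≤ 6642000 * c ^ 4 * (d * N) * L ^ 4 := by
  have hL1 : 1 ≤ L := hr.trans hL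
  have hcL : 1 ≤ c * L := one_le_mul_of_one_le_of_one_le hc hL1
  have hcLd : c * L ≤ d * (c * L) := le_mul_of_one_le_left (by linarith) hd
  have hdcL : d ≤ d * (c * L) := le_mul_of_one_le_right (by linarith) hcL
  have h₁ : d + l + 3 ≤ 27 * (d * (c * L)) := by linarith
  have h₂ : K + 1 ≤ 2 * (c * L) := by
    have := mul_le_mul_of_nonneg_left hL (show 0 ≤ c by linarith)
    linarith
  have h₃ : 1 + R * (z + 7) ≤ 41 * (c ^ 2 * N * L ^ 2) := by
    have e₁ : z + 7 ≤ 10 * (c * L) := by linarith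
    have e₂ : c * r * N ≤ c * L * N := by gcongr
    have e₃ : R * (z + 7) ≤ 4 * (c * L * N) * (10 * (c * L)) :=
      mul_le_mul (by linarith) e₁ (by linarith) (by positivity)
    have e₄ : 1 ≤ c ^ 2 * N * L ^ 2 := by
      have := one_le_mul_of_one_le_of_one_le (one_le_mul_of_one_le_of_one_le hcL hcL) hN
      linarith
    linarith
  have h₄ : (d + l + 3) * (K + 1) ≤ 27 * (d * (c * L)) * (2 * (c * L)) :=
    mul_le_mul h₁ h₂ (by linarith) (by positivity)
  calc 3000 * ((d + l + 3) * (K + 1)) * (1 + R * (z + 7))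
      ≤ 3000 * ((d + l + 3) * (K + 1)) * (41 * (c ^ 2 * N * L ^ 2)) := by gcongr
    _ ≤ 3000 * (27 * (d * (c * L)) * (2 * (c * L))) * (41 * (c ^ 2 * N * L ^ 2)) := by gcongr
    _ = 6642000 * c ^ 4 * (d * N) * L ^ 4 := by ring

theorem space_le {n d l c r N R L m a : ℝ} (hn : 1 ≤ n) (hd : 1 ≤ d) (hc : 1 ≤ c) (ha : 1 ≤ a)
    (hr : 1 ≤ r) (hN : 1 ≤ N) (hL : r ≤ L) (hm : m ≤ n) (hda : d ≤ a * n) (hl0 : 0 ≤ l)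
    (hl : l ≤ 16 * d + 6 * m + 1) (hR : R ≤ 4 * (c * r * N)) :
    24 + n * (d + 3) + R * (4 * l) + R * n + (5 * d + 2 * l + 8) ≤
      460 * (a * c) * (N * n + d * n) * L := by
  have hL1 : 1 ≤ L := hr.trans hL
  have hna : n ≤ a * n := le_mul_of_one_le_left (by linarith) ha
  have hndn : n ≤ d * n := le_mul_of_one_le_left (by linarith) hd
  have hddn : d ≤ d * n := le_mul_of_one_le_right (by linarith) hn
  have hla : l ≤ 23 * (a * n) := by linarith
  have hR' : R ≤ 4 * (c * L * N) := hR.trans (by gcongr)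
  have h₁ : R * (4 * l) ≤ 4 * (c * L * N) * (4 * (23 * (a * n))) :=
    mul_le_mul hR' (by linarith) (by linarith) (by positivity)
  have h₂ : R * n ≤ 4 * (c * L * N) * n := mul_le_mul_of_nonneg_right hR' (by linarith)
  have h₃ : c * L * N * n ≤ a * (c * L * N * n) := le_mul_of_one_le_left (by positivity) ha
  have h₄ : d * n ≤ a * c * L * (d * n) := le_mul_of_one_le_left (by positivity)
    (one_le_mul_of_one_le_of_one_le (one_le_mul_of_one_le_of_one_le ha hc) hL1)
  have h₅ : 24 + n * (d + 3) + (5 * d + 2 * l + 8) ≤ 100 * (d * n) := by linarith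
  have h₆ : 0 ≤ a * (c * L * N * n) := by positivity
  linarith

/-- Addresses and intermediate values are polynomial in the space bound `G`, so words of `O(log G)`
bits hold them. -/
theorem word_le {n d c N P s X G L a : ℝ} (hn : 1 ≤ n) (hd : 1 ≤ d) (hc : 1 ≤ c) (ha : 1 ≤ a)
    (hs0 : 0 ≤ s) (hs : s ≤ a * n) (hP : P ≤ 2 * (45 * d * n + s)) (hN : 1 ≤ N)
    (hG : G = N * n + d * n) (hL : L ≤ G) (hX : X ≤ 460 * (a * c) * G * L) :
    X + s + 100 + P * (s + 3) ≤ 1000 * (a ^ 2 * c) * G ^ 2 := by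
  have hnN : n ≤ N * n := le_mul_of_one_le_left (by linarith) hN
  have hndn : n ≤ d * n := le_mul_of_one_le_left (by linarith) hd
  have hG1 : 1 ≤ G := by linarith
  have hdn : d * n ≤ G := by linarith
  have hsG : s ≤ a * G := hs.trans (by gcongr; linarith)
  have hGa : G ≤ a * G := le_mul_of_one_le_left (by linarith) ha
  have h₁ : X ≤ 460 * (a * c) * G ^ 2 := hX.trans (by
    rw [sq, ← mul_assoc (460 * (a * c))]; gcongr)
  have h₂ : P * (s + 3) ≤ 2 * (46 * (a * G)) * (4 * (a * G)) :=
    mul_le_mul (by linarith) (by linarith) (by linarith) (by positivity)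
  have h₃ : a * c * G ^ 2 ≤ a ^ 2 * c * G ^ 2 := by
    rw [sq a]; gcongr; exact le_mul_of_one_le_left (by linarith) ha
  have h₄ : a ^ 2 * G ^ 2 ≤ a ^ 2 * c * G ^ 2 := by
    gcongr; exact le_mul_of_one_le_right (by positivity) hc
  have h₅ : a * G ≤ a ^ 2 * G ^ 2 := by
    rw [← mul_pow]; exact le_self_pow₀ (hG1.trans hGa) (by norm_num)
  linarith

end Asymptotics

/-! ### Choice of the parameters and proof of the theorem -/

theorem mainTheorem1 :
    -- one query program for all instances
    ∃ Q : WordRAM.Prog, ∀ c A : ℝ, 1 ≤ c →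
    -- the constants hidden in the asymptotic notation
    ∃ (C : ℝ) (e : ℕ), 0 < C ∧
    ∀ n d r σ : ℕ, 1 ≤ n → 1 ≤ d → 1 ≤ r → (d : ℝ) ≤ A * n → (σ : ℝ) ≤ A * n →
    ∃ (D : HashIndex n σ) (p₁ p₂ : ℝ),
      -- words have logarithmically many bits
      (D.wordSize : ℝ) ≤ C * Real.log (3 ^ r * (n : ℝ) ^ (1 + 1 / c) + d * n) ∧
      -- each of the independent copies is a random function `h_ρ` from the locality-sensitive family
      0 < D.seeds ∧ n ≤ D.grid ∧ D.IsUniform (hashLen n d (hashP n r c)) ∧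
      IsSensitive (fun s => editHash n d (hashP n r c) (D.ρ s)) d r (c * r) p₁ p₂ ∧
      hashP n r c ^ r / C ≤ p₁ ∧ p₂ ≤ C / (n * c * r) ∧
      -- the number of copies is of order `1 / p₁`
      1 / (C * p₁) ≤ D.copies ∧ (D.copies : ℝ) ≤ C / p₁ ∧
      ∀ S : Fin n → List (Fin σ), (∀ i, (S i).length ≤ d) →
        -- space
        (∀ ω, (D.space S ω : ℝ) ≤ softO C e (3 ^ r * (n : ℝ) ^ (1 + 1 / c) + d * n)) ∧
        ∀ q : List (Fin σ), q.length ≤ d →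
          ∃ (T : (Fin D.copies → Fin D.seeds) → ℕ)
            (out : (Fin D.copies → Fin D.seeds) → Option (Fin n)),
            -- the query program halts after `T` steps with the answer `out`
            (∀ ω, WordRAM.Answers (D.env S ω q) Q (T ω) (out ω) ∧
              D.IsSearchResult d (hashP n r c) (c * r) S ω q (out ω)) ∧
            -- query time
            expect T ≤ softO C e (d * 3 ^ r * (n : ℝ) ^ (1 / c)) ∧
            -- a close string is found, within the time bound, with probability more than 1/10
            ((∃ i, editDist q (S i) ≤ r) →
              1 / 10 < prob (fun ω => (T ω : ℝ) ≤ softO C e (d * 3 ^ r * (n : ℝ) ^ (1 / c)) ∧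
                ∃ i, out ω = some i ∧ (editDist q (S i) : ℝ) ≤ c * r)) := by

  refine ⟨WordRAM.query, fun c A hc => ?_⟩
  set a : ℝ := max A 1 with ha
  have ha1 : 1 ≤ a := le_max_right _ _
  have hc4 : 1 ≤ c ^ 4 := one_le_pow₀ hc
  have ha2 : 1 ≤ a ^ 2 := one_le_pow₀ ha1
  have hca : 1 ≤ c ^ 4 * a ^ 2 := one_le_mul_of_one_le_of_one_le hc4 ha2
  set C : ℝ := 100000000 * (c ^ 4 * a ^ 2) with hC
  have hC0 : 0 < C := by positivity
  refine ⟨C, 4, hC0, fun n d r σ hn hd hr hdA hσA => ?_⟩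
  have hn' : (1 : ℝ) ≤ n := by exact_mod_cast hn
  have hd' : (1 : ℝ) ≤ d := by exact_mod_cast hd
  have hr' : (1 : ℝ) ≤ r := by exact_mod_cast hr
  have hda : (d : ℝ) ≤ a * n := hdA.trans (by gcongr; exact le_max_left _ _)
  have hσa : (σ : ℝ) ≤ a * n := hσA.trans (by gcongr; exact le_max_left _ _)
  set N : ℝ := 3 ^ r * (n : ℝ) ^ (1 / c) with hN
  have hnc : 1 ≤ (n : ℝ) ^ (1 / c) := Real.one_le_rpow hn' (by positivity)
  have h3r : (1 : ℝ) ≤ 3 ^ r := one_le_pow₀ (by norm_num)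
  have hN1 : 1 ≤ N := one_le_mul_of_one_le_of_one_le h3r hnc
  have hG : 3 ^ r * (n : ℝ) ^ (1 + 1 / c) + d * n = N * n + d * n := by
    rw [Real.rpow_add (by linarith), Real.rpow_one, hN]; ring
  have hg : d * 3 ^ r * (n : ℝ) ^ (1 / c) = d * N := by rw [hN]; ring
  rw [hG, hg]
  set G : ℝ := N * n + d * n with hG'
  set g : ℝ := d * N with hg'
  have h3N : (3 : ℝ) ^ r ≤ N := le_mul_of_one_le_right (by positivity) hnc
  have hNg : N ≤ g := le_mul_of_one_le_left (by linarith) hd'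
  have hNG : N ≤ G := by
    have := le_mul_of_one_le_right (show 0 ≤ N by linarith) hn'
    have : 0 ≤ (d : ℝ) * n := by positivity
    linarith
  have hrg : (r : ℝ) ≤ Real.log g := le_log_of_three_pow_le (h3N.trans hNg)
  have hrG : (r : ℝ) ≤ Real.log G := le_log_of_three_pow_le (h3N.trans hNG)
  have hLg : 1 ≤ Real.log g := hr'.trans hrg
  have hLG : 1 ≤ Real.log G := hr'.trans hrG
  -- From `n ^ (1/c) ≤ g`; this is where the constants come to depend on `c`.
  have hm : Real.log n ≤ c * Real.log g := by
    have h := Real.log_le_log (by positivity)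
      ((le_mul_of_one_le_left (by positivity) h3r : (n : ℝ) ^ (1 / c) ≤ N).trans hNg)
    rw [Real.log_rpow (by linarith), one_div_mul_eq_div, div_le_iff₀ (by linarith)] at h
    linarith
  have hmn : Real.log n ≤ n := (Real.log_le_sub_one_of_pos (by linarith)).trans (by linarith)
  have hp := hashP_pos hn hr hc
  have hp3 := hashP_le hn hr hc
  have hpr : 0 < hashP n r c ^ r := pow_pos hp r
  have hl := hashLen_le (d := d) hn hp hp3
  set ℓ := hashLen n d (hashP n r c) with hℓ
  -- Bertrand's postulate. The lower bound provides `45dn ≤ P` for the accuracy and `σ < P` for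
  -- distinct character codes; the upper bound keeps the words short.
  obtain ⟨P, hPprime, hP1, hP2⟩ := Nat.exists_prime_lt_and_le_two_mul (45 * d * n + σ) (by positivity)
  have : Fact P.Prime := ⟨hPprime⟩
  set R := ⌈2 / hashP n r c ^ r⌉₊ with hRdef
  have hR1 : 2 / hashP n r c ^ r ≤ R := Nat.le_ceil _
  have hR2 : (R : ℝ) ≤ 2 * (2 / hashP n r c ^ r) := ceil_two_div_le hn hr hc
  have hR3 : (R : ℝ) ≤ 4 * (c * r * N) := by
    have := two_div_hashP_pow_le hn hr hc
    linarith
  set K := min ⌊c * r⌋₊ d with hK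
  have hKr : (K : ℝ) ≤ c * r :=
    (Nat.cast_le.mpr (min_le_left _ _)).trans (Nat.floor_le (by positivity))
  set X := 24 + n * (d + 3) + R * (4 * ℓ) + R * n + (5 * d + 2 * ℓ + 8) with hX
  have hXle : (X : ℝ) ≤ 460 * (a * c) * G * Real.log G := by
    rw [hX]
    push_cast
    exact space_le hn' hd' hc ha1 hr' hN1 hrG hmn hda (Nat.cast_nonneg _) hl hR3
  -- `Y` dominates all addresses and all intermediate values, so `Y.size` bits per word suffice.
  set Y := X + σ + 100 + P * (σ + 3) with hY
  have hG0 : 0 < G := by linarith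
  have hYle : (Y : ℝ) ≤ 1000 * (a ^ 2 * c) * G ^ 2 := by
    rw [hY]
    push_cast
    exact word_le hn' hd' hc ha1 (Nat.cast_nonneg _) hσa (by exact_mod_cast hP2) hN1 hG'
      ((Real.log_le_sub_one_of_pos hG0).trans (by linarith)) hXle
  have hw : Y < 2 ^ Y.size := Nat.lt_size_self Y
  have hc1 : c ≤ c ^ 4 := le_self_pow₀ hc (by norm_num)
  have ha3 : a ≤ a ^ 2 := le_self_pow₀ ha1 (by norm_num)
  have hac : a ^ 2 * c ≤ c ^ 4 * a ^ 2 := by rw [mul_comm]; gcongr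
  have hac1 : a * c ≤ c ^ 4 * a ^ 2 := by rw [mul_comm]; gcongr
  refine ⟨editIndex n σ d r c P R K Y.size, hashP n r c ^ r / 2, 6 / (n * c * r), ?_,
    editIndex_seeds_pos, ?_, editIndex_isUniform (by omega),
    editIndex_isSensitive hn hd hr hc (by omega) (by omega), ?_, ?_, ?_, ?_, ?_⟩
  · change (Y.size : ℝ) ≤ _
    have h₁ := size_le_two_mul_log (n := Y) (by omega)
    have hY0 : (0 : ℝ) < Y := by
      have : 0 < Y := by omega
      exact_mod_cast this
    have h₂ := Real.log_le_log hY0 hYle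
    rw [Real.log_mul (by positivity) (by positivity), Real.log_pow] at h₂
    have h₃ := Real.log_le_sub_one_of_pos (show 0 < 1000 * (a ^ 2 * c) by positivity)
    have h₄ : 1000 * (c ^ 4 * a ^ 2) ≤ 1000 * (c ^ 4 * a ^ 2) * Real.log G :=
      le_mul_of_one_le_right (by positivity) hLG
    have h₅ : Real.log G ≤ c ^ 4 * a ^ 2 * Real.log G := le_mul_of_one_le_left (by linarith) hca
    push_cast at h₂
    rw [hC]
    linarith
  · change n ≤ P
    have : n ≤ d * n := Nat.le_mul_of_pos_left _ hd
    have : 45 * d * n = 45 * (d * n) := by ring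
    omega
  · exact div_le_div_of_nonneg_left hpr.le (by norm_num) (by linarith)
  · have := one_le_ncr hn hr hc
    gcongr
    linarith
  · change _ ≤ (R : ℝ)
    refine le_trans ?_ hR1
    rw [show (2 : ℝ) / hashP n r c ^ r = 1 / (1 * (hashP n r c ^ r / 2)) by field_simp]
    gcongr
    linarith
  · change (R : ℝ) ≤ _
    refine hR2.trans ?_
    rw [show 2 * ((2 : ℝ) / hashP n r c ^ r) = 2 / (hashP n r c ^ r / 2) by field_simp]
    gcongr
    linarith
  · intro S hS
    refine ⟨fun ω => ?_, fun q hq => ?_⟩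
    · have hsp : (editIndex n σ d r c P R K Y.size).space S ω = X := by
        rw [HashIndex.space]
        change (WordRAM.Inst.words _).length + _ = _
        rw [WordRAM.Inst.length_words]
        rfl
      rw [hsp, softO]
      refine hXle.trans ?_
      have h₁ : Real.log G ≤ Real.log G ^ 4 := le_self_pow₀ hLG (by norm_num)
      gcongr
      linarith
    · have hM := time_le hd' hc hr' hN1 hrg hm (Nat.cast_nonneg ℓ) hl (Nat.cast_nonneg K) hKr
        (Nat.cast_nonneg n.size) (size_le_two_mul_log hn) hR3
      -- The quarter leaves room for the time limit `4M` of `exists_search`.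
      have hM' : 6642000 * c ^ 4 * g * Real.log g ^ 4 ≤ softO C 4 g / 4 := by
        have h₁ : c ^ 4 ≤ c ^ 4 * a ^ 2 := le_mul_of_one_le_right (by linarith) ha2
        have h₂ := mul_le_mul_of_nonneg_right h₁
          (show 0 ≤ g * Real.log g ^ 4 from mul_nonneg (by linarith) (by positivity))
        have h₃ : 0 ≤ c ^ 4 * a ^ 2 * (g * Real.log g ^ 4) :=
          mul_nonneg (by positivity) (mul_nonneg (by linarith) (by positivity))
        rw [softO, hC]
        linarith
      obtain ⟨T, out, h₁, h₂, h₃⟩ := exists_search (P := P) (w := Y.size) (S := S) hn hd hr hc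
        (by omega) (by omega) hS hq hK hR1 (by rw [← hℓ]; omega) (by omega) (hM.trans hM')
      have h0 : 0 ≤ softO C 4 g :=
        mul_nonneg (mul_nonneg hC0.le (by linarith)) (by positivity)
      refine ⟨T, out, h₁, h₂.trans (by linarith), fun h => ?_⟩
      have := h₃ h
      rwa [mul_div_cancel₀ _ (by norm_num : (4 : ℝ) ≠ 0)] at this
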